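/- **Setting.** Let $G$ be a compact Lie group with Lie algebra $\mathfrak g=T_1G$ and let $\langle\cdot,\cdot\rangle$ be an $\mathrm{Ad}$-invariant non-degenerate symmetric bilinear form on $\mathfrak g$ (for instance an $\mathrm{Ad}$-invariant inner product). Let $(e_i)$ be a basis of $\mathfrak g$ and $(e^i)$ the basis with $\langle e^i,e_j\rangle=\delta_{ij}$ (so $e^i=e_i$ if $(e_i)$ is orthonormal). For $x\in\mathfrak g$ let $x^L,x^R$ be the left- and right-invariant vector fields on $G$ with value $x$ at $1$, and for a smooth $G$-manifold $M$ let $x_M(m)=\frac{d}{ds}\big|_{s=0}\exp(-sx)\cdot m$; this extends to $\bigwedge^\bullet\mathfrak g$ multiplicatively. The Cartan trivector is $\phi=\frac1{12}\sum_{i,j,k}\langle e^i,[e^j,e^k]\rangle\,e_i\wedge e_j\wedge e_k$. A *Hamiltonian quasi-Poisson $G$-manifold* $(M,P,\phi_M,\mu)$ is a smooth $G$-manifold with a smooth invariant bivector field $P$ with $[P,P]=\phi_M$ (Schouten bracket) and a smooth $\mathrm{Ad}$-equivariant map $\mu:M\to G$ with $P(d(f\circ\mu),\cdot)=\big((Df)\circ\mu\big)_M$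 for all $f\in C^\infty(G)$, where $Df=\frac12\sum_i\big((e_i^L+e_i^R)f\big)\,e^i$. A *Hamiltonian Poisson $G$-manifold* $(N,P_0,\nu)$ is a smooth $G$-manifold with a smooth invariant bivector field $P_0$ with $[P_0,P_0]=0$ and a smooth coadjoint-equivariant map $\nu:N\to\mathfrak g^*$ with $P_0(d\langle\nu,x\rangle,\cdot)=x_N$ for all $x\in\mathfrak g$. The *deformation space* is $\mathcal G=\mathcal D(G,\{1\})=(G\times\mathbb R^*)\sqcup(\mathfrak g\times\{0\})$, with projection $\pi_{\mathcal G}:\mathcal G\to\mathbb R$ and with the smooth structure for which $G\times\mathbb R^*$ is an open submanifold and $(x,t)\mapsto(\kappa(tx),t)$ for $t\ne0$, $(x,0)\mapsto(x,0)$, is an open smooth parametrisation, where $\kappa$ is a local parametrisation of $G$ near $1$ with $\kappa(0)=1$ and $d\kappa_0=\mathrm{id}_{\mathfrak g}$. The group $G$ acts on $\mathcal G$ by conjugation on $G$ and by the adjoint action on $\mathfrak g$. A *Poisson deformation* of $(M,P,\phi_M,\mu)$ to $(N,P_0,\nu)$ over $S$, where $S=[0,1]$ or $S=\mathbb R$,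 is a smooth $G$-manifold $Q$ (with boundary if $S=[0,1]$) with a $G$-invariant smooth submersion $\pi:Q\to S$, a smooth $G$-equivariant map $\tilde\mu:Q\to\mathcal G$ with $\pi_{\mathcal G}\circ\tilde\mu=\pi$, and smooth sections $\tilde P$ of $\bigwedge^2\ker d\pi$ and $\tilde\Phi$ of $\bigwedge^3\ker d\pi$, such that for $t\in S\setminus\{0\}$ the fibre $\pi^{-1}(t)$ with the restricted data is isomorphic to $(M,tP,t^2\phi_M,\mu)$ (a Hamiltonian quasi-Poisson $G$-manifold for the form $t^{-1}\langle\cdot,\cdot\rangle$), and the fibre $\pi^{-1}(0)$ is isomorphic to $(N,P_0,\nu)$, with $\tilde\Phi=0$ there; the moment maps are compared through $\mathfrak g\cong\mathfrak g^*$, $x\mapsto\langle x,\cdot\rangle$. The isomorphisms are $G$-equivariant diffeomorphisms onto the fibres that match the multivector fields and the moment maps. **Theorem.** Let $P_G=\frac12\sum_i e_i^R\wedge (e^i)^L$, let $\phi_G$ be the trivector field generated by $\phi$ for the conjugation action of $G$ on itself, and let $P_0$ be the linear Poisson bivector field on $\mathfrak g^*$, $P_0(\xi)=\frac12\sum_{j,k}\xi([e_j,e_k])\,\partial_j\wedge\partial_k$,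 where $(\partial_j)$ is the basis of $\mathfrak g^*$ dual to $(e_j)$ (for $(e_j)$ orthonormal and $\xi=\langle x,\cdot\rangle$ this is $-\frac12(\mathrm{ad}_x)_{jk}\,\partial_j\wedge\partial_k$). Then $(G,P_G,\phi_G,\mathrm{Id})$ with the conjugation action is a Hamiltonian quasi-Poisson $G$-manifold, $(\mathfrak g^*,P_0,\mathrm{Id})$ with the coadjoint action is a Hamiltonian Poisson $G$-manifold, and $\mathcal G$, with $\pi=\pi_{\mathcal G}$ and $\tilde\mu=\mathrm{Id}$, carries a Poisson deformation of the first to the second over $\mathbb R$; likewise its part $\pi_{\mathcal G}^{-1}([0,1])$, with $\tilde\mu$ the inclusion into $\mathcal G$, carries one over $[0,1]$. The fibre isomorphisms are the canonical ones, $g\mapsto(g,t)$ for $t\neq0$ and $\langle x,\cdot\rangle\mapsto(x,0)$ for $t=0$. In particular the family $tP_G$ ($t\ne0$) extends smoothly across $t=0$ by $P_0$, and $t^2\phi_G$ extends smoothly by $0$. -/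

import Mathlib

open scoped Manifold ContDiff Topology

set_option linter.unusedSectionVars false

noncomputable section

/-! ### Multivectors and multivector fields -/

section KVectors

variable {V W : Type*} [AddCommGroup V] [Module ℝ V] [TopologicalSpace V]
  [AddCommGroup W] [Module ℝ W] [TopologicalSpace W]

/-- `k`-vectors on a finite-dimensional space `V`: the exterior power `⋀ᵏ V`, realised as the
alternating `k`-linear forms on the dual space `V*`. -/
abbrev KVector (k : ℕ) (V : Type*) [AddCommGroup V] [Module ℝ V] [TopologicalSpace V] :
    Type _ :=
  (V →L[ℝ] ℝ) [⋀^Fin k]→ₗ[ℝ] ℝ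

/-- Evaluation of covectors on a tuple of vectors. -/
def evalTuple {k : ℕ} (v : Fin k → V) : (V →L[ℝ] ℝ) →ₗ[ℝ] (Fin k → ℝ) where
  toFun α j := α (v j)
  map_add' _ _ := rfl
  map_smul' _ _ := rfl

/-- The decomposable `k`-vector `v₁ ∧ ⋯ ∧ v_k`, with value `det (αᵢ(vⱼ))` on `(α₁, …, α_k)`. -/
def wedge {k : ℕ} (v : Fin k → V) : KVector k V :=
  Matrix.detRowAlternating.compLinearMap (evalTuple v)

lemma wedge_apply {k : ℕ} (v : Fin k → V) (α : Fin k → V →L[ℝ] ℝ) :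
    wedge v α = Matrix.det (Matrix.of fun i j => α i (v j)) := rfl

/-- Transpose of a linear map, on covectors. -/
def pullCovector (L : V →L[ℝ] W) : (W →L[ℝ] ℝ) →ₗ[ℝ] (V →L[ℝ] ℝ) where
  toFun α := α.comp L
  map_add' _ _ := rfl
  map_smul' _ _ := rfl

/-- Push-forward `⋀ᵏ L : ⋀ᵏ V → ⋀ᵏ W` of `k`-vectors along a linear map. -/
def KVector.push {k : ℕ} (L : V →L[ℝ] W) (T : KVector k V) : KVector k W :=
  T.compLinearMap (pullCovector L)

end KVectors

section Fields

variable {E H : Type*} [NormedAddCommGroup E] [NormedSpace ℝ E] [TopologicalSpace H]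
  (I : ModelWithCorners ℝ E H)
  {M : Type*} [TopologicalSpace M] [ChartedSpace H M]

/-- The differential at `m` of a real-valued function, as a covector. -/
def covec (f : M → ℝ) (m : M) : TangentSpace I m →L[ℝ] ℝ := mfderiv I 𝓘(ℝ, ℝ) f m

variable (M) in
/-- (Not necessarily smooth) `k`-vector fields on `M`. -/
abbrev KVectorField (k : ℕ) : Type _ := (m : M) → KVector k (TangentSpace I m)

variable {I}

/-- Smoothness of a `k`-vector field: `T(df₁, …, df_k)` is smooth for all locally defined smooth
functions `f₁, …, f_k` (taking coordinate functions: its components in charts are smooth). -/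
def KVectorField.IsSmooth {k : ℕ} (T : KVectorField I M k) : Prop :=
  ∀ U : Set M, IsOpen U → ∀ f : Fin k → M → ℝ,
    (∀ i, ContMDiffOn I 𝓘(ℝ, ℝ) ∞ (f i) U) →
      ContMDiffOn I 𝓘(ℝ, ℝ) ∞ (fun m => T m fun i => covec I (f i) m) U

/-- The bracket `{f, g} = P(df, dg)` of a bivector field. -/
def bivectorBracket (P : KVectorField I M 2) (f g : M → ℝ) (m : M) : ℝ :=
  P m ![covec I f m, covec I g m]

/-- `[P, P] = T` for the Schouten bracket (the graded extension of the Lie bracket to multivector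
fields, so that `[X ∧ Y, X ∧ Y] = 2 [X, Y] ∧ X ∧ Y`): `[P, P]` is the trivector field
determined by `[P, P](df, dg, dh) = 2 ({f, {g, h}} + {g, {h, f}} + {h, {f, g}})`. -/
def IsSchoutenSquare (P : KVectorField I M 2) (T : KVectorField I M 3) : Prop :=
  ∀ U : Set M, IsOpen U → ∀ f g h : M → ℝ,
    ContMDiffOn I 𝓘(ℝ, ℝ) ∞ f U → ContMDiffOn I 𝓘(ℝ, ℝ) ∞ g U →
    ContMDiffOn I 𝓘(ℝ, ℝ) ∞ h U → ∀ m ∈ U,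
      T m ![covec I f m, covec I g m, covec I h m] =
        2 * (bivectorBracket P f (bivectorBracket P g h) m
          + bivectorBracket P g (bivectorBracket P h f) m
          + bivectorBracket P h (bivectorBracket P f g) m)

/-- A `k`-vector field on `M` is a section of `⋀ᵏ (ker dπ)`: it is killed by every covector that
vanishes on `ker dπ`. -/
def KVectorField.IsVertical {F K S : Type*} [NormedAddCommGroup F] [NormedSpace ℝ F]
    [TopologicalSpace K] (J : ModelWithCorners ℝ F K) [TopologicalSpace S] [ChartedSpace K S]
    (p : M → S) {k : ℕ} (T : KVectorField I M k) : Prop :=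
  ∀ (m : M) (α : Fin k → TangentSpace I m →L[ℝ] ℝ),
    (∃ i, ∀ v : TangentSpace I m, mfderiv I J p m v = 0 → α i v = 0) → T m α = 0

end Fields

/-! ### Lie groups: adjoint actions, invariant forms, invariant vector fields -/

section LieGroups

variable {E : Type*} [NormedAddCommGroup E] [NormedSpace ℝ E]
  {G : Type*} [TopologicalSpace G] [ChartedSpace E G] [Group G]

/-- The adjoint action of `g` on the Lie algebra `𝔤 = T₁G`: the derivative at `1` of conjugation. -/
def adj (g : G) : GroupLieAlgebra 𝓘(ℝ, E) G →L[ℝ] GroupLieAlgebra 𝓘(ℝ, E) G :=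
  mfderiv 𝓘(ℝ, E) 𝓘(ℝ, E) (fun h : G => g * h * g⁻¹) (1 : G)

/-- The left-invariant vector field `x^L`, equal to `x` at the identity. -/
def leftField (x : GroupLieAlgebra 𝓘(ℝ, E) G) (g : G) : TangentSpace 𝓘(ℝ, E) g :=
  mfderiv 𝓘(ℝ, E) 𝓘(ℝ, E) (fun h : G => g * h) (1 : G) x

/-- The right-invariant vector field `x^R`, equal to `x` at the identity. -/
def rightField (x : GroupLieAlgebra 𝓘(ℝ, E) G) (g : G) : TangentSpace 𝓘(ℝ, E) g :=
  mfderiv 𝓘(ℝ, E) 𝓘(ℝ, E) (fun h : G => h * g) (1 : G) x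

/-- The coadjoint action of `g` on `𝔤*`; the Lie algebra `𝔤 = T₁G` has `E` as underlying space. -/
def coadj (g : G) (ξ : E →L[ℝ] ℝ) : E →L[ℝ] ℝ :=
  ContinuousLinearMap.comp (M₁ := E) (M₂ := E) ξ (adj g⁻¹)

variable (E G) in
/-- A nondegenerate symmetric `Ad`-invariant bilinear form on the Lie algebra of `G`. -/
structure InvariantForm where
  form : LinearMap.BilinForm ℝ (GroupLieAlgebra 𝓘(ℝ, E) G)
  symm : form.IsSymm
  nondegenerate : form.Nondegenerate
  invariant : ∀ (g : G) (x y : GroupLieAlgebra 𝓘(ℝ, E) G), form (adj g x) (adj g y) = form x y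

/-- The rescaled form `c · ⟨ , ⟩` for `c ≠ 0`. -/
def InvariantForm.scale (B : InvariantForm E G) (c : ℝ) (hc : c ≠ 0) : InvariantForm E G where
  form := c • B.form
  symm := ⟨fun x y => by simp [B.symm.eq x y]⟩
  nondegenerate := by
    refine ⟨fun x hx => B.nondegenerate.1 x fun y => ?_,
      fun x hx => B.nondegenerate.2 x fun y => ?_⟩
    · have := hx y
      simpa [hc] using this
    · have := hx y
      simpa [hc] using this
  invariant g x y := by simp [B.invariant g x y]

/-- The element of `𝔤` that corresponds to `ξ ∈ 𝔤*` under `𝔤 ≅ 𝔤*`, `x ↦ ⟨x, ·⟩`. -/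
def InvariantForm.sharp [FiniteDimensional ℝ E] (B : InvariantForm E G) (ξ : E →L[ℝ] ℝ) :
    GroupLieAlgebra 𝓘(ℝ, E) G :=
  haveI : FiniteDimensional ℝ (GroupLieAlgebra 𝓘(ℝ, E) G) :=
    inferInstanceAs (FiniteDimensional ℝ E)
  (B.form.toDual B.nondegenerate).symm (ξ : E →ₗ[ℝ] ℝ)

variable {ι : Type*} [Fintype ι] [DecidableEq ι]

/-- The basis `(eⁱ)` with `⟨eⁱ, eⱼ⟩ = δᵢⱼ`. It is `(eᵢ)` itself when `(eᵢ)` is orthonormal. -/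
def InvariantForm.dual (B : InvariantForm E G)
    (e : Module.Basis ι ℝ (GroupLieAlgebra 𝓘(ℝ, E) G)) :
    Module.Basis ι ℝ (GroupLieAlgebra 𝓘(ℝ, E) G) :=
  B.form.dualBasis B.nondegenerate e

/-- The bivector field `P_G = ½ ∑ᵢ eᵢ^R ∧ (eⁱ)^L` on `G`. -/
def groupBivector (B : InvariantForm E G)
    (e : Module.Basis ι ℝ (GroupLieAlgebra 𝓘(ℝ, E) G)) : KVectorField 𝓘(ℝ, E) G 2 :=
  fun g => (1 / 2 : ℝ) • ∑ i, wedge ![rightField (e i) g, leftField (B.dual e i) g]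

/-- The linear Poisson (Lie–Poisson) bivector field on `𝔤*`: at `ξ` it is
`½ ∑ⱼₖ ξ([eⱼ, eₖ]) ∂ⱼ ∧ ∂ₖ`, where `∂ⱼ ∈ 𝔤*` is the `j`-th vector of the basis dual to `(eⱼ)`.
For `(eⱼ)` orthonormal and `ξ = ⟨x, ·⟩` one has `ξ([eⱼ, eₖ]) = -⟨eⱼ, [x, eₖ]⟩ = -(ad_x)ⱼₖ`. -/
def linearBivector (e : Module.Basis ι ℝ (GroupLieAlgebra 𝓘(ℝ, E) G)) [FiniteDimensional ℝ E] :
    KVectorField 𝓘(ℝ, E →L[ℝ] ℝ) (E →L[ℝ] ℝ) 2 :=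
  let d : ι → (E →L[ℝ] ℝ) := fun j => LinearMap.toContinuousLinearMap (E := E) (e.coord j)
  fun ξ => (1 / 2 : ℝ) • ∑ j, ∑ k,
    (ξ (⁅e j, e k⁆ : GroupLieAlgebra 𝓘(ℝ, E) G)) •
      wedge (V := TangentSpace 𝓘(ℝ, E →L[ℝ] ℝ) ξ) ![d j, d k]

end LieGroups

/-! ### `G`-manifolds, Hamiltonian quasi-Poisson and Hamiltonian Poisson manifolds -/

section Hamiltonian

variable {E : Type*} [NormedAddCommGroup E] [NormedSpace ℝ E]
  {G : Type*} [TopologicalSpace G] [ChartedSpace E G] [Group G]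
  {ι : Type*} [Fintype ι] [DecidableEq ι]
  {E' H' : Type*} [NormedAddCommGroup E'] [NormedSpace ℝ E'] [TopologicalSpace H']
  (I : ModelWithCorners ℝ E' H') {M : Type*} [TopologicalSpace M] [ChartedSpace H' M]

/-- `a : G → M → M` is a smooth left action of `G` on `M`. -/
structure IsSmoothAction (a : G → M → M) : Prop where
  one : ∀ m, a 1 m = m
  mul : ∀ g h m, a (g * h) m = a g (a h m)
  smooth : ContMDiff (𝓘(ℝ, E).prod I) I ∞ fun p : G × M => a p.1 p.2

/-- The fundamental vector field `x_M(m) = d/dt|₀ exp(-tx)·m`, that is, minus the derivative at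
`1` of the orbit map `g ↦ g·m`, applied to `x`. -/
def fundamental (a : G → M → M) (x : GroupLieAlgebra 𝓘(ℝ, E) G) (m : M) : TangentSpace I m :=
  -(mfderiv 𝓘(ℝ, E) I (fun g : G => a g m) 1 x : E')

/-- The trivector field `φ_M` generated by the Cartan trivector
`φ = 1/12 ∑ ⟨eⁱ, [eʲ, eᵏ]⟩ eᵢ ∧ eⱼ ∧ eₖ` of `⟨ , ⟩`. -/
def cartanField (B : InvariantForm E G) (e : Module.Basis ι ℝ (GroupLieAlgebra 𝓘(ℝ, E) G))
    (a : G → M → M) : KVectorField I M 3 :=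
  fun m => (1 / 12 : ℝ) • ∑ i, ∑ j, ∑ k,
    (B.form (B.dual e i) ⁅B.dual e j, B.dual e k⁆) •
      wedge ![fundamental I a (e i) m, fundamental I a (e j) m, fundamental I a (e k) m]

/-- Invariance of a multivector field under an action. -/
def KVectorField.IsInvariant {k : ℕ} {I : ModelWithCorners ℝ E' H'} (T : KVectorField I M k) (a : G → M → M) : Prop :=
  ∀ g m, (T m).push (mfderiv I I (a g) m) = T (a g m)

/-- The `𝔤`-valued differential operator `D = ½ ∑ᵢ eⁱ ⊗ (eᵢ^L + eᵢ^R)` on functions on `G`. -/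
def momentOperator (B : InvariantForm E G) (e : Module.Basis ι ℝ (GroupLieAlgebra 𝓘(ℝ, E) G))
    (f : G → ℝ) (g : G) : GroupLieAlgebra 𝓘(ℝ, E) G :=
  (1 / 2 : ℝ) • ∑ i, (covec 𝓘(ℝ, E) f g (leftField (e i) g + rightField (e i) g)) • B.dual e i

/-- `(M, P, φ_M, μ)` with the action `a` is a Hamiltonian quasi-Poisson `G`-manifold with respect
to the invariant form `B`: the bivector field `P` is invariant, `[P, P] = φ_M` is the trivector
field generated by the Cartan trivector, and the `Ad`-equivariant map `μ : M → G` satisfies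
`P(d(f ∘ μ), ·) = ((D f) ∘ μ)_M` for all smooth functions `f` on `G`. -/
structure IsHamiltonianQuasiPoisson (B : InvariantForm E G)
    (e : Module.Basis ι ℝ (GroupLieAlgebra 𝓘(ℝ, E) G)) (a : G → M → M)
    (P : KVectorField I M 2) (Φ : KVectorField I M 3) (μ : M → G) : Prop where
  action : IsSmoothAction (E := E) I a
  smooth : P.IsSmooth
  invariant : P.IsInvariant a
  trivector : Φ = cartanField I B e a
  jacobi : IsSchoutenSquare P Φ
  moment_smooth : ContMDiff I 𝓘(ℝ, E) ∞ μ
  moment_equivariant : ∀ g m, μ (a g m) = g * μ m * g⁻¹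
  moment : ∀ f : G → ℝ, ContMDiff 𝓘(ℝ, E) 𝓘(ℝ, ℝ) ∞ f →
    ∀ (m : M) (β : TangentSpace I m →L[ℝ] ℝ),
      P m ![covec I (f ∘ μ) m, β] = β (fundamental I a (momentOperator B e f (μ m)) m)

/-- `(N, P, ν)` with the action `a` is a Hamiltonian Poisson `G`-manifold: `P` is an invariant
Poisson bivector field and the coadjoint-equivariant map `ν : N → 𝔤*` satisfies
`P(d⟨ν, x⟩, ·) = x_N` for all `x ∈ 𝔤`. -/
structure IsHamiltonianPoisson (a : G → M → M) (P : KVectorField I M 2)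
    (ν : M → (E →L[ℝ] ℝ)) : Prop where
  action : IsSmoothAction (E := E) I a
  smooth : P.IsSmooth
  invariant : P.IsInvariant a
  jacobi : IsSchoutenSquare P fun _ => 0
  moment_smooth : ContMDiff I 𝓘(ℝ, E →L[ℝ] ℝ) ∞ ν
  moment_equivariant : ∀ g m, ν (a g m) = coadj g (ν m)
  moment : ∀ (x : GroupLieAlgebra 𝓘(ℝ, E) G) (m : M) (β : TangentSpace I m →L[ℝ] ℝ),
    P m ![covec I (fun n => ν n (x : E)) m, β] = β (fundamental I a x m)

end Hamiltonian

/-! ### The deformation space -/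

section DeformationSpace

/-- The deformation space of `G` at the identity over a base `S` with parameter `τ : S → ℝ`:
the group `G` over the points with `τ ≠ 0` and the Lie algebra `𝔤` over the points with `τ = 0`.
For `S = ℝ`, `τ = id` this is `𝒢 = D(G, {1}) = (G × ℝ*) ⊔ (𝔤 × {0})`; for the inclusion
`[0,1] ⊆ ℝ` it is the part of `𝒢` over `[0,1]`. (`H` is the model space of the base.) -/
inductive DefSpace (E H G : Type*) [NormedAddCommGroup E] [NormedSpace ℝ E]
    [TopologicalSpace G] [ChartedSpace E G] [Group G] {S : Type*} [TopologicalSpace S]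
    (τ : C(S, ℝ)) : Type _
  | grp (g : G) (t : S) (ht : τ t ≠ 0)
  | lie (x : GroupLieAlgebra 𝓘(ℝ, E) G) (t : S) (ht : τ t = 0)

namespace DefSpace

variable {E H G : Type*} [NormedAddCommGroup E] [NormedSpace ℝ E]
  [TopologicalSpace G] [ChartedSpace E G] [Group G] {S : Type*} [TopologicalSpace S]
  {τ : C(S, ℝ)}

/-- The projection to the base. -/
def proj : DefSpace E H G τ → S
  | grp _ t _ => t
  | lie _ t _ => t

/-- The `G`-action: conjugation on `G`, the adjoint action on `𝔤`. -/
def act (h : G) : DefSpace E H G τ → DefSpace E H G τ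
  | grp g t ht => grp (h * g * h⁻¹) t ht
  | lie x t ht => lie (adj h x) t ht

open Classical in
/-- The point over `t` given by `g` if `τ t ≠ 0` and by `x` if `τ t = 0`. -/
def mk (g : G) (x : E) (t : S) : DefSpace E H G τ :=
  if ht : τ t = 0 then lie x t ht else grp g t ht

lemma mk_of_eq (g : G) (x : E) {t : S} (ht : τ t = 0) :
    (mk g x t : DefSpace E H G τ) = lie x t ht := dif_pos ht

lemma mk_of_ne (g : G) (x : E) {t : S} (ht : τ t ≠ 0) :
    (mk g x t : DefSpace E H G τ) = grp g t ht := dif_neg ht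

variable [TopologicalSpace H]

/-- The product chart of `G × {τ ≠ 0}` given by charts of `G` and of the base. -/
def grpChart (c : OpenPartialHomeomorph G E) (d : OpenPartialHomeomorph S H) :
    PartialEquiv (DefSpace E H G τ) (ModelProd E H) where
  toFun
    | grp g t _ => (c g, d t)
    | lie x t _ => (x, d t)
  invFun p := mk (c.symm p.1) p.1 (d.symm p.2)
  source := {q | ∃ g t ht, q = grp g t ht ∧ g ∈ c.source ∧ t ∈ d.source}
  target := {p | p.1 ∈ c.target ∧ p.2 ∈ d.target ∧ τ (d.symm p.2) ≠ 0}
  map_source' := by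
    rintro _ ⟨g, t, ht, rfl, hg, htd⟩
    refine ⟨c.map_source hg, d.map_source htd, ?_⟩
    simpa [d.left_inv htd] using ht
  map_target' := by
    rintro ⟨v, h⟩ ⟨hv, hh, hτ⟩
    exact ⟨_, _, hτ, mk_of_ne _ _ hτ, c.map_target hv, d.map_target hh⟩
  left_inv' := by
    rintro _ ⟨g, t, ht, rfl, hg, htd⟩
    simp only [c.left_inv hg, d.left_inv htd]
    exact mk_of_ne _ _ ht
  right_inv' := by
    rintro ⟨v, h⟩ ⟨hv, hh, hτ⟩
    simp only [mk_of_ne _ _ hτ]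
    exact Prod.ext (c.right_inv hv) (d.right_inv hh)

/-- The chart of the deformation space at `𝔤 × {τ = 0}`. Let `c` be the preferred chart of `G` at
`1` and `κ(v) = c⁻¹(c(1) + v)`; by definition of the tangent space `𝔤 = T₁G`, the derivative of
`κ` at `0` is the identity of `𝔤`. The chart is the inverse of
`(x, t) ↦ (κ(τ(t) x), t)` for `τ(t) ≠ 0`, `(x, t) ↦ (x, t)` for `τ(t) = 0`. As is usual for a
deformation to the normal cone, any other `κ` with `κ(0) = 1` and derivative the identity
(for instance `exp`) gives the same smooth structure. -/
def lieChart (d : OpenPartialHomeomorph S H) :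
    PartialEquiv (DefSpace E H G τ) (ModelProd E H) where
  toFun
    | grp g t _ => ((τ t)⁻¹ • (chartAt E (1 : G) g - chartAt E (1 : G) 1), d t)
    | lie x t _ => (x, d t)
  invFun p := mk ((chartAt E (1 : G)).symm (chartAt E (1 : G) 1 + τ (d.symm p.2) • p.1)) p.1
    (d.symm p.2)
  source := {q | q.proj ∈ d.source ∧ ∀ g t ht, q = grp g t ht → g ∈ (chartAt E (1 : G)).source}
  target := {p | p.2 ∈ d.target ∧
    chartAt E (1 : G) 1 + τ (d.symm p.2) • p.1 ∈ (chartAt E (1 : G)).target}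
  map_source' := by
    rintro (⟨g, t, ht⟩ | ⟨x, t, ht⟩) ⟨htd, hg⟩
    · have hg := hg g t ht rfl
      refine ⟨d.map_source htd, ?_⟩
      have : d.symm (d t) = t := d.left_inv htd
      simp only [this, smul_smul, mul_inv_cancel₀ ht, one_smul, add_sub_cancel]
      exact (chartAt E (1 : G)).map_source hg
    · refine ⟨d.map_source htd, ?_⟩
      have : d.symm (d t) = t := d.left_inv htd
      simp only [this, ht]
      have h0 : ∀ y : E, chartAt E (1 : G) 1 + (0 : ℝ) • y = chartAt E (1 : G) 1 := fun y => by
        rw [zero_smul, add_zero]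
      exact (congrArg (· ∈ (chartAt E (1 : G)).target) (h0 x)).mpr (mem_chart_target E (1 : G))
  map_target' := by
    rintro ⟨v, h⟩ ⟨hh, hv⟩
    by_cases hτ : τ (d.symm h) = 0
    · simp only [mk_of_eq _ _ hτ]
      exact ⟨d.map_target hh, fun _ _ _ hq => by cases hq⟩
    · simp only [mk_of_ne _ _ hτ]
      refine ⟨d.map_target hh, fun g t ht hq => ?_⟩
      cases hq
      exact (chartAt E (1 : G)).map_target hv
  left_inv' := by
    rintro (⟨g, t, ht⟩ | ⟨x, t, ht⟩) ⟨htd, hg⟩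
    · have hg := hg g t ht rfl
      have h1 : d.symm (d t) = t := d.left_inv htd
      simp only [h1, smul_smul, mul_inv_cancel₀ ht, one_smul, add_sub_cancel,
        (chartAt E (1 : G)).left_inv hg]
      exact mk_of_ne _ _ ht
    · have h1 : d.symm (d t) = t := d.left_inv htd
      simp only [h1]
      exact mk_of_eq _ _ ht
  right_inv' := by
    rintro ⟨v, h⟩ ⟨hh, hv⟩
    by_cases hτ : τ (d.symm h) = 0
    · simp only [mk_of_eq _ _ hτ]
      exact Prod.ext rfl (d.right_inv hh)
    · simp only [mk_of_ne _ _ hτ]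
      refine Prod.ext ?_ (d.right_inv hh)
      simp only [(chartAt E (1 : G)).right_inv hv, add_sub_cancel_left, smul_smul,
        inv_mul_cancel₀ hτ, one_smul]

lemma grp_grp_source (c c' : OpenPartialHomeomorph G E) (d d' : OpenPartialHomeomorph S H) :
    ((grpChart (τ := τ) c d).symm.trans (grpChart c' d')).source =
      {p | p.1 ∈ c.target ∧ p.2 ∈ d.target ∧ τ (d.symm p.2) ≠ 0 ∧
        c.symm p.1 ∈ c'.source ∧ d.symm p.2 ∈ d'.source} := by
  ext ⟨v, h⟩
  rw [PartialEquiv.trans_source]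
  constructor
  · rintro ⟨⟨hv, hh, hτ⟩, g, t, ht, hq, hg, htd⟩
    have hq' : (mk (c.symm v) v (d.symm h) : DefSpace E H G τ) = grp g t ht := hq
    rw [mk_of_ne _ _ hτ] at hq'
    cases hq'
    exact ⟨hv, hh, hτ, hg, htd⟩
  · rintro ⟨hv, hh, hτ, hg, htd⟩
    exact ⟨⟨hv, hh, hτ⟩, _, _, hτ, mk_of_ne _ _ hτ, hg, htd⟩

lemma grp_lie_source (c : OpenPartialHomeomorph G E) (d d' : OpenPartialHomeomorph S H) :
    ((grpChart (τ := τ) c d).symm.trans (lieChart d')).source =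
      {p | p.1 ∈ c.target ∧ p.2 ∈ d.target ∧ τ (d.symm p.2) ≠ 0 ∧
        c.symm p.1 ∈ (chartAt E (1 : G)).source ∧ d.symm p.2 ∈ d'.source} := by
  ext ⟨v, h⟩
  rw [PartialEquiv.trans_source]
  constructor
  · rintro ⟨⟨hv, hh, hτ⟩, htd, hg⟩
    have e1 : (grpChart (τ := τ) c d).symm (v, h) = grp (c.symm v) (d.symm h) hτ :=
      mk_of_ne _ _ hτ
    rw [e1] at htd hg
    exact ⟨hv, hh, hτ, hg _ _ _ rfl, htd⟩
  · rintro ⟨hv, hh, hτ, hg, htd⟩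
    refine ⟨⟨hv, hh, hτ⟩, ?_⟩
    have e1 : (grpChart (τ := τ) c d).symm (v, h) = grp (c.symm v) (d.symm h) hτ :=
      mk_of_ne _ _ hτ
    rw [Set.mem_preimage, e1]
    exact ⟨htd, fun _ _ _ hq => by cases hq; exact hg⟩

lemma lie_grp_source (c : OpenPartialHomeomorph G E) (d d' : OpenPartialHomeomorph S H) :
    ((lieChart (G := G) (τ := τ) d).symm.trans (grpChart c d')).source =
      {p | (p.2 ∈ d.target ∧ chartAt E (1 : G) 1 + τ (d.symm p.2) • p.1 ∈
          (chartAt E (1 : G)).target) ∧ τ (d.symm p.2) ≠ 0 ∧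
        (chartAt E (1 : G)).symm (chartAt E (1 : G) 1 + τ (d.symm p.2) • p.1) ∈ c.source ∧
        d.symm p.2 ∈ d'.source} := by
  ext ⟨v, h⟩
  rw [PartialEquiv.trans_source]
  constructor
  · rintro ⟨hvh, g, t, ht, hq, hg, htd⟩
    have hq' : (mk _ v (d.symm h) : DefSpace E H G τ) = grp g t ht := hq
    by_cases hτ : τ (d.symm h) = 0
    · rw [mk_of_eq _ _ hτ] at hq'
      cases hq'
    · rw [mk_of_ne _ _ hτ] at hq'
      cases hq'
      exact ⟨hvh, hτ, hg, htd⟩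
  · rintro ⟨hvh, hτ, hg, htd⟩
    exact ⟨hvh, _, _, hτ, mk_of_ne _ _ hτ, hg, htd⟩

lemma lie_lie_source (d d' : OpenPartialHomeomorph S H) :
    ((lieChart (E := E) (G := G) (τ := τ) d).symm.trans (lieChart d')).source =
      {p | (p.2 ∈ d.target ∧ chartAt E (1 : G) 1 + τ (d.symm p.2) • p.1 ∈
          (chartAt E (1 : G)).target) ∧ d.symm p.2 ∈ d'.source} := by
  ext ⟨v, h⟩
  rw [PartialEquiv.trans_source]
  by_cases hτ : τ (d.symm h) = 0
  · have e1 : (lieChart (E := E) (G := G) (τ := τ) d).symm (v, h) = lie v (d.symm h) hτ :=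
      mk_of_eq _ _ hτ
    constructor
    · rintro ⟨hvh, htd, hg⟩
      rw [e1] at htd
      exact ⟨hvh, htd⟩
    · rintro ⟨hvh, htd⟩
      refine ⟨hvh, ?_⟩
      rw [Set.mem_preimage, e1]
      exact ⟨htd, fun _ _ _ hq => by cases hq⟩
  · have e1 : (lieChart (E := E) (G := G) (τ := τ) d).symm (v, h) =
        grp ((chartAt E (1 : G)).symm (chartAt E (1 : G) 1 + τ (d.symm h) • v)) (d.symm h) hτ :=
      mk_of_ne _ _ hτ
    constructor
    · rintro ⟨hvh, htd, hg⟩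
      rw [e1] at htd
      exact ⟨hvh, htd⟩
    · rintro ⟨hvh, htd⟩
      refine ⟨hvh, ?_⟩
      rw [Set.mem_preimage, e1]
      exact ⟨htd, fun _ _ _ hq => by cases hq; exact (chartAt E (1 : G)).map_target hvh.2⟩

/-- The parameter, read in a chart of the base. -/
lemma continuousOn_param (d : OpenPartialHomeomorph S H) :
    ContinuousOn (fun p : ModelProd E H => τ (d.symm p.2)) {p | p.2 ∈ d.target} :=
  τ.continuous.comp_continuousOn (d.continuousOn_symm.comp continuous_snd.continuousOn
    fun _ hp => hp)

lemma isOpen_base (d : OpenPartialHomeomorph S H) :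
    IsOpen {p : ModelProd E H | p.2 ∈ d.target} :=
  d.open_target.preimage continuous_snd

lemma continuousOn_affine (d : OpenPartialHomeomorph S H) :
    ContinuousOn (fun p : ModelProd E H => chartAt E (1 : G) 1 + τ (d.symm p.2) • p.1)
      {p | p.2 ∈ d.target} :=
  continuousOn_const.add ((continuousOn_param d).smul continuous_fst.continuousOn)

lemma isOpen_grp_target (c : OpenPartialHomeomorph G E) (d : OpenPartialHomeomorph S H) :
    IsOpen (grpChart (τ := τ) c d).target := by
  have h1 := (continuousOn_param (E := E) (τ := τ) d).isOpen_inter_preimage (isOpen_base d)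
    (isOpen_compl_singleton (x := (0 : ℝ)))
  convert! (c.open_target.preimage continuous_fst).inter h1 using 1

lemma isOpen_lie_target (d : OpenPartialHomeomorph S H) :
    IsOpen (lieChart (E := E) (G := G) (τ := τ) d).target :=
  (continuousOn_affine d).isOpen_inter_preimage (isOpen_base d) (chartAt E (1 : G)).open_target

lemma isOpen_change (d d' : OpenPartialHomeomorph S H) :
    IsOpen {p : ModelProd E H | p.2 ∈ d.target ∧ d.symm p.2 ∈ d'.source} :=
  (d.symm.trans d').open_source.preimage continuous_snd

lemma isOpen_change_fst (c c' : OpenPartialHomeomorph G E) :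
    IsOpen {p : ModelProd E H | p.1 ∈ c.target ∧ c.symm p.1 ∈ c'.source} :=
  (c.symm.trans c').open_source.preimage continuous_fst

lemma continuousOn_change (d d' : OpenPartialHomeomorph S H) :
    ContinuousOn (fun p : ModelProd E H => d' (d.symm p.2))
      {p | p.2 ∈ d.target ∧ d.symm p.2 ∈ d'.source} :=
  d'.continuousOn.comp (d.continuousOn_symm.comp continuous_snd.continuousOn fun _ hp => hp.1)
    fun _ hp => hp.2

lemma continuousOn_change_fst (c c' : OpenPartialHomeomorph G E) :
    ContinuousOn (fun p : ModelProd E H => c' (c.symm p.1))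
      {p | p.1 ∈ c.target ∧ c.symm p.1 ∈ c'.source} :=
  c'.continuousOn.comp (c.continuousOn_symm.comp continuous_fst.continuousOn fun _ hp => hp.1)
    fun _ hp => hp.2

lemma isOpen_grp_grp (c c' : OpenPartialHomeomorph G E) (d d' : OpenPartialHomeomorph S H) :
    IsOpen ((grpChart (τ := τ) c d).symm.trans (grpChart c' d')).source := by
  rw [grp_grp_source]
  convert! ((isOpen_grp_target (τ := τ) c d).inter (isOpen_change_fst c c')).inter
    (isOpen_change d d') using 1
  ext p
  exact ⟨fun ⟨a, b, e, f, g⟩ => ⟨⟨⟨a, b, e⟩, a, f⟩, b, g⟩,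
    fun ⟨⟨⟨a, b, e⟩, _, f⟩, _, g⟩ => ⟨a, b, e, f, g⟩⟩

lemma continuousOn_grp_grp (c c' : OpenPartialHomeomorph G E)
    (d d' : OpenPartialHomeomorph S H) :
    ContinuousOn ((grpChart (τ := τ) c d).symm.trans (grpChart c' d'))
      ((grpChart (τ := τ) c d).symm.trans (grpChart c' d')).source := by
  rw [grp_grp_source]
  refine (((continuousOn_change_fst c c').mono fun p hp => ⟨hp.1, hp.2.2.2.1⟩).prodMk
    ((continuousOn_change d d').mono fun p hp => ⟨hp.2.1, hp.2.2.2.2⟩)).congr ?_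
  rintro ⟨v, h⟩ ⟨_, _, hτ, _, _⟩
  exact congrArg (grpChart (τ := τ) c' d') (mk_of_ne _ _ hτ)

lemma isOpen_grp_lie (c : OpenPartialHomeomorph G E) (d d' : OpenPartialHomeomorph S H) :
    IsOpen ((grpChart (τ := τ) c d).symm.trans (lieChart d')).source := by
  rw [grp_lie_source, ← grp_grp_source]
  exact isOpen_grp_grp c _ d d'

lemma continuousOn_grp_lie (c : OpenPartialHomeomorph G E) (d d' : OpenPartialHomeomorph S H) :
    ContinuousOn ((grpChart (τ := τ) c d).symm.trans (lieChart d'))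
      ((grpChart (τ := τ) c d).symm.trans (lieChart d')).source := by
  rw [grp_lie_source]
  have h1 : ContinuousOn (fun p : ModelProd E H => (τ (d.symm p.2))⁻¹ •
      (chartAt E (1 : G) (c.symm p.1) - chartAt E (1 : G) 1))
      {p | p.1 ∈ c.target ∧ p.2 ∈ d.target ∧ τ (d.symm p.2) ≠ 0 ∧
        c.symm p.1 ∈ (chartAt E (1 : G)).source ∧ d.symm p.2 ∈ d'.source} :=
    (((continuousOn_param d).mono fun p hp => hp.2.1).inv₀ fun p hp => hp.2.2.1).smul
      (((continuousOn_change_fst c (chartAt E (1 : G))).mono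
        fun p hp => ⟨hp.1, hp.2.2.2.1⟩).sub continuousOn_const)
  refine (h1.prodMk
    ((continuousOn_change d d').mono fun p hp => ⟨hp.2.1, hp.2.2.2.2⟩)).congr ?_
  rintro ⟨v, h⟩ ⟨_, _, hτ, _, _⟩
  exact congrArg (lieChart (τ := τ) d') (mk_of_ne _ _ hτ)

lemma isOpen_lie_grp (c : OpenPartialHomeomorph G E) (d d' : OpenPartialHomeomorph S H) :
    IsOpen ((lieChart (G := G) (τ := τ) d).symm.trans (grpChart c d')).source := by
  rw [lie_grp_source]
  have h1 := (continuousOn_param (E := E) (τ := τ) d).isOpen_inter_preimage (isOpen_base d)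
    (isOpen_compl_singleton (x := (0 : ℝ)))
  have h2 := (continuousOn_affine (G := G) (τ := τ) d).isOpen_inter_preimage (isOpen_base d)
    ((chartAt E (1 : G)).symm.trans c).open_source
  convert! (h1.inter h2).inter (isOpen_change d d') using 1
  ext p
  exact ⟨fun ⟨⟨a, b⟩, e, f, g⟩ => ⟨⟨⟨a, e⟩, a, b, f⟩, a, g⟩,
    fun ⟨⟨⟨a, e⟩, _, b, f⟩, _, g⟩ => ⟨⟨a, b⟩, e, f, g⟩⟩

lemma continuousOn_lie_grp (c : OpenPartialHomeomorph G E) (d d' : OpenPartialHomeomorph S H) :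
    ContinuousOn ((lieChart (G := G) (τ := τ) d).symm.trans (grpChart c d'))
      ((lieChart (G := G) (τ := τ) d).symm.trans (grpChart c d')).source := by
  rw [lie_grp_source]
  have h1 : ContinuousOn (fun p : ModelProd E H => c ((chartAt E (1 : G)).symm
      (chartAt E (1 : G) 1 + τ (d.symm p.2) • p.1)))
      {p | (p.2 ∈ d.target ∧ chartAt E (1 : G) 1 + τ (d.symm p.2) • p.1 ∈
          (chartAt E (1 : G)).target) ∧ τ (d.symm p.2) ≠ 0 ∧
        (chartAt E (1 : G)).symm (chartAt E (1 : G) 1 + τ (d.symm p.2) • p.1) ∈ c.source ∧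
        d.symm p.2 ∈ d'.source} :=
    c.continuousOn.comp ((chartAt E (1 : G)).continuousOn_symm.comp
      ((continuousOn_affine d).mono fun p hp => hp.1.1) fun p hp => hp.1.2) fun p hp => hp.2.2.1
  refine (h1.prodMk
    ((continuousOn_change d d').mono fun p hp => ⟨hp.1.1, hp.2.2.2⟩)).congr ?_
  rintro ⟨v, h⟩ ⟨_, hτ, _, _⟩
  exact congrArg (grpChart (τ := τ) c d') (mk_of_ne _ _ hτ)

lemma isOpen_lie_lie (d d' : OpenPartialHomeomorph S H) :
    IsOpen ((lieChart (E := E) (G := G) (τ := τ) d).symm.trans (lieChart d')).source := by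
  rw [lie_lie_source]
  convert! (isOpen_lie_target (E := E) (G := G) (τ := τ) d).inter (isOpen_change d d') using 1
  ext p
  exact ⟨fun ⟨a, b⟩ => ⟨a, a.1, b⟩, fun ⟨a, _, b⟩ => ⟨a, b⟩⟩

lemma continuousOn_lie_lie (d d' : OpenPartialHomeomorph S H) :
    ContinuousOn ((lieChart (E := E) (G := G) (τ := τ) d).symm.trans (lieChart d'))
      ((lieChart (E := E) (G := G) (τ := τ) d).symm.trans (lieChart d')).source := by
  rw [lie_lie_source]
  refine ((continuous_fst.continuousOn).prodMk
    ((continuousOn_change d d').mono fun p hp => ⟨hp.1.1, hp.2⟩)).congr ?_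
  rintro ⟨v, h⟩ ⟨⟨hh, hv⟩, hd⟩
  by_cases hτ : τ (d.symm h) = 0
  · exact congrArg (lieChart (E := E) (G := G) (τ := τ) d') (mk_of_eq _ _ hτ)
  · refine (congrArg (lieChart (E := E) (G := G) (τ := τ) d') (mk_of_ne _ _ hτ)).trans ?_
    refine Prod.ext ?_ rfl
    change (τ (d.symm h))⁻¹ • (chartAt E (1 : G) ((chartAt E (1 : G)).symm
      (chartAt E (1 : G) 1 + τ (d.symm h) • v)) - chartAt E (1 : G) 1) = v
    rw [(chartAt E (1 : G)).right_inv hv, add_sub_cancel_left, smul_smul, inv_mul_cancel₀ hτ,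
      one_smul]

variable [ChartedSpace H S]

variable (E H G τ) in
/-- The atlas of the deformation space. -/
def core : ChartedSpaceCore (ModelProd E H) (DefSpace E H G τ) where
  atlas := {e | (∃ c ∈ atlas E G, ∃ d ∈ atlas H S, e = grpChart c d) ∨
    ∃ d ∈ atlas H S, e = lieChart d}
  chartAt
    | grp g t _ => grpChart (chartAt E g) (chartAt H t)
    | lie _ t _ => lieChart (chartAt H t)
  mem_chart_source := by
    rintro (⟨g, t, ht⟩ | ⟨x, t, ht⟩)
    · exact ⟨g, t, ht, rfl, mem_chart_source E g, mem_chart_source H t⟩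
    · exact ⟨mem_chart_source H t, fun _ _ _ hq => by cases hq⟩
  chart_mem_atlas := by
    rintro (⟨g, t, ht⟩ | ⟨x, t, ht⟩)
    · exact Or.inl ⟨_, chart_mem_atlas E g, _, chart_mem_atlas H t, rfl⟩
    · exact Or.inr ⟨_, chart_mem_atlas H t, rfl⟩
  open_source := by
    rintro _ _ (⟨c, -, d, -, rfl⟩ | ⟨d, -, rfl⟩) (⟨c', -, d', -, rfl⟩ | ⟨d', -, rfl⟩)
    · exact isOpen_grp_grp c c' d d'
    · exact isOpen_grp_lie c d d'
    · exact isOpen_lie_grp c' d d'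
    · exact isOpen_lie_lie d d'
  continuousOn_toFun := by
    rintro _ _ (⟨c, -, d, -, rfl⟩ | ⟨d, -, rfl⟩) (⟨c', -, d', -, rfl⟩ | ⟨d', -, rfl⟩)
    · exact continuousOn_grp_grp c c' d d'
    · exact continuousOn_grp_lie c d d'
    · exact continuousOn_lie_grp c' d d'
    · exact continuousOn_lie_lie d d'

instance : TopologicalSpace (DefSpace E H G τ) := (core E H G τ).toTopologicalSpace

instance : ChartedSpace (ModelProd E H) (DefSpace E H G τ) := (core E H G τ).toChartedSpace

end DefSpace

variable (E G : Type*) [NormedAddCommGroup E] [NormedSpace ℝ E]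
  [TopologicalSpace G] [ChartedSpace E G] [Group G]

/-- The deformation space `𝒢 = D(G, {1}) = (G × ℝ*) ⊔ (𝔤 × {0})`. -/
abbrev GroupDeformation : Type _ := DefSpace E ℝ G (ContinuousMap.id ℝ)

variable {E G}

/-- The inclusion `[0,1] ⊆ ℝ`. -/
def unitInclusion : C(Set.Icc (0 : ℝ) 1, ℝ) := ⟨Subtype.val, continuous_subtype_val⟩

variable (E G) in
/-- The part of the deformation space `𝒢` over `[0,1]`, a manifold with boundary. -/
abbrev UnitGroupDeformation : Type _ := DefSpace E (EuclideanHalfSpace 1) G unitInclusion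

/-- The natural map from the deformation space over `(S, τ)` to `𝒢`, covering `τ`. -/
def DefSpace.toGroupDeformation {H S : Type*} [TopologicalSpace S] {τ : C(S, ℝ)} :
    DefSpace E H G τ → GroupDeformation E G
  | .grp g t ht => .grp g (τ t) ht
  | .lie x t ht => .lie x (τ t) ht

end DeformationSpace

/-! ### Poisson deformations -/

section PoissonDeformation

variable {E : Type*} [NormedAddCommGroup E] [NormedSpace ℝ E] [FiniteDimensional ℝ E]
  {G : Type*} [TopologicalSpace G] [ChartedSpace E G] [Group G]
  {ι : Type*} [Fintype ι] [DecidableEq ι]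
  {EM HM : Type*} [NormedAddCommGroup EM] [NormedSpace ℝ EM] [TopologicalSpace HM]
  (IM : ModelWithCorners ℝ EM HM) {M : Type*} [TopologicalSpace M] [ChartedSpace HM M]
  {EN HN : Type*} [NormedAddCommGroup EN] [NormedSpace ℝ EN] [TopologicalSpace HN]
  (IN : ModelWithCorners ℝ EN HN) {N : Type*} [TopologicalSpace N] [ChartedSpace HN N]
  {ES HS : Type*} [NormedAddCommGroup ES] [NormedSpace ℝ ES] [TopologicalSpace HS]
  (IS : ModelWithCorners ℝ ES HS) {S : Type*} [TopologicalSpace S] [ChartedSpace HS S]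
  {EQ HQ : Type*} [NormedAddCommGroup EQ] [NormedSpace ℝ EQ] [TopologicalSpace HQ]
  (IQ : ModelWithCorners ℝ EQ HQ) {Q : Type*} [TopologicalSpace Q] [ChartedSpace HQ Q]

/-- `j : M → Q` is a diffeomorphism of `M` onto the fibre `π⁻¹(t)`: a smooth embedding (smooth,
immersive, homeomorphic onto its image) with image `π⁻¹(t)`. -/
structure IsFibreDiffeo (p : Q → S) (t : S) (j : M → Q) : Prop where
  smooth : ContMDiff IM IQ ∞ j
  immersive : ∀ m, Function.Injective (mfderiv IM IQ j m)
  embedding : Topology.IsEmbedding j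
  range : Set.range j = p ⁻¹' {t}

/-- The data `(Q, p, b, μ̃, P̃, Φ̃)` form a Poisson deformation, over the base `S` with parameter
`τ : S → ℝ`, of the Hamiltonian quasi-Poisson `G`-manifold `(M, P, Φ, μ)` with action `aM` to the
Hamiltonian Poisson `G`-manifold `(N, P₀, ν)` with action `aN`; the fibres are identified with
`M` and `N` through `j` and `j₀`. The base of interest is the inclusion `[0,1] ⊆ ℝ`.

For `t ≠ 0`, the rescaled data `(M, tP, t²Φ, μ)` are a Hamiltonian quasi-Poisson `G`-manifold with
respect to the form `t⁻¹⟨ , ⟩`, whose Cartan trivector is `t²φ`. -/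
structure IsPoissonDeformation (τ : C(S, ℝ)) (B : InvariantForm E G)
    (e : Module.Basis ι ℝ (GroupLieAlgebra 𝓘(ℝ, E) G))
    (aM : G → M → M) (P : KVectorField IM M 2) (Φ : KVectorField IM M 3) (μ : M → G)
    (aN : G → N → N) (P₀ : KVectorField IN N 2) (ν : N → (E →L[ℝ] ℝ))
    (p : Q → S) (b : G → Q → Q) (μ' : Q → GroupDeformation E G)
    (P' : KVectorField IQ Q 2) (Φ' : KVectorField IQ Q 3)
    (j : S → M → Q) (j₀ : S → N → Q) : Prop where
  source_isHamiltonian : IsHamiltonianQuasiPoisson IM B e aM P Φ μ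
  target_isHamiltonian : IsHamiltonianPoisson IN aN P₀ ν
  isManifold : IsManifold IQ ∞ Q
  t2 : T2Space Q
  secondCountable : SecondCountableTopology Q
  submersion : Manifold.IsSubmersion IQ IS ∞ p
  submersion_invariant : ∀ g q, p (b g q) = p q
  action : IsSmoothAction (E := E) IQ b
  moment_smooth : ContMDiff IQ (𝓘(ℝ, E).prod 𝓘(ℝ, ℝ)) ∞ μ'
  moment_equivariant : ∀ g q, μ' (b g q) = (μ' q).act g
  moment_proj : ∀ q, (μ' q).proj = τ (p q)
  bivector_smooth : P'.IsSmooth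
  bivector_vertical : P'.IsVertical IS p
  trivector_smooth : Φ'.IsSmooth
  trivector_vertical : Φ'.IsVertical IS p
  rescaled_isHamiltonian : ∀ (t : S) (ht : τ t ≠ 0),
    IsHamiltonianQuasiPoisson IM (B.scale (τ t)⁻¹ (inv_ne_zero ht)) e aM
      (fun m => τ t • P m) (fun m => τ t ^ 2 • Φ m) μ
  fibre_diffeo : ∀ t : S, τ t ≠ 0 → IsFibreDiffeo IM IQ p t (j t)
  fibre_equivariant : ∀ t : S, τ t ≠ 0 → ∀ g m, j t (aM g m) = b g (j t m)
  fibre_bivector : ∀ t : S, τ t ≠ 0 → ∀ m,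
    P' (j t m) = (τ t • P m).push (mfderiv IM IQ (j t) m)
  fibre_trivector : ∀ t : S, τ t ≠ 0 → ∀ m,
    Φ' (j t m) = (τ t ^ 2 • Φ m).push (mfderiv IM IQ (j t) m)
  fibre_moment : ∀ (t : S) (ht : τ t ≠ 0) (m : M), μ' (j t m) = .grp (μ m) (τ t) ht
  zero_diffeo : ∀ t : S, τ t = 0 → IsFibreDiffeo IN IQ p t (j₀ t)
  zero_equivariant : ∀ t : S, τ t = 0 → ∀ g n, j₀ t (aN g n) = b g (j₀ t n)
  zero_bivector : ∀ t : S, τ t = 0 → ∀ n,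
    P' (j₀ t n) = (P₀ n).push (mfderiv IN IQ (j₀ t) n)
  zero_trivector : ∀ t : S, τ t = 0 → ∀ n, Φ' (j₀ t n) = 0
  zero_moment : ∀ (t : S) (ht : τ t = 0) (n : N), μ' (j₀ t n) = .lie (B.sharp (ν n)) (τ t) ht

end PoissonDeformation

end

/-!
The proof differentiates functions along left- and right-invariant vector fields: `leftDeriv f g`
and `rightDeriv f g` are the linear forms `x ↦ x^L f (g)` and `x ↦ x^R f (g)` on the Lie algebra.
These two families commute with each other, each of them represents the Lie bracket up to sign, and
they are related by `Ad_g`.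

*The group.* As `⟨·,·⟩` identifies `𝔤` with `𝔤*`, the bracket of `P_G` is an expression in left and
right derivatives, and the double bracket is governed by commutators of vector fields with
coefficients frozen at the point in question (`frozen_commutator`). The cyclic sum gives
`[P_G, P_G] = φ_G` (`isSchoutenSquare_groupBivector`). The fundamental fields of conjugation are
`x^L - x^R` (`fundamental_conj`), which gives the moment map condition (`groupBivector_moment`) and
`isHamiltonianQuasiPoisson_group`. Replacing the form by `t⁻¹ ⟨·,·⟩` replaces `(P, φ_M)` by
`(t P, t² φ_M)` (`IsHamiltonianQuasiPoisson.scale`).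

*The dual of the Lie algebra.* Identifying the bidual of `𝔤` with `𝔤`, the linear bivector is
`(x, y) ↦ ξ([x, y])`; second derivatives cancel in the Jacobiator, and what remains is the Jacobi
identity of `𝔤` (`isHamiltonianPoisson_dual`).

*The deformation space.* Smoothness near `τ = 0` is controlled by the blow-down map to `G × S` and
by the rescaled coordinate `(c(g) - c(1)) / τ`, where `c` is the preferred chart at `1`
(`DefSpace.contMDiffAt_of_components`, `DefSpace.contMDiffAt_of_comp_kappa`). Hadamard's lemma with
parameters (`ContDiffAt.hadamard`) shows that the rescaled coordinate of a family of curves through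
`1` extends smoothly across `τ = 0` by the velocities (`contMDiffAt_difference_quotient`). Hence the
action of `G` is smooth (`DefSpace.contMDiff_act`), and so is right translation by `κ(τ x)`, which
extends to translation of `𝔤` by `x` (`DefSpace.contMDiffAt_translate`). Differentiating the latter
gives smooth vector fields extending `τ x^L` by the constant field `x`.

With `Vⁱ` the field so obtained from `eⁱ`, the bivector field of the deformation is
`-½ ∑ (eᵢ)_𝒢 ∧ Vⁱ`. Over `τ ≠ 0` it is `τ P_G`, because `(eᵢ)_G = eᵢ^L - eᵢ^R` and
`∑ eᵢ^L ∧ (eⁱ)^L = 0` (`DefSpace.deformationBivector_group`). Over `τ = 0` it is the linear Poisson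
structure, because `(eᵢ)_𝒢` is then the fundamental field of the coadjoint action
(`DefSpace.deformationBivector_dual`). The trivector field is `τ²` times the Cartan trivector field
of the action on the deformation space. All of this works over any base `(S, τ)`
(`DefSpace.isPoissonDeformation`), in particular over `ℝ` and over `[0,1]`.
-/

/-! ### Hadamard's lemma with parameters -/

section Hadamard

universe u

variable {P : Type u} [NormedAddCommGroup P] [NormedSpace ℝ P] [FiniteDimensional ℝ P]

/-- A function that is continuous on `U × V`, with `[0,1] ⊆ V`, is bounded near any point of `U`,
uniformly over `[0,1]`. -/
lemma exists_eventually_norm_le_of_continuousOn {F : Type*} [NormedAddCommGroup F]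
    {g : P × ℝ → F} {U : Set P} {V : Set ℝ} (hU : IsOpen U) (hV : Set.Icc (0 : ℝ) 1 ⊆ V)
    (hg : ContinuousOn g (U ×ˢ V)) {p₀ : P} (hp : p₀ ∈ U) :
    ∃ s ∈ 𝓝 p₀, s ⊆ U ∧ ∃ C, ∀ p ∈ s, ∀ t ∈ Set.Icc (0 : ℝ) 1, ‖g (p, t)‖ ≤ C := by
  have : ProperSpace P := FiniteDimensional.proper ℝ P
  obtain ⟨ε, hε, hsub⟩ := Metric.nhds_basis_closedBall.mem_iff.1 (hU.mem_nhds hp)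
  obtain ⟨C, hC⟩ := ((isCompact_closedBall p₀ ε).prod
    (isCompact_Icc (a := (0 : ℝ)) (b := 1))).exists_bound_of_continuousOn
      (hg.mono (Set.prod_mono hsub hV))
  exact ⟨_, Metric.closedBall_mem_nhds _ hε, hsub, C, fun p hp t ht => hC (p, t) ⟨hp, ht⟩⟩

lemma uIoc_zero_one_subset : Set.uIoc (0 : ℝ) 1 ⊆ Set.Icc 0 1 := by
  rw [Set.uIoc_of_le zero_le_one]
  exact Set.Ioc_subset_Icc_self

lemma continuousOn_slice {F : Type*} [TopologicalSpace F] {g : P × ℝ → F} {U : Set P} {V : Set ℝ}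
    (hV : Set.Icc (0 : ℝ) 1 ⊆ V) (hg : ContinuousOn g (U ×ˢ V)) {p : P} (hp : p ∈ U) :
    ContinuousOn (fun t => g (p, t)) (Set.Icc 0 1) :=
  hg.comp (by fun_prop) fun _ ht => ⟨hp, hV ht⟩

lemma aestronglyMeasurable_slice {F : Type*} [NormedAddCommGroup F] {g : P × ℝ → F} {U : Set P}
    {V : Set ℝ} (hV : Set.Icc (0 : ℝ) 1 ⊆ V) (hg : ContinuousOn g (U ×ˢ V)) {p : P} (hp : p ∈ U) :
    MeasureTheory.AEStronglyMeasurable (fun t => g (p, t))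
      (MeasureTheory.volume.restrict (Set.uIoc (0 : ℝ) 1)) :=
  ((continuousOn_slice hV hg hp).mono uIoc_zero_one_subset).aestronglyMeasurable
    measurableSet_uIoc

/-- Smoothness of integrals over `[0,1]` that depend on a parameter. -/
theorem contDiffOn_integral_unitInterval (n : ℕ) {F : Type u} [NormedAddCommGroup F]
    [NormedSpace ℝ F] {g : P × ℝ → F} {U : Set P} {V : Set ℝ} (hU : IsOpen U) (hVo : IsOpen V)
    (hV : Set.Icc (0 : ℝ) 1 ⊆ V) (hg : ContDiffOn ℝ n g (U ×ˢ V)) :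
    ContDiffOn ℝ n (fun p => ∫ t in (0 : ℝ)..1, g (p, t)) U := by
  induction n generalizing F with
  | zero =>
    have hg := hg.continuousOn
    refine contDiffOn_zero.2 fun p hp => ContinuousAt.continuousWithinAt ?_
    obtain ⟨s, hs, hsU, C, hC⟩ := exists_eventually_norm_le_of_continuousOn hU hV hg hp
    refine intervalIntegral.continuousAt_of_dominated_interval (bound := fun _ => C) ?_ ?_ ?_ ?_
    · filter_upwards [hs] with q hq using aestronglyMeasurable_slice hV hg (hsU hq)
    · filter_upwards [hs] with q hq
      exact Filter.Eventually.of_forall fun t ht => hC q hq t (uIoc_zero_one_subset ht)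
    · exact intervalIntegrable_const
    · refine Filter.Eventually.of_forall fun t ht => ?_
      have h1 : ContinuousAt g (p, t) :=
        hg.continuousAt ((hU.prod hVo).mem_nhds ⟨hp, hV (uIoc_zero_one_subset ht)⟩)
      exact h1.comp (f := fun q => (q, t)) (by fun_prop)
  | succ n ih =>
    have hn : ((n + 1 : ℕ) : WithTop ℕ∞) ≠ 0 := by simp
    have hg0 := hg.continuousOn
    set g' : P × ℝ → (P →L[ℝ] F) := fun q =>
      (fderiv ℝ g q).comp (ContinuousLinearMap.inl ℝ P ℝ) with hg'
    have hg'n : ContDiffOn ℝ n g' (U ×ˢ V) := by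
      have := hg.fderiv_of_isOpen (m := n) (hU.prod hVo) (by norm_cast)
      exact this.clm_comp contDiffOn_const
    have hder : ∀ p ∈ U, HasFDerivAt (fun p => ∫ t in (0 : ℝ)..1, g (p, t))
        (∫ t in (0 : ℝ)..1, g' (p, t)) p := by
      intro p hp
      obtain ⟨s, hs, hsU, C, hC⟩ :=
        exists_eventually_norm_le_of_continuousOn hU hV hg'n.continuousOn hp
      refine intervalIntegral.hasFDerivAt_integral_of_dominated_of_fderiv_le
        (F' := fun p t => g' (p, t)) (bound := fun _ => C) hs ?_ ?_
        (aestronglyMeasurable_slice hV hg'n.continuousOn hp) ?_ intervalIntegrable_const ?_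
      · filter_upwards [hs] with q hq using aestronglyMeasurable_slice hV hg0 (hsU hq)
      · refine ContinuousOn.intervalIntegrable ?_
        rw [Set.uIcc_of_le zero_le_one]
        exact continuousOn_slice hV hg0 hp
      · exact Filter.Eventually.of_forall fun t ht q hq => hC q hq t (uIoc_zero_one_subset ht)
      · refine Filter.Eventually.of_forall fun t ht q hq => ?_
        have h1 : HasFDerivAt g (fderiv ℝ g (q, t)) (q, t) :=
          ((hg.differentiableOn hn).differentiableAt ((hU.prod hVo).mem_nhds
            ⟨hsU hq, hV (uIoc_zero_one_subset ht)⟩)).hasFDerivAt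
        exact h1.comp q (hasFDerivAt_prodMk_left q t)
    have hcast : ((n + 1 : ℕ) : WithTop ℕ∞) = (n : WithTop ℕ∞) + 1 := by norm_cast
    rw [hcast, contDiffOn_succ_iff_fderiv_of_isOpen hU]
    refine ⟨fun p hp => (hder p hp).differentiableAt.differentiableWithinAt, fun h => ?_, ?_⟩
    · exact absurd h (by simp)
    · exact (ih hg'n).congr fun p hp => (hder p hp).fderiv

/-- Hadamard's lemma: if `f(p, 0) = 0`, then `f(p, t) / t` extends smoothly across `t = 0` by the
partial derivative `∂f/∂t (p, 0)`. -/
theorem ContDiffAt.hadamard {F : Type u} [NormedAddCommGroup F] [NormedSpace ℝ F]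
    [CompleteSpace F] {f : P × ℝ → F} {p₀ : P} (hf : ContDiffAt ℝ ∞ f (p₀, 0))
    (h0 : ∀ᶠ p in 𝓝 p₀, f (p, 0) = 0) :
    ContDiffAt ℝ ∞ (fun q : P × ℝ =>
      if q.2 = 0 then fderiv ℝ f (q.1, 0) (0, 1) else q.2⁻¹ • f q) (p₀, 0) := by
  rw [contDiffAt_infty]
  intro n
  have hf' : ContDiffAt ℝ ((n + 1 : ℕ) : WithTop ℕ∞) f (p₀, 0) :=
    hf.of_le (by exact_mod_cast le_top)
  obtain ⟨u, hu, hfu⟩ := hf'.contDiffOn le_rfl (by simp)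
  obtain ⟨v, hv, w, hw, hvw⟩ := mem_nhds_prod_iff.1 (Filter.inter_mem hu
    (h0.prod_inl_nhds (0 : ℝ)))
  obtain ⟨δ, hδ, hδv⟩ := Metric.nhds_basis_ball.mem_iff.1 hv
  obtain ⟨ε, hε, hεw⟩ := Metric.nhds_basis_ball.mem_iff.1 hw
  have hsub : Metric.ball p₀ δ ×ˢ Metric.ball (0 : ℝ) ε ⊆ u :=
    fun q hq => (hvw ⟨hδv hq.1, hεw hq.2⟩).1
  have hz : ∀ p ∈ Metric.ball p₀ δ, f (p, 0) = 0 :=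
    fun p hp => (hvw (⟨hδv hp, hεw (Metric.mem_ball_self hε)⟩ : (p, (0 : ℝ)) ∈ v ×ˢ w)).2
  have hO : IsOpen (Metric.ball p₀ δ ×ˢ Metric.ball (0 : ℝ) ε) :=
    Metric.isOpen_ball.prod Metric.isOpen_ball
  replace hfu := hfu.mono hsub
  -- the integral is over `s ∈ [0,1]`, so it is defined for `|t| < ε/2`, `|s| < 2`
  set U : Set (P × ℝ) := Metric.ball p₀ δ ×ˢ Metric.ball (0 : ℝ) (ε / 2) with hUdef
  have hU : IsOpen U := Metric.isOpen_ball.prod Metric.isOpen_ball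
  have hmem : ∀ q ∈ U, ∀ s ∈ Metric.ball (0 : ℝ) 2,
      (q.1, s * q.2) ∈ Metric.ball p₀ δ ×ˢ Metric.ball (0 : ℝ) ε := by
    rintro ⟨p, t⟩ ⟨hp, ht⟩ s hs
    refine ⟨hp, ?_⟩
    simp only [Metric.mem_ball, dist_zero_right, Real.norm_eq_abs, abs_mul] at ht hs ⊢
    nlinarith [abs_nonneg s, abs_nonneg t]
  have hV : Set.Icc (0 : ℝ) 1 ⊆ Metric.ball (0 : ℝ) 2 := fun s hs => by
    simp only [Metric.mem_ball, dist_zero_right, Real.norm_eq_abs, abs_of_nonneg hs.1]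
    linarith [hs.2]
  have hd : ContDiffOn ℝ n (fun q => fderiv ℝ f q (0, 1))
      (Metric.ball p₀ δ ×ˢ Metric.ball (0 : ℝ) ε) :=
    (hfu.fderiv_of_isOpen (m := n) hO (by norm_cast)).clm_apply contDiffOn_const
  have hint := contDiffOn_integral_unitInterval n
    (g := fun q : (P × ℝ) × ℝ => fderiv ℝ f (q.1.1, q.2 * q.1.2) (0, 1)) hU Metric.isOpen_ball hV
    (hd.comp (f := fun q : (P × ℝ) × ℝ => (q.1.1, q.2 * q.1.2))
      (ContDiff.contDiffOn (by fun_prop)) fun q hq => hmem q.1 hq.1 q.2 hq.2)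
  have h00 : ((p₀, 0) : P × ℝ) ∈ U :=
    ⟨Metric.mem_ball_self hδ, Metric.mem_ball_self (by positivity)⟩
  refine (hint.contDiffAt (hU.mem_nhds h00)).congr_of_eventuallyEq ?_
  filter_upwards [hU.mem_nhds h00] with ⟨p, t⟩ hpt
  by_cases ht : t = 0
  · simp [ht]
  · simp only [ht, if_false]
    have hder : ∀ s ∈ Set.uIcc (0 : ℝ) 1, HasDerivAt (fun s : ℝ => f (p, s * t))
        (t • fderiv ℝ f (p, s * t) (0, 1)) s := by
      intro s hs
      rw [Set.uIcc_of_le zero_le_one] at hs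
      have h1 := ((hfu.differentiableOn (by simp)).differentiableAt
        (hO.mem_nhds (hmem _ hpt s (hV hs)))).hasFDerivAt
      have h2 : HasDerivAt (fun s : ℝ => (p, s * t)) (0, t) s := by
        have := (hasDerivAt_const s p).prodMk ((hasDerivAt_id s).mul_const t)
        simpa using this
      have h3 := h1.comp_hasDerivAt s h2
      have h4 : ((0, t) : P × ℝ) = t • (0, 1) := by simp
      rw [h4, map_smul] at h3
      exact h3
    have hcont : ContinuousOn (fun s : ℝ => t • fderiv ℝ f (p, s * t) (0, 1)) (Set.uIcc 0 1) := by
      rw [Set.uIcc_of_le zero_le_one]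
      refine (hd.continuousOn.comp (f := fun s : ℝ => (p, s * t)) (by fun_prop)
        fun s hs => hmem _ hpt s (hV hs)).const_smul t
    have hftc := intervalIntegral.integral_eq_sub_of_hasDerivAt hder hcont.intervalIntegrable
    rw [intervalIntegral.integral_smul, one_mul, zero_mul, hz p hpt.1, sub_zero] at hftc
    rw [← hftc, smul_smul, inv_mul_cancel₀ ht, one_smul]

end Hadamard

/-! ### Vector fields given by families of maps -/

lemma KVector.sum_apply {V : Type*} [AddCommGroup V] [Module ℝ V] [TopologicalSpace V] {k : ℕ}
    {ι : Type*} (s : Finset ι) (T : ι → KVector k V) (α : Fin k → V →L[ℝ] ℝ) :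
    (∑ i ∈ s, T i) α = ∑ i ∈ s, T i α := by
  classical
  induction s using Finset.induction_on with
  | empty => rfl
  | insert i s hi ih => rw [Finset.sum_insert hi, Finset.sum_insert hi, ← ih]; rfl

section Families

variable {EM HM : Type*} [NormedAddCommGroup EM] [NormedSpace ℝ EM] [TopologicalSpace HM]
  {I : ModelWithCorners ℝ EM HM} {M : Type*} [TopologicalSpace M] [ChartedSpace HM M]
  {EN HN : Type*} [NormedAddCommGroup EN] [NormedSpace ℝ EN] [TopologicalSpace HN]
  {J : ModelWithCorners ℝ EN HN} {N : Type*} [TopologicalSpace N] [ChartedSpace HN N]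

/-- The partial derivative of a smooth function with values in a vector space depends smoothly
on the other variable. -/
lemma contMDiffAt_mfderiv_param {F : Type*} [NormedAddCommGroup F] [NormedSpace ℝ F]
    [IsManifold I 1 M] [IsManifold J 1 N] {u : M → N → F} {m : M} {n : N}
    (hu : ContMDiffAt (I.prod J) 𝓘(ℝ, F) ∞ (Function.uncurry u) (m, n)) :
    ContMDiffAt (M' := EN →L[ℝ] F) I 𝓘(ℝ, EN →L[ℝ] F) ∞ (fun x => mfderiv J 𝓘(ℝ, F) (u x) n)
      m := by
  have h := ContMDiffAt.mfderiv (m := ∞) (n := ∞) u (fun _ => n) hu contMDiffAt_const le_rfl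
  have h1 : ∀ v : EN, (tangentBundleCore J N).coordChange (achart HN n) (achart HN n) n v = v :=
    (tangentBundleCore J N).coordChange_self _ n (mem_chart_source HN n)
  refine h.congr_of_eventuallyEq (Filter.Eventually.of_forall fun x => ?_)
  refine Eq.trans ?_ (inTangentCoordinates_eq (I := J) (I' := 𝓘(ℝ, F)) (fun _ => n)
    (fun x => u x n) (fun x => mfderiv J 𝓘(ℝ, F) (u x) n) (mem_chart_source HN n)
    (mem_chart_source F _)).symm
  have h2 := tangentBundleCore_coordChange_model_space (I := 𝓘(ℝ, F)) (u x n) (u m n) (u x n)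
  refine Eq.trans ?_ (congrArg (fun L : F →L[ℝ] F => L.comp ((mfderiv J 𝓘(ℝ, F) (u x) n :
    EN →L[ℝ] F).comp ((tangentBundleCore J N).coordChange (achart HN n) (achart HN n) n)))
    h2).symm
  refine ContinuousLinearMap.ext fun v => ?_
  exact congrArg (mfderiv J 𝓘(ℝ, F) (u x) n) (h1 v).symm

/-- Chain rule for covectors, at a point that is only propositionally the value of `F`. -/
lemma covec_mfderiv {F : N → M} {n : N} {m : M} (hF : MDifferentiableAt J I F n) (h : F n = m)
    {f : M → ℝ} (hf : MDifferentiableAt I 𝓘(ℝ, ℝ) f m) (v : TangentSpace J n) :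
    covec I f m (mfderiv J I F n v : EM) = mfderiv J 𝓘(ℝ, ℝ) (f ∘ F) n v :=
  (mfderiv_comp_apply_of_eq n hf hF h v).symm

lemma covec_congr {f g : M → ℝ} {m : M} (h : f =ᶠ[𝓝 m] g) : covec I f m = covec I g m :=
  h.mfderiv_eq

lemma covec_neg (f : M → ℝ) (m : M) : covec I (fun x => -f x) m = -covec I f m :=
  mfderiv_neg

lemma covec_add {f g : M → ℝ} {m : M} (hf : MDifferentiableAt I 𝓘(ℝ, ℝ) f m)
    (hg : MDifferentiableAt I 𝓘(ℝ, ℝ) g m) :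
    covec I (fun x => f x + g x) m = covec I f m + covec I g m :=
  (hf.hasMFDerivAt.add hg.hasMFDerivAt).mfderiv

lemma covec_sub {f g : M → ℝ} {m : M} (hf : MDifferentiableAt I 𝓘(ℝ, ℝ) f m)
    (hg : MDifferentiableAt I 𝓘(ℝ, ℝ) g m) :
    covec I (fun x => f x - g x) m = covec I f m - covec I g m :=
  (hf.hasMFDerivAt.sub hg.hasMFDerivAt).mfderiv

lemma covec_mul {f g : M → ℝ} {m : M} (hf : MDifferentiableAt I 𝓘(ℝ, ℝ) f m)
    (hg : MDifferentiableAt I 𝓘(ℝ, ℝ) g m) :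
    covec I (fun x => f x * g x) m = f m • covec I g m + g m • covec I f m :=
  (hf.hasMFDerivAt.mul hg.hasMFDerivAt).mfderiv

lemma covec_const_mul {f : M → ℝ} {m : M} (hf : MDifferentiableAt I 𝓘(ℝ, ℝ) f m) (c : ℝ) :
    covec I (fun x => c * f x) m = c • covec I f m :=
  (hf.hasMFDerivAt.const_smul c).mfderiv

lemma covec_sum {ι : Type*} {s : Finset ι} {f : ι → M → ℝ} {m : M}
    (hf : ∀ i ∈ s, MDifferentiableAt I 𝓘(ℝ, ℝ) (f i) m) :
    MDifferentiableAt I 𝓘(ℝ, ℝ) (fun x => ∑ i ∈ s, f i x) m ∧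
      covec I (fun x => ∑ i ∈ s, f i x) m = ∑ i ∈ s, covec I (f i) m := by
  classical
  induction s using Finset.induction_on with
  | empty => exact ⟨mdifferentiableAt_const, mfderiv_const⟩
  | insert i s hi ih =>
    have h1 := hf i (Finset.mem_insert_self i s)
    obtain ⟨h2, h3⟩ := ih fun j hj => hf j (Finset.mem_insert_of_mem hj)
    simp only [Finset.sum_insert hi]
    exact ⟨h1.add h2, (covec_add h1 h2).trans (by rw [h3])⟩

/-- A vector field is smooth if it maps locally defined smooth functions to smooth functions. -/
def IsSmoothField (V : (m : M) → TangentSpace I m) : Prop :=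
  ∀ U : Set M, IsOpen U → ∀ f : M → ℝ, ContMDiffOn I 𝓘(ℝ, ℝ) ∞ f U →
    ContMDiffOn I 𝓘(ℝ, ℝ) ∞ (fun m => covec I f m (V m)) U

/-- If `F(m, n₀) = m`, then the derivatives at `n₀` of the maps `F(m, ·)` form a smooth vector
field. -/
lemma isSmoothField_of_family [IsManifold I 1 M] [IsManifold J 1 N] {F : M → N → M} {n : N}
    (hF : ∀ m, ContMDiffAt (I.prod J) I ∞ (Function.uncurry F) (m, n)) (h : ∀ m, F m n = m)
    (v : TangentSpace J n) :
    IsSmoothField (I := I) (M := M) fun m => (mfderiv J I (F m) n v : EM) := by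
  intro U hU f hf m hm
  have hfm : ContMDiffAt I 𝓘(ℝ, ℝ) ∞ f (Function.uncurry F (m, n)) := by
    have : Function.uncurry F (m, n) = m := h m
    rw [this]
    exact hf.contMDiffAt (hU.mem_nhds hm)
  have h1 : ContMDiffAt (I.prod J) 𝓘(ℝ, ℝ) ∞ (Function.uncurry fun m => f ∘ F m) (m, n) :=
    hfm.comp (m, n) (hF m)
  have h2 := (contMDiffAt_mfderiv_param h1).clm_apply
    (contMDiffAt_const (I' := 𝓘(ℝ, EN)) (M' := EN) (c := v))
  refine (h2.congr_of_eventuallyEq ?_).contMDiffWithinAt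
  filter_upwards [hU.mem_nhds hm] with x hx
  refine covec_mfderiv ?_ (h x) ((hf.contMDiffAt (hU.mem_nhds hx)).mdifferentiableAt (by simp)) v
  have h3 := (hF x).comp n (f := fun y => (x, y)) (contMDiffAt_const.prodMk contMDiffAt_id)
  exact h3.mdifferentiableAt (by simp)

lemma IsSmoothField.neg {V : (m : M) → TangentSpace I m} (hV : IsSmoothField V) :
    IsSmoothField fun m => -V m := fun U hU f hf => by
  have := (hV U hU f hf).neg
  refine this.congr fun m _ => ?_
  simp

/-- Decomposable multivector fields with smooth factors are smooth. -/
lemma isSmooth_wedge {k : ℕ} {V : Fin k → (m : M) → TangentSpace I m}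
    (hV : ∀ i, IsSmoothField (V i)) :
    KVectorField.IsSmooth (I := I) (M := M) fun m => wedge fun i => V i m := by
  intro U hU f hf
  simp only [wedge_apply, Matrix.det_apply, Matrix.of_apply]
  refine contMDiffOn_finsetSum fun σ _ => ?_
  simp only [Units.smul_def, zsmul_eq_mul]
  exact contMDiffOn_const.mul (contMDiffOn_finsetProd fun i _ => hV i U hU (f (σ i)) (hf (σ i)))

lemma KVectorField.IsSmooth.smul {k : ℕ} {T : KVectorField I M k} (hT : T.IsSmooth) {c : M → ℝ}
    (hc : ContMDiff I 𝓘(ℝ, ℝ) ∞ c) :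
    KVectorField.IsSmooth (I := I) (M := M) fun m => c m • T m := fun U hU f hf =>
  hc.contMDiffOn.mul (hT U hU f hf)

lemma KVectorField.IsSmooth.sum {k : ℕ} {ι : Type*} {s : Finset ι} {T : ι → KVectorField I M k}
    (hT : ∀ i ∈ s, (T i).IsSmooth) :
    KVectorField.IsSmooth (I := I) (M := M) fun m => ∑ i ∈ s, T i m := fun U hU f hf => by
  refine (contMDiffOn_finsetSum fun i hi => hT i hi U hU f hf).congr fun m _ => ?_
  exact KVector.sum_apply _ _ _

end Families

/-! ### The Lie bracket of vector fields as a commutator of derivations -/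

section Commutator

variable {E : Type*} [NormedAddCommGroup E] [NormedSpace ℝ E] [CompleteSpace E]
  {M : Type*} [TopologicalSpace M] [ChartedSpace E M] [IsManifold 𝓘(ℝ, E) ∞ M]

open VectorField

/-- A vector field, applied to a function, in a chart. -/
lemma covec_eq_fderiv_chart (V : (m : M) → TangentSpace 𝓘(ℝ, E) m) (m : M) {y : E}
    (hy : y ∈ (extChartAt 𝓘(ℝ, E) m).target) {u : M → ℝ}
    (hu : MDifferentiableAt 𝓘(ℝ, E) 𝓘(ℝ, ℝ) u ((extChartAt 𝓘(ℝ, E) m).symm y)) :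
    covec 𝓘(ℝ, E) u ((extChartAt 𝓘(ℝ, E) m).symm y) (V ((extChartAt 𝓘(ℝ, E) m).symm y)) =
      fderiv ℝ (u ∘ (extChartAt 𝓘(ℝ, E) m).symm) y
        (mpullbackWithin 𝓘(ℝ, E) 𝓘(ℝ, E) (extChartAt 𝓘(ℝ, E) m).symm V
          (Set.range 𝓘(ℝ, E)) y) := by
  have hinv := isInvertible_mfderivWithin_extChartAt_symm (I := 𝓘(ℝ, E)) hy
  have hd := mdifferentiableWithinAt_extChartAt_symm (I := 𝓘(ℝ, E)) hy
  rw [mpullbackWithin_apply]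
  rw [modelWithCornersSelf_coe, Set.range_id] at *
  rw [mfderivWithin_univ] at *
  rw [mdifferentiableWithinAt_univ] at hd
  rw [← mfderiv_eq_fderiv]
  refine Eq.trans ?_ (mfderiv_comp_apply y hu hd _).symm
  rw [hinv.self_apply_inverse]
  rfl

/-- A vector field in the chart at `m`, as a function on the model space. -/
noncomputable def chartField (V : (m : M) → TangentSpace 𝓘(ℝ, E) m) (m : M) : E → E :=
  fun y => mpullbackWithin 𝓘(ℝ, E) 𝓘(ℝ, E) (extChartAt 𝓘(ℝ, E) m).symm V
    (Set.range 𝓘(ℝ, E)) y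

lemma differentiableAt_chartField {V : (m : M) → TangentSpace 𝓘(ℝ, E) m} {m : M}
    (hV : MDifferentiableAt 𝓘(ℝ, E) 𝓘(ℝ, E).tangent
      (fun x => (V x : TangentBundle 𝓘(ℝ, E) M)) m) :
    DifferentiableAt ℝ (chartField V m) (extChartAt 𝓘(ℝ, E) m m) := by
  have h : DifferentiableWithinAt ℝ (chartField V m)
      ((extChartAt 𝓘(ℝ, E) m).symm ⁻¹' Set.univ ∩ Set.range 𝓘(ℝ, E)) (extChartAt 𝓘(ℝ, E) m m) :=
    MDifferentiableWithinAt.differentiableWithinAt_mpullbackWithin_vectorField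
      (mdifferentiableWithinAt_univ.2 hV)
  rwa [Set.preimage_univ, Set.univ_inter, modelWithCornersSelf_coe, Set.range_id,
    differentiableWithinAt_univ] at h

/-- The Lie bracket of vector fields acts on functions as the commutator. -/
lemma covec_mlieBracket {V W : (m : M) → TangentSpace 𝓘(ℝ, E) m} {m : M}
    (hV : MDifferentiableAt 𝓘(ℝ, E) 𝓘(ℝ, E).tangent
      (fun x => (V x : TangentBundle 𝓘(ℝ, E) M)) m)
    (hW : MDifferentiableAt 𝓘(ℝ, E) 𝓘(ℝ, E).tangent
      (fun x => (W x : TangentBundle 𝓘(ℝ, E) M)) m)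
    {f : M → ℝ} (hf : ContMDiffAt 𝓘(ℝ, E) 𝓘(ℝ, ℝ) ∞ f m)
    (hVf : MDifferentiableAt 𝓘(ℝ, E) 𝓘(ℝ, ℝ) (fun x => covec 𝓘(ℝ, E) f x (V x)) m)
    (hWf : MDifferentiableAt 𝓘(ℝ, E) 𝓘(ℝ, ℝ) (fun x => covec 𝓘(ℝ, E) f x (W x)) m) :
    covec 𝓘(ℝ, E) f m (mlieBracket 𝓘(ℝ, E) V W m) =
      covec 𝓘(ℝ, E) (fun x => covec 𝓘(ℝ, E) f x (W x)) m (V m) -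
        covec 𝓘(ℝ, E) (fun x => covec 𝓘(ℝ, E) f x (V x)) m (W m) := by
  set φ := extChartAt 𝓘(ℝ, E) m with hφ
  set F : E → ℝ := f ∘ φ.symm with hF
  have hm : φ.symm (φ m) = m := φ.left_inv (mem_extChartAt_source m)
  have ht : φ m ∈ φ.target := mem_extChartAt_target m
  have hFs : ContDiffAt ℝ 2 F (φ m) := by
    have h1 : ContMDiffAt 𝓘(ℝ, E) 𝓘(ℝ, E) 2 φ.symm (φ m) := by
      have := contMDiffWithinAt_extChartAt_symm_range (I := 𝓘(ℝ, E)) (n := 2) m ht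
      rwa [modelWithCornersSelf_coe, Set.range_id, contMDiffWithinAt_univ] at this
    have h2 : ContMDiffAt 𝓘(ℝ, E) 𝓘(ℝ, ℝ) 2 F (φ m) :=
      ContMDiffAt.comp (φ m) (by rw [hm]; exact hf.of_le ENat.LEInfty.out) h1
    exact h2.contDiffAt
  have hcont : ContinuousAt φ.symm (φ m) := continuousAt_extChartAt_symm m
  have hev : ∀ᶠ y in 𝓝 (φ m), MDifferentiableAt 𝓘(ℝ, E) 𝓘(ℝ, ℝ) f (φ.symm y) := by
    have h1 : ∀ᶠ x in 𝓝 m, ContMDiffAt 𝓘(ℝ, E) 𝓘(ℝ, ℝ) 1 f x :=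
      (contMDiffAt_iff_contMDiffAt_nhds (by simp)).1 (hf.of_le ENat.LEInfty.out)
    have h2 := hcont.eventually (by rw [hm]; exact h1)
    exact h2.mono fun y hy => hy.mdifferentiableAt (by simp)
  have hev' : ∀ᶠ y in 𝓝 (φ m), y ∈ φ.target := extChartAt_target_mem_nhds m
  have key : ∀ X : (m : M) → TangentSpace 𝓘(ℝ, E) m,
      (fun x => covec 𝓘(ℝ, E) f x (X x)) ∘ φ.symm =ᶠ[𝓝 (φ m)]
        fun y => fderiv ℝ F y (chartField X m y) := fun X => by
    filter_upwards [hev, hev'] with y hy hyt using covec_eq_fderiv_chart X m hyt hy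
  have hsymm : IsSymmSndFDerivAt ℝ F (φ m) := hFs.isSymmSndFDerivAt (by simp)
  have hdF : DifferentiableAt ℝ (fderiv ℝ F) (φ m) :=
    (hFs.fderiv_right (m := 1) (by norm_num)).differentiableAt (by simp)
  -- second derivatives along two vector fields, in the chart
  have second : ∀ X Y : (m : M) → TangentSpace 𝓘(ℝ, E) m,
      DifferentiableAt ℝ (chartField Y m) (φ m) →
      MDifferentiableAt 𝓘(ℝ, E) 𝓘(ℝ, ℝ) (fun x => covec 𝓘(ℝ, E) f x (Y x)) m →
      covec 𝓘(ℝ, E) (fun x => covec 𝓘(ℝ, E) f x (Y x)) m (X m) =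
        fderiv ℝ (fderiv ℝ F) (φ m) (chartField X m (φ m)) (chartField Y m (φ m)) +
        fderiv ℝ F (φ m) (fderiv ℝ (chartField Y m) (φ m) (chartField X m (φ m))) := by
    intro X Y hY hYf
    have h1 := covec_eq_fderiv_chart X m ht (u := fun x => covec 𝓘(ℝ, E) f x (Y x))
      (by rw [hm]; exact hYf)
    rw [hm] at h1
    refine h1.trans ?_
    have h2 : fderiv ℝ ((fun x => covec 𝓘(ℝ, E) f x (Y x)) ∘ φ.symm) (φ m) =
        fderiv ℝ (fun y => fderiv ℝ F y (chartField Y m y)) (φ m) := (key Y).fderiv_eq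
    refine (congrArg (fun L : E →L[ℝ] ℝ => L (chartField X m (φ m))) h2).trans ?_
    rw [fderiv_clm_apply hdF hY]
    exact add_comm _ _
  have hb : covec 𝓘(ℝ, E) f m (mlieBracket 𝓘(ℝ, E) V W m) =
      fderiv ℝ F (φ m) (lieBracket ℝ (chartField V m) (chartField W m) (φ m)) := by
    have hfF : MDifferentiableAt 𝓘(ℝ, E) 𝓘(ℝ, ℝ) F (φ m) :=
      (hFs.differentiableAt (by simp)).mdifferentiableAt
    have hφd : MDifferentiableAt 𝓘(ℝ, E) 𝓘(ℝ, E) φ m :=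
      mdifferentiableAt_extChartAt (mem_chart_source E m)
    have h1 : mfderiv 𝓘(ℝ, E) 𝓘(ℝ, ℝ) f m = mfderiv 𝓘(ℝ, E) 𝓘(ℝ, ℝ) (F ∘ φ) m := by
      refine Filter.EventuallyEq.mfderiv_eq ?_
      filter_upwards [extChartAt_source_mem_nhds (I := 𝓘(ℝ, E)) m] with x hx
      exact congrArg f (φ.left_inv hx).symm
    have h2 : mlieBracket 𝓘(ℝ, E) V W m = (mfderiv 𝓘(ℝ, E) 𝓘(ℝ, E) φ m).inverse
        (lieBracketWithin (E := E) ℝ (chartField V m) (chartField W m)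
          (φ.symm ⁻¹' Set.univ ∩ Set.range 𝓘(ℝ, E)) (φ m)) := mlieBracketWithin_apply
    rw [Set.preimage_univ, Set.univ_inter, modelWithCornersSelf_coe, Set.range_id,
      lieBracketWithin_univ] at h2
    rw [h2]
    refine (congrArg (fun L : E →L[ℝ] ℝ => L _) h1).trans ?_
    refine (mfderiv_comp_apply m hfF hφd _).trans ?_
    refine (congrArg (mfderiv 𝓘(ℝ, E) 𝓘(ℝ, ℝ) F (φ m))
      ((isInvertible_mfderiv_extChartAt (mem_extChartAt_source m)).self_apply_inverse _)).trans ?_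
    rw [mfderiv_eq_fderiv]
    rfl
  rw [second V W (differentiableAt_chartField hW) hWf,
    second W V (differentiableAt_chartField hV) hVf,
    hsymm.eq (chartField V m (φ m)), hb, lieBracket, map_sub]
  ring

end Commutator

/-! ### Invariant derivations on a Lie group -/

section Diag

variable {EM HM : Type*} [NormedAddCommGroup EM] [NormedSpace ℝ EM] [TopologicalSpace HM]
  {I : ModelWithCorners ℝ EM HM} {M : Type*} [TopologicalSpace M] [ChartedSpace HM M]

/-- The derivative of `h ↦ v(h, h)` is the sum of the partial derivatives. -/
lemma mfderiv_diag {F K : Type*} [NormedAddCommGroup F] [NormedSpace ℝ F] [TopologicalSpace K]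
    {J : ModelWithCorners ℝ F K} {N : Type*} [TopologicalSpace N] [ChartedSpace K N]
    {v : M → M → N} {m : M}
    (hv : MDifferentiableAt (I.prod I) J (Function.uncurry v) (m, m))
    (x : TangentSpace I m) :
    (mfderiv I J (fun h => v h h) m x : F) =
      (mfderiv I J (fun h => v h m) m x : F) + (mfderiv I J (fun h => v m h) m x : F) := by
  have h1 := mfderiv_comp_apply (I' := I.prod I) m (f := fun h : M => (h, h)) hv
    (mdifferentiableAt_id.prodMk mdifferentiableAt_id) x
  have h2 := mfderiv_prod_eq_add_apply hv
    (v := mfderiv I (I.prod I) (fun h : M => (h, h)) m x)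
  have h3 : mfderiv I (I.prod I) (fun h : M => (h, h)) m =
      (mfderiv I I (fun h : M => h) m).prod (mfderiv I I (fun h : M => h) m) :=
    mfderiv_prodMk mdifferentiableAt_id mdifferentiableAt_id
  have h4 : mfderiv I I (fun h : M => h) m = ContinuousLinearMap.id ℝ (TangentSpace I m) :=
    mfderiv_id
  have h5 : (mfderiv I (I.prod I) (fun h : M => (h, h)) m x : EM × EM) = (x, x) := by
    rw [h3, h4]; rfl
  refine h1.trans (h2.trans ?_)
  exact congrArg (fun p : EM × EM => (mfderiv I J (fun h => v h m) m p.1 : F) +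
    (mfderiv I J (fun h => v m h) m p.2 : F)) h5

end Diag

section Derivations

variable {E : Type*} [NormedAddCommGroup E] [NormedSpace ℝ E]
  {G : Type*} [TopologicalSpace G] [ChartedSpace E G] [Group G]

/-- The derivative of `f` at `g` along left-invariant vector fields: the value at `x` is
`(x^L f)(g)`. -/
noncomputable def leftDeriv (f : G → ℝ) (g : G) : GroupLieAlgebra 𝓘(ℝ, E) G →L[ℝ] ℝ :=
  covec 𝓘(ℝ, E) (fun h => f (g * h)) 1

/-- The derivative of `f` at `g` along right-invariant vector fields: the value at `x` is
`(x^R f)(g)`. -/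
noncomputable def rightDeriv (f : G → ℝ) (g : G) : GroupLieAlgebra 𝓘(ℝ, E) G →L[ℝ] ℝ :=
  covec 𝓘(ℝ, E) (fun h => f (h * g)) 1

variable [LieGroup 𝓘(ℝ, E) ∞ G]

lemma mdifferentiableAt_mul_left_one (g : G) :
    MDifferentiableAt 𝓘(ℝ, E) 𝓘(ℝ, E) (fun h : G => g * h) 1 :=
  (contMDiff_mul_left (I := 𝓘(ℝ, E)) (n := ∞)).mdifferentiableAt (by simp)

lemma mdifferentiableAt_mul_right_one (g : G) :
    MDifferentiableAt 𝓘(ℝ, E) 𝓘(ℝ, E) (fun h : G => h * g) 1 :=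
  (contMDiff_mul_right (I := 𝓘(ℝ, E)) (n := ∞)).mdifferentiableAt (by simp)

lemma contMDiff_conj : ContMDiff (𝓘(ℝ, E).prod 𝓘(ℝ, E)) 𝓘(ℝ, E) ∞
    (fun p : G × G => p.1 * p.2 * p.1⁻¹) :=
  (contMDiff_fst.mul contMDiff_snd).mul contMDiff_fst.inv

lemma contMDiff_conj_right (g : G) :
    ContMDiff 𝓘(ℝ, E) 𝓘(ℝ, E) ∞ (fun h : G => g * h * g⁻¹) :=
  contMDiff_conj.comp (contMDiff_const.prodMk contMDiff_id)

lemma mdifferentiableAt_conj_one (g : G) :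
    MDifferentiableAt 𝓘(ℝ, E) 𝓘(ℝ, E) (fun h : G => g * h * g⁻¹) 1 :=
  (contMDiff_conj_right g).mdifferentiableAt (by simp)

lemma covec_leftField {f : G → ℝ} {g : G} (hf : MDifferentiableAt 𝓘(ℝ, E) 𝓘(ℝ, ℝ) f g)
    (x : GroupLieAlgebra 𝓘(ℝ, E) G) :
    covec 𝓘(ℝ, E) f g (leftField x g) = leftDeriv f g x :=
  covec_mfderiv (mdifferentiableAt_mul_left_one g) (mul_one g) hf x

lemma covec_rightField {f : G → ℝ} {g : G} (hf : MDifferentiableAt 𝓘(ℝ, E) 𝓘(ℝ, ℝ) f g)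
    (x : GroupLieAlgebra 𝓘(ℝ, E) G) :
    covec 𝓘(ℝ, E) f g (rightField x g) = rightDeriv f g x :=
  covec_mfderiv (mdifferentiableAt_mul_right_one g) (one_mul g) hf x

lemma leftDeriv_one (f : G → ℝ) : leftDeriv (E := E) f 1 = covec 𝓘(ℝ, E) f 1 := by
  unfold leftDeriv
  simp only [one_mul]

lemma rightDeriv_one (f : G → ℝ) : rightDeriv (E := E) f 1 = covec 𝓘(ℝ, E) f 1 := by
  unfold rightDeriv
  simp only [mul_one]

lemma isSmoothField_leftField (x : GroupLieAlgebra 𝓘(ℝ, E) G) :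
    IsSmoothField (I := 𝓘(ℝ, E)) (leftField x : (g : G) → TangentSpace 𝓘(ℝ, E) g) :=
  isSmoothField_of_family (F := fun g h : G => g * h) (n := (1 : G))
    (fun _ => (contMDiff_mul 𝓘(ℝ, E) ∞).contMDiffAt) mul_one x

lemma isSmoothField_rightField (x : GroupLieAlgebra 𝓘(ℝ, E) G) :
    IsSmoothField (I := 𝓘(ℝ, E)) (rightField x : (g : G) → TangentSpace 𝓘(ℝ, E) g) :=
  isSmoothField_of_family (F := fun g h : G => h * g) (n := (1 : G))
    (fun _ => (contMDiff_snd.mul contMDiff_fst).contMDiffAt) one_mul x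

lemma contMDiffOn_leftDeriv {f : G → ℝ} {U : Set G} (hU : IsOpen U)
    (hf : ContMDiffOn 𝓘(ℝ, E) 𝓘(ℝ, ℝ) ∞ f U) (x : GroupLieAlgebra 𝓘(ℝ, E) G) :
    ContMDiffOn 𝓘(ℝ, E) 𝓘(ℝ, ℝ) ∞ (fun g => leftDeriv f g x) U :=
  (isSmoothField_leftField x U hU f hf).congr fun _ hg =>
    (covec_leftField ((hf.contMDiffAt (hU.mem_nhds hg)).mdifferentiableAt (by simp)) x).symm

lemma contMDiffOn_rightDeriv {f : G → ℝ} {U : Set G} (hU : IsOpen U)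
    (hf : ContMDiffOn 𝓘(ℝ, E) 𝓘(ℝ, ℝ) ∞ f U) (x : GroupLieAlgebra 𝓘(ℝ, E) G) :
    ContMDiffOn 𝓘(ℝ, E) 𝓘(ℝ, ℝ) ∞ (fun g => rightDeriv f g x) U :=
  (isSmoothField_rightField x U hU f hf).congr fun _ hg =>
    (covec_rightField ((hf.contMDiffAt (hU.mem_nhds hg)).mdifferentiableAt (by simp)) x).symm

/-- The derivative at `1` in the preferred chart. -/
lemma covec_one_eq_fderiv {w : G → ℝ} (hw : MDifferentiableAt 𝓘(ℝ, E) 𝓘(ℝ, ℝ) w (1 : G)) (x : E) :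
    covec 𝓘(ℝ, E) w (1 : G) x =
      fderiv ℝ (w ∘ (chartAt E (1 : G)).symm) (chartAt E (1 : G) 1) x := by
  have h := hw.mfderiv
  rw [modelWithCornersSelf_coe, Set.range_id, fderivWithin_univ] at h
  exact congrArg (fun L : E →L[ℝ] ℝ => L x) h

lemma covec_comp_inv {w : G → ℝ} (hw : MDifferentiableAt 𝓘(ℝ, E) 𝓘(ℝ, ℝ) w (1 : G))
    (x : GroupLieAlgebra 𝓘(ℝ, E) G) :
    covec 𝓘(ℝ, E) (fun h => w h⁻¹) (1 : G) x = -covec 𝓘(ℝ, E) w 1 x := by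
  have h0 : MDifferentiableAt (𝓘(ℝ, E).prod 𝓘(ℝ, E)) 𝓘(ℝ, ℝ)
      (Function.uncurry fun a b : G => w (a * b⁻¹)) (1, 1) := by
    have h1 : ContMDiff (𝓘(ℝ, E).prod 𝓘(ℝ, E)) 𝓘(ℝ, E) ∞ (fun p : G × G => p.1 * p.2⁻¹) :=
      contMDiff_fst.mul contMDiff_snd.inv
    refine MDifferentiableAt.comp (I' := 𝓘(ℝ, E)) _ ?_ (h1.mdifferentiableAt (by simp))
    simpa using hw
  have h : covec 𝓘(ℝ, E) (fun h => w (h * h⁻¹)) (1 : G) x =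
      covec 𝓘(ℝ, E) (fun h => w (h * 1⁻¹)) (1 : G) x +
        covec 𝓘(ℝ, E) (fun h => w (1 * h⁻¹)) (1 : G) x := mfderiv_diag h0 x
  have h1 : covec 𝓘(ℝ, E) (fun _ : G => w 1) (1 : G) = 0 := mfderiv_const
  simp only [mul_inv_cancel, inv_one, mul_one, one_mul, h1] at h
  have h' : (0 : ℝ) = covec 𝓘(ℝ, E) w 1 x + covec 𝓘(ℝ, E) (fun h => w h⁻¹) (1 : G) x := h
  linarith

end Derivations

section Commutators

variable {E : Type*} [NormedAddCommGroup E] [NormedSpace ℝ E] [CompleteSpace E]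
  {G : Type*} [TopologicalSpace G] [ChartedSpace E G] [Group G] [LieGroup 𝓘(ℝ, E) ∞ G]

variable (E G) in
lemma lieGroup_minSmoothness : LieGroup 𝓘(ℝ, E) (minSmoothness ℝ 3) G := by
  refine LieGroup.of_le (n := ∞) ?_
  rw [minSmoothness_of_isRCLikeNormedField]
  exact ENat.LEInfty.out

/-- Left-invariant vector fields represent the Lie algebra. -/
lemma leftDeriv_commutator {f : G → ℝ} {U : Set G} (hU : IsOpen U)
    (hf : ContMDiffOn 𝓘(ℝ, E) 𝓘(ℝ, ℝ) ∞ f U) {g : G} (hg : g ∈ U)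
    (x y : GroupLieAlgebra 𝓘(ℝ, E) G) :
    leftDeriv (fun g => leftDeriv f g y) g x - leftDeriv (fun g => leftDeriv f g x) g y =
      leftDeriv f g ⁅x, y⁆ := by
  have := lieGroup_minSmoothness E G
  have hUg := hU.mem_nhds hg
  have hd : ∀ z : GroupLieAlgebra 𝓘(ℝ, E) G,
      MDifferentiableAt 𝓘(ℝ, E) 𝓘(ℝ, ℝ) (fun g => leftDeriv f g z) g := fun z =>
    ((contMDiffOn_leftDeriv hU hf z).contMDiffAt hUg).mdifferentiableAt (by simp)
  have he : ∀ z : GroupLieAlgebra 𝓘(ℝ, E) G,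
      (fun g => covec 𝓘(ℝ, E) f g (leftField z g)) =ᶠ[𝓝 g] fun g => leftDeriv f g z := fun z => by
    filter_upwards [hUg] with a ha using
      covec_leftField ((hf.contMDiffAt (hU.mem_nhds ha)).mdifferentiableAt (by simp)) z
  have hfg := hf.contMDiffAt hUg
  have h1 := covec_mlieBracket (V := leftField x) (W := leftField y) (m := g)
    (mdifferentiableAt_mulInvariantVectorField x) (mdifferentiableAt_mulInvariantVectorField y) hfg
    ((hd x).congr_of_eventuallyEq (he x)) ((hd y).congr_of_eventuallyEq (he y))
  have h2 : VectorField.mlieBracket 𝓘(ℝ, E) (leftField x) (leftField y) g =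
      leftField ⁅x, y⁆ g :=
    (congrFun (mulInvariantVector_mlieBracket x y) g).symm
  rw [h2, covec_leftField (hfg.mdifferentiableAt (by simp))] at h1
  rw [h1, ← covec_leftField (hd y), ← covec_leftField (hd x)]
  rw [covec_congr (he x), covec_congr (he y)]

lemma rightDeriv_eq_leftDeriv_inv {f : G → ℝ} {g : G}
    (hf : MDifferentiableAt 𝓘(ℝ, E) 𝓘(ℝ, ℝ) f g) (x : GroupLieAlgebra 𝓘(ℝ, E) G) :
    rightDeriv f g x = -leftDeriv (fun h => f h⁻¹) g⁻¹ x := by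
  have hw : MDifferentiableAt 𝓘(ℝ, E) 𝓘(ℝ, ℝ) (fun h => f (h * g)) (1 : G) :=
    MDifferentiableAt.comp (I' := 𝓘(ℝ, E)) (1 : G) (by rwa [one_mul])
      (mdifferentiableAt_mul_right_one g)
  have h := covec_comp_inv hw x
  unfold leftDeriv rightDeriv
  simp only [mul_inv_rev, inv_inv]
  rw [h, neg_neg]

/-- Right-invariant vector fields anti-represent the Lie algebra. -/
lemma rightDeriv_commutator {f : G → ℝ} {U : Set G} (hU : IsOpen U)
    (hf : ContMDiffOn 𝓘(ℝ, E) 𝓘(ℝ, ℝ) ∞ f U) {g : G} (hg : g ∈ U)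
    (x y : GroupLieAlgebra 𝓘(ℝ, E) G) :
    rightDeriv (fun g => rightDeriv f g y) g x - rightDeriv (fun g => rightDeriv f g x) g y =
      -rightDeriv f g ⁅x, y⁆ := by
  have hinv : ContMDiff 𝓘(ℝ, E) 𝓘(ℝ, E) ∞ (fun h : G => h⁻¹) := contMDiff_inv 𝓘(ℝ, E) ∞
  have hU' : IsOpen ((fun h : G => h⁻¹) ⁻¹' U) := hU.preimage hinv.continuous
  have hf' : ContMDiffOn 𝓘(ℝ, E) 𝓘(ℝ, ℝ) ∞ (fun h => f h⁻¹) ((fun h : G => h⁻¹) ⁻¹' U) :=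
    hf.comp hinv.contMDiffOn fun _ h => h
  have hg' : g⁻¹ ∈ (fun h : G => h⁻¹) ⁻¹' U := by simpa using hg
  have hfd : ∀ a ∈ U, MDifferentiableAt 𝓘(ℝ, E) 𝓘(ℝ, ℝ) f a := fun a ha =>
    (hf.contMDiffAt (hU.mem_nhds ha)).mdifferentiableAt (by simp)
  have key : ∀ a b : GroupLieAlgebra 𝓘(ℝ, E) G, rightDeriv (fun g => rightDeriv f g b) g a =
      leftDeriv (fun g => leftDeriv (fun h => f h⁻¹) g b) g⁻¹ a := fun a b => by
    rw [rightDeriv_eq_leftDeriv_inv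
      (((contMDiffOn_rightDeriv hU hf b).contMDiffAt (hU.mem_nhds hg)).mdifferentiableAt (by simp))]
    have he : (fun h : G => rightDeriv f (g⁻¹ * h)⁻¹ b) =ᶠ[𝓝 1]
        -(fun h => leftDeriv (fun h => f h⁻¹) (g⁻¹ * h) b) := by
      have hcont : ContinuousAt (fun h : G => (g⁻¹ * h)⁻¹) 1 :=
        (hinv.comp (contMDiff_mul_left (I := 𝓘(ℝ, E)) (n := ∞) (a := g⁻¹))).continuous.continuousAt
      have : ∀ᶠ h in 𝓝 (1 : G), (g⁻¹ * h)⁻¹ ∈ U := hcont.eventually (by simpa using hU.mem_nhds hg)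
      filter_upwards [this] with h hh
      rw [rightDeriv_eq_leftDeriv_inv (hfd _ hh), inv_inv]
      rfl
    change -covec 𝓘(ℝ, E) (fun h : G => rightDeriv f (g⁻¹ * h)⁻¹ b) 1 a = _
    rw [covec_congr he]
    exact (congrArg (fun L : E →L[ℝ] ℝ => -(L a)) (covec_neg (I := 𝓘(ℝ, E))
      (fun h : G => leftDeriv (E := E) (fun h => f h⁻¹) (g⁻¹ * h) b) 1)).trans (neg_neg _)
  rw [key, key, leftDeriv_commutator hU' hf' hg', rightDeriv_eq_leftDeriv_inv (hfd g hg), neg_neg]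

/-- Left- and right-invariant vector fields commute: both iterated derivatives are second
derivatives of `(s, t) ↦ f(κ(s) g κ(t))`, where `κ` is the inverse of a chart at `1`. -/
lemma leftDeriv_rightDeriv_comm {f : G → ℝ} {U : Set G} (hU : IsOpen U)
    (hf : ContMDiffOn 𝓘(ℝ, E) 𝓘(ℝ, ℝ) ∞ f U) {g : G} (hg : g ∈ U)
    (x y : GroupLieAlgebra 𝓘(ℝ, E) G) :
    leftDeriv (fun g => rightDeriv f g y) g x = rightDeriv (fun g => leftDeriv f g x) g y := by
  set φ := chartAt E (1 : G) with hφ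
  set c : E := φ 1 with hc
  have h1c : φ.symm c = 1 := φ.left_inv (mem_chart_source E 1)
  have hct : c ∈ φ.target := mem_chart_target E 1
  have hκ : ContMDiffOn 𝓘(ℝ, E) 𝓘(ℝ, E) ∞ φ.symm φ.target := contMDiffOn_chart_symm
  set m : E × E → G := fun p => φ.symm p.1 * g * φ.symm p.2 with hm
  have hO : IsOpen (φ.target ×ˢ φ.target) := φ.open_target.prod φ.open_target
  have hms : ContMDiffOn 𝓘(ℝ, E × E) 𝓘(ℝ, E) ∞ m (φ.target ×ˢ φ.target) :=
    ((hκ.comp contDiff_fst.contMDiff.contMDiffOn fun p hp => hp.1).mul contMDiffOn_const).mul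
      (hκ.comp contDiff_snd.contMDiff.contMDiffOn fun p hp => hp.2)
  set W : Set (E × E) := φ.target ×ˢ φ.target ∩ m ⁻¹' U with hW
  have hWo : IsOpen W := hms.continuousOn.isOpen_inter_preimage hO hU
  have hcW : (c, c) ∈ W := ⟨⟨hct, hct⟩, by simpa [hm, h1c] using hg⟩
  set u : E × E → ℝ := fun p => f (m p) with hu
  have hus : ContDiffOn ℝ ∞ u W :=
    contMDiffOn_iff_contDiffOn.1 (hf.comp (hms.mono Set.inter_subset_left) fun p hp => hp.2)
  have hud : ∀ p ∈ W, HasFDerivAt u (fderiv ℝ u p) p := fun p hp =>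
    ((hus.contDiffAt (hWo.mem_nhds hp)).differentiableAt (by simp)).hasFDerivAt
  have hu2 : ContDiffAt ℝ 2 u (c, c) :=
    (hus.contDiffAt (hWo.mem_nhds hcW)).of_le ENat.LEInfty.out
  have hdd : HasFDerivAt (fderiv ℝ u) (fderiv ℝ (fderiv ℝ u) (c, c)) (c, c) :=
    ((hu2.fderiv_right (m := 1) (by norm_num)).differentiableAt (by simp)).hasFDerivAt
  have hsymm : IsSymmSndFDerivAt ℝ u (c, c) := hu2.isSymmSndFDerivAt (by simp)
  have hfU : ∀ a ∈ U, MDifferentiableAt 𝓘(ℝ, E) 𝓘(ℝ, ℝ) f a := fun a ha =>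
    (hf.contMDiffAt (hU.mem_nhds ha)).mdifferentiableAt (by simp)
  -- first derivatives
  have hR : ∀ t, (c, t) ∈ W → rightDeriv f (g * φ.symm t) y = fderiv ℝ u (c, t) (y, 0) := by
    intro t ht
    have hmem : g * φ.symm t ∈ U := by simpa [hm, h1c] using ht.2
    have hw : MDifferentiableAt 𝓘(ℝ, E) 𝓘(ℝ, ℝ) (fun h => f (h * (g * φ.symm t))) (1 : G) :=
      MDifferentiableAt.comp (I' := 𝓘(ℝ, E)) (1 : G) (by rw [one_mul]; exact hfU _ hmem)
        (mdifferentiableAt_mul_right_one _)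
    refine (covec_one_eq_fderiv hw y).trans ?_
    have he : (fun h => f (h * (g * φ.symm t))) ∘ φ.symm = fun s => u (s, t) := by
      ext s; simp [hu, hm, mul_assoc]
    have h2 : HasFDerivAt (fun s => u (s, t)) _ c :=
      HasFDerivAt.comp (g := u) (f := fun s => (s, t)) c (hud _ ht) (hasFDerivAt_prodMk_left c t)
    rw [he, h2.fderiv]
    rfl
  have hL : ∀ s, (s, c) ∈ W → leftDeriv f (φ.symm s * g) x = fderiv ℝ u (s, c) (0, x) := by
    intro s hs
    have hmem : φ.symm s * g ∈ U := by simpa [hm, h1c] using hs.2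
    have hw : MDifferentiableAt 𝓘(ℝ, E) 𝓘(ℝ, ℝ) (fun h => f (φ.symm s * g * h)) (1 : G) :=
      MDifferentiableAt.comp (I' := 𝓘(ℝ, E)) (1 : G) (by rw [mul_one]; exact hfU _ hmem)
        (mdifferentiableAt_mul_left_one _)
    refine (covec_one_eq_fderiv hw x).trans ?_
    have he : (fun h => f (φ.symm s * g * h)) ∘ φ.symm = fun t => u (s, t) := rfl
    have h2 : HasFDerivAt (fun t => u (s, t)) _ c :=
      HasFDerivAt.comp (g := u) (f := fun t => (s, t)) c (hud _ hs) (hasFDerivAt_prodMk_right s c)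
    rw [he, h2.fderiv]
    rfl
  -- second derivatives
  have hwR : MDifferentiableAt 𝓘(ℝ, E) 𝓘(ℝ, ℝ) (fun h => rightDeriv f (g * h) y) (1 : G) :=
    MDifferentiableAt.comp (I' := 𝓘(ℝ, E)) (1 : G) (by
      rw [mul_one]
      exact ((contMDiffOn_rightDeriv hU hf y).contMDiffAt (hU.mem_nhds hg)).mdifferentiableAt
        (by simp)) (mdifferentiableAt_mul_left_one _)
  have hwL : MDifferentiableAt 𝓘(ℝ, E) 𝓘(ℝ, ℝ) (fun h => leftDeriv f (h * g) x) (1 : G) :=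
    MDifferentiableAt.comp (I' := 𝓘(ℝ, E)) (1 : G) (by
      rw [one_mul]
      exact ((contMDiffOn_leftDeriv hU hf x).contMDiffAt (hU.mem_nhds hg)).mdifferentiableAt
        (by simp)) (mdifferentiableAt_mul_right_one _)
  have e1 : (fun h => rightDeriv f (g * h) y) ∘ φ.symm =ᶠ[𝓝 c]
      fun t => fderiv ℝ u (c, t) (y, 0) := by
    have : ∀ᶠ t in 𝓝 c, (c, t) ∈ W :=
      (by fun_prop : Continuous fun t : E => (c, t)).continuousAt.eventually (hWo.mem_nhds hcW)
    filter_upwards [this] with t ht using hR t ht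
  have e2 : (fun h => leftDeriv f (h * g) x) ∘ φ.symm =ᶠ[𝓝 c]
      fun s => fderiv ℝ u (s, c) (0, x) := by
    have : ∀ᶠ s in 𝓝 c, (s, c) ∈ W :=
      (by fun_prop : Continuous fun s : E => (s, c)).continuousAt.eventually (hWo.mem_nhds hcW)
    filter_upwards [this] with s hs using hL s hs
  have d1 : HasFDerivAt (fun t => fderiv ℝ u (c, t) (y, 0)) _ c :=
    (HasFDerivAt.comp (g := fderiv ℝ u) (f := fun t => (c, t)) c hdd
      (hasFDerivAt_prodMk_right c c)).clm_apply (hasFDerivAt_const ((y, 0) : E × E) c)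
  have d2 : HasFDerivAt (fun s => fderiv ℝ u (s, c) (0, x)) _ c :=
    (HasFDerivAt.comp (g := fderiv ℝ u) (f := fun s => (s, c)) c hdd
      (hasFDerivAt_prodMk_left c c)).clm_apply (hasFDerivAt_const ((0, x) : E × E) c)
  refine (covec_one_eq_fderiv hwR x).trans (Eq.trans ?_ (covec_one_eq_fderiv hwL y).symm)
  rw [← hφ, ← hc, e1.fderiv_eq, e2.fderiv_eq, d1.fderiv, d2.fderiv,
    ContinuousLinearMap.comp_zero, ContinuousLinearMap.comp_zero, zero_add, zero_add]
  exact hsymm.eq ((0, x) : E × E) (y, 0)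

end Commutators

/-! ### The adjoint action -/

section Adjoint

variable {E : Type*} [NormedAddCommGroup E] [NormedSpace ℝ E] [CompleteSpace E]
  {G : Type*} [TopologicalSpace G] [ChartedSpace E G] [Group G] [LieGroup 𝓘(ℝ, E) ∞ G]

lemma adj_one (x : GroupLieAlgebra 𝓘(ℝ, E) G) : adj (1 : G) x = x := by
  have h : (fun h : G => 1 * h * 1⁻¹) = id := by ext h; simp
  unfold adj
  rw [h]
  exact congrArg (fun L : E →L[ℝ] E => L x) (mfderiv_id (I := 𝓘(ℝ, E)) (x := (1 : G)))

lemma adj_mul (g h : G) (x : GroupLieAlgebra 𝓘(ℝ, E) G) : adj (g * h) x = adj g (adj h x) := by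
  have e : (fun k : G => g * h * k * (g * h)⁻¹) =
      (fun k => g * k * g⁻¹) ∘ fun k => h * k * h⁻¹ := by
    ext k; simp [mul_assoc]
  unfold adj
  rw [e]
  exact mfderiv_comp_apply_of_eq (1 : G) (mdifferentiableAt_conj_one g)
    (mdifferentiableAt_conj_one h) (by simp) x

lemma adj_inv_adj (g : G) (x : GroupLieAlgebra 𝓘(ℝ, E) G) : adj g⁻¹ (adj g x) = x := by
  rw [← adj_mul, inv_mul_cancel, adj_one]

lemma adj_adj_inv (g : G) (x : GroupLieAlgebra 𝓘(ℝ, E) G) : adj g (adj g⁻¹ x) = x := by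
  rw [← adj_mul, mul_inv_cancel, adj_one]

lemma covec_conj {w : G → ℝ} (hw : MDifferentiableAt 𝓘(ℝ, E) 𝓘(ℝ, ℝ) w (1 : G)) (g : G)
    (x : GroupLieAlgebra 𝓘(ℝ, E) G) :
    covec 𝓘(ℝ, E) (fun h => w (g * h * g⁻¹)) 1 x = covec 𝓘(ℝ, E) w 1 (adj g x) :=
  (covec_mfderiv (mdifferentiableAt_conj_one g) (by simp) hw x).symm

lemma mfderiv_extChartAt_one :
    (mfderiv 𝓘(ℝ, E) 𝓘(ℝ, E) (extChartAt 𝓘(ℝ, E) (1 : G)) (1 : G) : E →L[ℝ] E) =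
      ContinuousLinearMap.id ℝ E := by
  have hd : MDifferentiableAt 𝓘(ℝ, E) 𝓘(ℝ, E) (extChartAt 𝓘(ℝ, E) (1 : G)) (1 : G) :=
    mdifferentiableAt_extChartAt (mem_chart_source E (1 : G))
  have h := hd.mfderiv
  rw [modelWithCornersSelf_coe, Set.range_id, fderivWithin_univ] at h
  refine h.trans ?_
  have he : writtenInExtChartAt 𝓘(ℝ, E) 𝓘(ℝ, E) (1 : G) (extChartAt 𝓘(ℝ, E) (1 : G))
      =ᶠ[𝓝 (extChartAt 𝓘(ℝ, E) (1 : G) 1)] id := by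
    filter_upwards [extChartAt_target_mem_nhds (I := 𝓘(ℝ, E)) (1 : G)] with y hy
    exact (extChartAt 𝓘(ℝ, E) (1 : G)).right_inv hy
  rw [he.fderiv_eq, fderiv_id]

/-- Smooth functions near `1` separate the vectors of the Lie algebra. -/
lemma eq_of_forall_covec_one {x y : GroupLieAlgebra 𝓘(ℝ, E) G}
    (h : ∀ (U : Set G) (w : G → ℝ), IsOpen U → 1 ∈ U → ContMDiffOn 𝓘(ℝ, E) 𝓘(ℝ, ℝ) ∞ w U →
      covec 𝓘(ℝ, E) w 1 x = covec 𝓘(ℝ, E) w 1 y) : x = y := by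
  have key : ∀ (α : E →L[ℝ] ℝ) (z : GroupLieAlgebra 𝓘(ℝ, E) G),
      covec 𝓘(ℝ, E) (α ∘ extChartAt 𝓘(ℝ, E) (1 : G)) (1 : G) z = α z := fun α z => by
    have hd : MDifferentiableAt 𝓘(ℝ, E) 𝓘(ℝ, E) (extChartAt 𝓘(ℝ, E) (1 : G)) (1 : G) :=
      mdifferentiableAt_extChartAt (mem_chart_source E (1 : G))
    refine (mfderiv_comp_apply (I' := 𝓘(ℝ, E)) (1 : G) α.mdifferentiableAt hd z).trans ?_
    rw [ContinuousLinearMap.mfderiv_eq]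
    exact congrArg (fun L : E →L[ℝ] E => α (L z)) mfderiv_extChartAt_one
  have hE : (x : E) = y := by
    by_contra hne
    obtain ⟨α, hα⟩ := SeparatingDual.exists_separating_of_ne (R := ℝ) (V := E) hne
    refine hα ?_
    have := h (chartAt E (1 : G)).source (α ∘ extChartAt 𝓘(ℝ, E) (1 : G))
      (chartAt E (1 : G)).open_source (mem_chart_source E 1)
      (α.contMDiff.comp_contMDiffOn contMDiffOn_extChartAt)
    rwa [key, key] at this
  exact hE

variable (E) in
/-- `Ad_g`, read in the model space: the fibres of the tangent bundle are copies of it. -/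
noncomputable def adjE (g : G) : E →L[ℝ] E := adj g

lemma contMDiff_adj : ContMDiff (M' := E →L[ℝ] E) 𝓘(ℝ, E) 𝓘(ℝ, E →L[ℝ] E) ∞
    (fun g : G => adjE E g) := by
  intro g
  have h1 : ContMDiffAt 𝓘(ℝ, E) 𝓘(ℝ, E) ∞ (extChartAt 𝓘(ℝ, E) (1 : G)) (g * 1 * g⁻¹) := by
    rw [mul_one, mul_inv_cancel]
    exact contMDiffAt_extChartAt
  have h2 : ContMDiffAt (𝓘(ℝ, E).prod 𝓘(ℝ, E)) 𝓘(ℝ, E) ∞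
      (Function.uncurry fun a b : G => extChartAt 𝓘(ℝ, E) (1 : G) (a * b * a⁻¹)) (g, 1) :=
    ContMDiffAt.comp (g, (1 : G)) h1 contMDiff_conj.contMDiffAt
  have h3 := contMDiffAt_mfderiv_param h2
  refine h3.congr_of_eventuallyEq (Filter.Eventually.of_forall fun a => ?_)
  refine ContinuousLinearMap.ext fun x => ?_
  have hd : MDifferentiableAt 𝓘(ℝ, E) 𝓘(ℝ, E) (extChartAt 𝓘(ℝ, E) (1 : G)) (1 : G) :=
    mdifferentiableAt_extChartAt (mem_chart_source E (1 : G))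
  have h4 := mfderiv_comp_apply_of_eq (1 : G) hd (mdifferentiableAt_conj_one a) (by simp) x
  refine Eq.trans ?_ h4.symm
  exact (congrArg (fun L : E →L[ℝ] E => L (adj a x)) mfderiv_extChartAt_one).symm

/-- The derivative of the adjoint action at `1` is the Lie bracket. -/
lemma mfderiv_adj_one (x y : GroupLieAlgebra 𝓘(ℝ, E) G) :
    (mfderiv 𝓘(ℝ, E) 𝓘(ℝ, E) (fun g : G => adjE E g y) 1 x : E) = ⁅x, y⁆ := by
  refine eq_of_forall_covec_one (G := G) fun U w hU h1 hw => ?_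
  have hUn : U ∈ 𝓝 (1 : G) := hU.mem_nhds h1
  have hwd : MDifferentiableAt 𝓘(ℝ, E) 𝓘(ℝ, ℝ) w (1 : G) :=
    (hw.contMDiffAt hUn).mdifferentiableAt (by simp)
  -- `v(a, b)` is the derivative of `h ↦ w(a h b⁻¹)` at `1`, along `y`
  set v : G → G → ℝ := fun a b => covec 𝓘(ℝ, E) (fun h : G => w (a * h * b⁻¹)) 1 y with hv
  have hvs : ContMDiffAt (𝓘(ℝ, E).prod 𝓘(ℝ, E)) 𝓘(ℝ, ℝ) ∞ (Function.uncurry v) (1, 1) := by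
    have h2 : ContMDiff ((𝓘(ℝ, E).prod 𝓘(ℝ, E)).prod 𝓘(ℝ, E)) 𝓘(ℝ, E) ∞
        (fun p : (G × G) × G => p.1.1 * p.2 * p.1.2⁻¹) :=
      ((contMDiff_fst.comp contMDiff_fst).mul contMDiff_snd).mul
        (contMDiff_snd.comp contMDiff_fst).inv
    have h3 : ContMDiffAt ((𝓘(ℝ, E).prod 𝓘(ℝ, E)).prod 𝓘(ℝ, E)) 𝓘(ℝ, ℝ) ∞
        (Function.uncurry fun (p : G × G) (h : G) => w (p.1 * h * p.2⁻¹)) ((1, 1), 1) :=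
      ContMDiffAt.comp (I' := 𝓘(ℝ, E)) (((1, 1), 1) : (G × G) × G)
        (by simpa using hw.contMDiffAt hUn) h2.contMDiffAt
    exact (contMDiffAt_mfderiv_param h3).clm_apply
      (contMDiffAt_const (I' := 𝓘(ℝ, E)) (M' := E) (c := y))
  have hdiag : covec 𝓘(ℝ, E) (fun h => v h h) (1 : G) x =
      covec 𝓘(ℝ, E) (fun h => v h 1) (1 : G) x + covec 𝓘(ℝ, E) (fun h => v 1 h) (1 : G) x :=
    mfderiv_diag (hvs.mdifferentiableAt (by simp)) x
  have e0 : (fun h => v h h) = fun h : G => covec 𝓘(ℝ, E) w 1 (adj h y) := by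
    ext h; exact covec_conj hwd h y
  have hadj : MDifferentiableAt 𝓘(ℝ, E) 𝓘(ℝ, E) (fun g : G => adjE E g y) 1 :=
    (contMDiff_adj.contMDiffAt.clm_apply
      (contMDiffAt_const (I' := 𝓘(ℝ, E)) (M' := E) (c := y))).mdifferentiableAt (by simp)
  have e1 : covec 𝓘(ℝ, E) (fun h => v h h) (1 : G) x = covec 𝓘(ℝ, E) w 1
      (mfderiv 𝓘(ℝ, E) 𝓘(ℝ, E) (fun g : G => adjE E g y) 1 x : E) := by
    rw [e0]
    let α : E →L[ℝ] ℝ := covec 𝓘(ℝ, E) w (1 : G)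
    refine (mfderiv_comp_apply (I' := 𝓘(ℝ, E)) (1 : G) (g := α)
      (ContinuousLinearMap.mdifferentiableAt _) hadj x).trans ?_
    exact congrArg (fun L : E →L[ℝ] ℝ => L _) (ContinuousLinearMap.mfderiv_eq α)
  have e2 : (fun h => v h 1) = fun h : G => leftDeriv w h y := by
    ext h; simp only [hv, inv_one, mul_one]; rfl
  have e3 : (fun h => v 1 h) = fun h : G => rightDeriv w h⁻¹ y := by
    ext h; simp only [hv, one_mul]; rfl
  have hRd : MDifferentiableAt 𝓘(ℝ, E) 𝓘(ℝ, ℝ) (fun h : G => rightDeriv w h y) 1 :=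
    ((contMDiffOn_rightDeriv hU hw y).contMDiffAt hUn).mdifferentiableAt (by simp)
  have e4 := covec_comp_inv hRd x
  have e5 := leftDeriv_rightDeriv_comm hU hw h1 x y
  have e6 := leftDeriv_commutator hU hw h1 x y
  have e7 : ∀ z : GroupLieAlgebra 𝓘(ℝ, E) G, ∀ f : G → ℝ,
      leftDeriv f 1 z = covec 𝓘(ℝ, E) f 1 z := fun z f => by rw [leftDeriv_one]
  rw [← e1, hdiag, e2, e3, e4]
  simp only [leftDeriv_one, rightDeriv_one] at e5 e6
  rw [← e6, e5]
  ring

/-- The adjoint action preserves the Lie bracket. -/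
lemma adj_lie (g : G) (x y : GroupLieAlgebra 𝓘(ℝ, E) G) : adj g ⁅x, y⁆ = ⁅adj g x, adj g y⁆ := by
  have hadj : ∀ z : E, MDifferentiableAt 𝓘(ℝ, E) 𝓘(ℝ, E) (fun g : G => adjE E g z) 1 :=
    fun z => (contMDiff_adj.contMDiffAt.clm_apply
      (contMDiffAt_const (I' := 𝓘(ℝ, E)) (M' := E) (c := z))).mdifferentiableAt (by simp)
  have e : (fun h : G => adjE E (g * h * g⁻¹) (adjE E g y)) = fun h => adjE E g (adjE E h y) := by
    ext h
    exact (adj_mul (g * h) g⁻¹ _).trans ((congrArg (adj (g * h)) (adj_inv_adj g y)).trans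
      (adj_mul g h y))
  have h1 : (mfderiv 𝓘(ℝ, E) 𝓘(ℝ, E) (fun h : G => adjE E (g * h * g⁻¹) (adjE E g y)) 1 x : E) =
      ⁅adj g x, adj g y⁆ := by
    refine (mfderiv_comp_apply_of_eq (1 : G) (g := fun h : G => adjE E h (adjE E g y))
      (hadj (adjE E g y)) (mdifferentiableAt_conj_one g) (by simp) x).trans ?_
    exact mfderiv_adj_one _ _
  have h2 : (mfderiv 𝓘(ℝ, E) 𝓘(ℝ, E) (fun h : G => adjE E g (adjE E h y)) 1 x : E) =
      adj g ⁅x, y⁆ := by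
    refine (mfderiv_comp_apply (I' := 𝓘(ℝ, E)) (1 : G) (g := adjE E g)
      (ContinuousLinearMap.mdifferentiableAt _) (hadj y) x).trans ?_
    refine (congrArg (fun L : E →L[ℝ] E => L _)
      (ContinuousLinearMap.mfderiv_eq (adjE E g))).trans ?_
    exact congrArg (adjE E g) (mfderiv_adj_one x y)
  exact h2.symm.trans
    ((congrArg (fun u : G → E => (mfderiv 𝓘(ℝ, E) 𝓘(ℝ, E) u 1 x : E)) e).symm.trans h1)

end Adjoint

section InvariantForms

variable {E : Type*} [NormedAddCommGroup E] [NormedSpace ℝ E] [FiniteDimensional ℝ E]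
  {G : Type*} [TopologicalSpace G] [ChartedSpace E G] [Group G] [LieGroup 𝓘(ℝ, E) ∞ G]

lemma InvariantForm.adj_left (B : InvariantForm E G) (g : G) (x y : GroupLieAlgebra 𝓘(ℝ, E) G) :
    B.form (adj g x) y = B.form x (adj g⁻¹ y) := by
  have := FiniteDimensional.complete ℝ E
  conv_lhs => rw [← adj_adj_inv g y]
  exact B.invariant g _ _

/-- Infinitesimal invariance of an `Ad`-invariant form. -/
lemma InvariantForm.lie_left (B : InvariantForm E G) (z x y : GroupLieAlgebra 𝓘(ℝ, E) G) :
    B.form ⁅z, x⁆ y = -B.form x ⁅z, y⁆ := by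
  have := FiniteDimensional.complete ℝ E
  have hadj : ∀ z : E, MDifferentiableAt 𝓘(ℝ, E) 𝓘(ℝ, E) (fun g : G => adjE E g z) 1 :=
    fun z => (contMDiff_adj.contMDiffAt.clm_apply
      (contMDiffAt_const (I' := 𝓘(ℝ, E)) (M' := E) (c := z))).mdifferentiableAt (by simp)
  let b : E →ₗ[ℝ] E →ₗ[ℝ] ℝ := B.form
  let r : E →L[ℝ] ℝ := LinearMap.toContinuousLinearMap (b.flip y)
  let l : E →L[ℝ] ℝ := LinearMap.toContinuousLinearMap (b x)
  have h1 : covec 𝓘(ℝ, E) (fun h : G => r (adjE E h x)) 1 z = B.form ⁅z, x⁆ y := by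
    refine (mfderiv_comp_apply (I' := 𝓘(ℝ, E)) (1 : G) (g := r)
      (ContinuousLinearMap.mdifferentiableAt _) (hadj x) z).trans ?_
    refine (congrArg (fun L : E →L[ℝ] ℝ => L _) (ContinuousLinearMap.mfderiv_eq r)).trans ?_
    exact congrArg r (mfderiv_adj_one z x)
  have hl : MDifferentiableAt 𝓘(ℝ, E) 𝓘(ℝ, ℝ) (fun h : G => l (adjE E h y)) 1 :=
    MDifferentiableAt.comp (I' := 𝓘(ℝ, E)) (1 : G) l.mdifferentiableAt (hadj y)
  have h2 : covec 𝓘(ℝ, E) (fun h : G => l (adjE E h y)) 1 z = B.form x ⁅z, y⁆ := by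
    refine (mfderiv_comp_apply (I' := 𝓘(ℝ, E)) (1 : G) (g := l)
      (ContinuousLinearMap.mdifferentiableAt _) (hadj y) z).trans ?_
    refine (congrArg (fun L : E →L[ℝ] ℝ => L _) (ContinuousLinearMap.mfderiv_eq l)).trans ?_
    exact congrArg l (mfderiv_adj_one z y)
  have h3 := covec_comp_inv hl z
  have e : (fun h : G => r (adjE E h x)) = fun h => l (adjE E h⁻¹ y) := by
    ext h; exact B.adj_left h x y
  rw [← h1, e, h3, h2]

end InvariantForms

/-! ### Contractions with an invariant form -/

section Contractions

variable {E : Type*} [NormedAddCommGroup E] [NormedSpace ℝ E] [FiniteDimensional ℝ E]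
  {G : Type*} [TopologicalSpace G] [ChartedSpace E G] [Group G]
  {ι : Type*} [Fintype ι] [DecidableEq ι]

namespace InvariantForm

variable (B : InvariantForm E G) (e : Module.Basis ι ℝ (GroupLieAlgebra 𝓘(ℝ, E) G))

lemma form_comm (x y : GroupLieAlgebra 𝓘(ℝ, E) G) : B.form x y = B.form y x := B.symm.eq x y

lemma sharp_left (α : E →L[ℝ] ℝ) (x : GroupLieAlgebra 𝓘(ℝ, E) G) : B.form (B.sharp α) x = α x := by
  have : FiniteDimensional ℝ (GroupLieAlgebra 𝓘(ℝ, E) G) :=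
    inferInstanceAs (FiniteDimensional ℝ E)
  exact LinearMap.BilinForm.apply_toDual_symm_apply (hB := B.nondegenerate) _ _

lemma sharp_right (α : E →L[ℝ] ℝ) (x : GroupLieAlgebra 𝓘(ℝ, E) G) :
    B.form x (B.sharp α) = α x := by
  exact (B.form_comm _ _).trans (B.sharp_left α x)

lemma eq_of_form_left {x y : GroupLieAlgebra 𝓘(ℝ, E) G} (h : ∀ z, B.form x z = B.form y z) :
    x = y := by
  rw [← sub_eq_zero]
  exact B.nondegenerate.1 _ fun z => by rw [map_sub, LinearMap.sub_apply, h, sub_self]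

lemma sharp_eq_iff {α : E →L[ℝ] ℝ} {y : GroupLieAlgebra 𝓘(ℝ, E) G} :
    B.sharp α = y ↔ ∀ z : E, B.form y z = α z :=
  ⟨fun h z => h ▸ B.sharp_left α z,
    fun h => B.eq_of_form_left fun z => (B.sharp_left α z).trans (h z).symm⟩

lemma sharp_add (α β : E →L[ℝ] ℝ) : B.sharp (α + β) = B.sharp α + B.sharp β :=
  B.sharp_eq_iff.2 fun z => by
    refine (LinearMap.map_add₂ B.form _ _ _).trans ?_
    exact congrArg₂ (· + ·) (B.sharp_left α z) (B.sharp_left β z)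

lemma sharp_sub (α β : E →L[ℝ] ℝ) : B.sharp (α - β) = B.sharp α - B.sharp β :=
  B.sharp_eq_iff.2 fun z => by
    refine (LinearMap.map_sub₂ B.form _ _ _).trans ?_
    exact congrArg₂ (· - ·) (B.sharp_left α z) (B.sharp_left β z)

lemma sum_smul_dual (α : E →L[ℝ] ℝ) : ∑ i, α (e i) • B.dual e i = B.sharp α := by
  have h : ∀ i, (B.dual e).repr (B.sharp α) i = α (e i) := fun i => by
    rw [dual, LinearMap.BilinForm.dualBasis_repr_apply, sharp_left]
  rw [← (B.dual e).sum_repr (B.sharp α)]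
  simp only [h]

lemma dual_dual : B.dual (B.dual e) = e :=
  LinearMap.BilinForm.dualBasis_dualBasis _ B.symm _

lemma sum_dual_smul (α : E →L[ℝ] ℝ) : ∑ i, α (B.dual e i) • e i = B.sharp α := by
  have h := B.sum_smul_dual (B.dual e) α
  rwa [dual_dual] at h

lemma sum_mul_dual (α β : E →L[ℝ] ℝ) : ∑ i, α (e i) * β (B.dual e i) = β (B.sharp α) := by
  rw [← B.sum_smul_dual e α]
  refine Eq.trans ?_ (map_sum β (fun i => α (e i) • B.dual e i) Finset.univ).symm
  exact Finset.sum_congr rfl fun i _ => (map_smul β _ _).symm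

lemma sum_dual_mul (α β : E →L[ℝ] ℝ) : ∑ i, α (B.dual e i) * β (e i) = β (B.sharp α) := by
  have h := B.sum_mul_dual (B.dual e) α β
  rwa [dual_dual] at h

lemma sharp_comm (α β : E →L[ℝ] ℝ) : β (B.sharp α) = α (B.sharp β) := by
  rw [← sharp_left, ← sharp_right]

end InvariantForm

lemma wedge_two {V : Type*} [AddCommGroup V] [Module ℝ V] [TopologicalSpace V] (v w : V)
    (α : Fin 2 → V →L[ℝ] ℝ) : wedge ![v, w] α = α 0 v * α 1 w - α 0 w * α 1 v := by
  rw [wedge_apply, Matrix.det_fin_two]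
  rfl

lemma wedge_three {V : Type*} [AddCommGroup V] [Module ℝ V] [TopologicalSpace V] (u v w : V)
    (α : Fin 3 → V →L[ℝ] ℝ) : wedge ![u, v, w] α =
      α 0 u * α 1 v * α 2 w - α 0 u * α 1 w * α 2 v - α 0 v * α 1 u * α 2 w
        + α 0 v * α 1 w * α 2 u + α 0 w * α 1 u * α 2 v - α 0 w * α 1 v * α 2 u := by
  rw [wedge_apply, Matrix.det_fin_three]
  rfl

lemma KVector.map_smul_right {V : Type*} [AddCommGroup V] [Module ℝ V] [TopologicalSpace V]
    (T : KVector 2 V) (α β : V →L[ℝ] ℝ) (c : ℝ) : T ![α, c • β] = c * T ![α, β] := by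
  have h := T.map_update_smul ![α, β] 1 c β
  have h1 : Function.update ![α, β] 1 (c • β) = ![α, c • β] := by
    ext i : 1; fin_cases i <;> rfl
  have h2 : Function.update ![α, β] 1 β = ![α, β] := by
    ext i : 1; fin_cases i <;> rfl
  rwa [h1, h2] at h

lemma KVectorField.IsSmooth.bracket {E' H' : Type*} [NormedAddCommGroup E'] [NormedSpace ℝ E']
    [TopologicalSpace H'] {I : ModelWithCorners ℝ E' H'} {M : Type*} [TopologicalSpace M]
    [ChartedSpace H' M] {P : KVectorField I M 2} (hP : P.IsSmooth) {U : Set M} (hU : IsOpen U)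
    {f g : M → ℝ} (hf : ContMDiffOn I 𝓘(ℝ, ℝ) ∞ f U) (hg : ContMDiffOn I 𝓘(ℝ, ℝ) ∞ g U) :
    ContMDiffOn I 𝓘(ℝ, ℝ) ∞ (bivectorBracket P f g) U := by
  refine (hP U hU ![f, g] fun i => ?_).congr fun x _ => ?_
  · fin_cases i
    exacts [hf, hg]
  · refine congrArg (P x) ?_
    ext i : 1
    fin_cases i <;> rfl

end Contractions

/-! ### The Cartan trivector -/

section Cartan

variable {E : Type*} [NormedAddCommGroup E] [NormedSpace ℝ E] [FiniteDimensional ℝ E]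
  {G : Type*} [TopologicalSpace G] [ChartedSpace E G] [Group G] [LieGroup 𝓘(ℝ, E) ∞ G]
  {ι : Type*} [Fintype ι] [DecidableEq ι]

namespace InvariantForm

variable (B : InvariantForm E G) (e : Module.Basis ι ℝ (GroupLieAlgebra 𝓘(ℝ, E) G))

/-- The trilinear form `⟨x, [y, z]⟩`. -/
noncomputable def tri (x y z : GroupLieAlgebra 𝓘(ℝ, E) G) : ℝ := B.form x ⁅y, z⁆

lemma tri_swap (x y z : GroupLieAlgebra 𝓘(ℝ, E) G) : B.tri x z y = -B.tri x y z := by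
  have : CompleteSpace E := FiniteDimensional.complete ℝ E
  have := lieGroup_minSmoothness E G
  have h : ⁅z, y⁆ = -⁅y, z⁆ := (lie_skew z y).symm
  unfold tri
  rw [h, map_neg]

lemma tri_rotate (x y z : GroupLieAlgebra 𝓘(ℝ, E) G) : B.tri y z x = B.tri x y z := by
  have h := B.lie_left z x y
  rw [form_comm] at h
  have h1 := B.tri_swap x y z
  unfold tri at h1 ⊢
  rw [h, h1, neg_neg]

lemma tri_sub_sub_sub (x x' y y' z z' : GroupLieAlgebra 𝓘(ℝ, E) G) :
    B.tri (x - x') (y - y') (z - z') =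
      B.tri x y z - B.tri x y z' - B.tri x y' z + B.tri x y' z'
        - B.tri x' y z + B.tri x' y z' + B.tri x' y' z - B.tri x' y' z' := by
  have : CompleteSpace E := FiniteDimensional.complete ℝ E
  have := lieGroup_minSmoothness E G
  unfold tri
  rw [sub_lie, lie_sub, lie_sub]
  simp only [map_sub, LinearMap.sub_apply]
  ring

lemma tri_smul (c : ℝ) (x y z : GroupLieAlgebra 𝓘(ℝ, E) G) :
    B.tri (c • x) (c • y) (c • z) = c ^ 3 * B.tri x y z := by
  have : CompleteSpace E := FiniteDimensional.complete ℝ E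
  have := lieGroup_minSmoothness E G
  unfold tri
  rw [smul_lie, lie_smul]
  simp only [map_smul, LinearMap.smul_apply, smul_eq_mul]
  ring

lemma tri_adj (g : G) (x y z : GroupLieAlgebra 𝓘(ℝ, E) G) :
    B.tri (adj g x) (adj g y) (adj g z) = B.tri x y z := by
  have : CompleteSpace E := FiniteDimensional.complete ℝ E
  unfold tri
  rw [← adj_lie, B.invariant]

lemma tri_sharp (α β γ : E →L[ℝ] ℝ) :
    ∑ i, ∑ j, ∑ k, B.form (B.dual e i) ⁅B.dual e j, B.dual e k⁆ * (α (e i) * β (e j) * γ (e k)) =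
      B.tri (B.sharp α) (B.sharp β) (B.sharp γ) := by
  have : CompleteSpace E := FiniteDimensional.complete ℝ E
  have := lieGroup_minSmoothness E G
  rw [← B.sum_smul_dual e α, ← B.sum_smul_dual e β, ← B.sum_smul_dual e γ, tri]
  simp only [sum_lie, lie_sum, map_sum, LinearMap.sum_apply, smul_lie,
    lie_smul, map_smul, LinearMap.smul_apply, smul_eq_mul]
  refine (Finset.sum_comm.trans (Finset.sum_congr rfl fun j _ => Finset.sum_comm)).trans
    (Finset.sum_comm.trans ?_)
  refine Finset.sum_congr rfl fun k _ => ?_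
  rw [Finset.mul_sum]
  refine Finset.sum_congr rfl fun j _ => ?_
  rw [Finset.mul_sum, Finset.mul_sum]
  exact Finset.sum_congr rfl fun i _ => by ring

end InvariantForm

variable {E' H' : Type*} [NormedAddCommGroup E'] [NormedSpace ℝ E'] [TopologicalSpace H']
  {I : ModelWithCorners ℝ E' H'} {M : Type*} [TopologicalSpace M] [ChartedSpace H' M]

variable (E) in
/-- The pull-back of a covector at `m` to a linear form on the Lie algebra, along the fundamental
vector fields of an action. -/
noncomputable def pullFundamental (a : G → M → M) (m : M) (α : TangentSpace I m →L[ℝ] ℝ) :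
    E →L[ℝ] ℝ :=
  let d : E →L[ℝ] E' := mfderiv 𝓘(ℝ, E) I (fun g : G => a g m) 1
  let α' : E' →L[ℝ] ℝ := α
  α'.comp (-d)

lemma pullFundamental_apply (a : G → M → M) (m : M) (α : TangentSpace I m →L[ℝ] ℝ)
    (x : GroupLieAlgebra 𝓘(ℝ, E) G) :
    pullFundamental E a m α x = α (fundamental I a x m) := rfl

/-- The Cartan trivector is `½ ⟨x, [y, z]⟩` as a trilinear form on `𝔤* ≅ 𝔤`: all six permutations
in `eᵢ ∧ eⱼ ∧ eₖ` contribute equally. -/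
lemma cartanField_apply (B : InvariantForm E G)
    (e : Module.Basis ι ℝ (GroupLieAlgebra 𝓘(ℝ, E) G)) (a : G → M → M) (m : M)
    (α : Fin 3 → TangentSpace I m →L[ℝ] ℝ) :
    cartanField I B e a m α = 1 / 2 * B.tri (B.sharp (pullFundamental E a m (α 0)))
      (B.sharp (pullFundamental E a m (α 1))) (B.sharp (pullFundamental E a m (α 2))) := by
  set p : Fin 3 → E →L[ℝ] ℝ := fun i => pullFundamental E a m (α i) with hp
  have h1 : ∀ i j k, (B.form (B.dual e i) ⁅B.dual e j, B.dual e k⁆ • wedge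
      ![fundamental I a (e i) m, fundamental I a (e j) m, fundamental I a (e k) m]) α =
      B.form (B.dual e i) ⁅B.dual e j, B.dual e k⁆ * (p 0 (e i) * p 1 (e j) * p 2 (e k)) -
      B.form (B.dual e i) ⁅B.dual e j, B.dual e k⁆ * (p 0 (e i) * p 2 (e j) * p 1 (e k)) -
      B.form (B.dual e i) ⁅B.dual e j, B.dual e k⁆ * (p 1 (e i) * p 0 (e j) * p 2 (e k)) +
      B.form (B.dual e i) ⁅B.dual e j, B.dual e k⁆ * (p 2 (e i) * p 0 (e j) * p 1 (e k)) +
      B.form (B.dual e i) ⁅B.dual e j, B.dual e k⁆ * (p 1 (e i) * p 2 (e j) * p 0 (e k)) -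
      B.form (B.dual e i) ⁅B.dual e j, B.dual e k⁆ * (p 2 (e i) * p 1 (e j) * p 0 (e k)) :=
    fun i j k => by
      refine (congrArg (B.form (B.dual e i) ⁅B.dual e j, B.dual e k⁆ * ·)
        (wedge_three _ _ _ _)).trans ?_
      simp only [hp, pullFundamental_apply]
      ring
  have h2 : cartanField I B e a m α = (1 / 12 : ℝ) * ∑ i, ∑ j, ∑ k,
      (B.form (B.dual e i) ⁅B.dual e j, B.dual e k⁆ • wedge
      ![fundamental I a (e i) m, fundamental I a (e j) m, fundamental I a (e k) m]) α := by
    unfold cartanField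
    refine congrArg ((1 / 12 : ℝ) * ·) ((KVector.sum_apply _ _ _).trans ?_)
    refine Finset.sum_congr rfl fun i _ => (KVector.sum_apply _ _ _).trans ?_
    exact Finset.sum_congr rfl fun j _ => KVector.sum_apply _ _ _
  rw [h2]
  simp only [h1, Finset.sum_add_distrib, Finset.sum_sub_distrib, B.tri_sharp e]
  have s1 := B.tri_swap (B.sharp (p 0)) (B.sharp (p 1)) (B.sharp (p 2))
  have s2 := B.tri_swap (B.sharp (p 1)) (B.sharp (p 2)) (B.sharp (p 0))
  have s3 := B.tri_swap (B.sharp (p 2)) (B.sharp (p 0)) (B.sharp (p 1))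
  have r1 := B.tri_rotate (B.sharp (p 0)) (B.sharp (p 1)) (B.sharp (p 2))
  have r2 := B.tri_rotate (B.sharp (p 1)) (B.sharp (p 2)) (B.sharp (p 0))
  rw [s1, s2, s3, r2, r1]
  ring

/-- Rescaling the form by `c` rescales the Cartan trivector by `c⁻²`. -/
lemma cartanField_scale (B : InvariantForm E G)
    (e : Module.Basis ι ℝ (GroupLieAlgebra 𝓘(ℝ, E) G)) (a : G → M → M) {c : ℝ} (hc : c ≠ 0)
    (m : M) : cartanField I (B.scale c hc) e a m = (c⁻¹) ^ 2 • cartanField I B e a m := by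
  have : CompleteSpace E := FiniteDimensional.complete ℝ E
  have := lieGroup_minSmoothness E G
  have hs : ∀ α : E →L[ℝ] ℝ, (B.scale c hc).sharp α = c⁻¹ • B.sharp α := fun α => by
    rw [InvariantForm.sharp_eq_iff]
    intro z
    have h1 : (B.scale c hc).form (c⁻¹ • B.sharp α) z = c * (c⁻¹ * B.form (B.sharp α) z) :=
      congrArg (c * ·) (LinearMap.map_smul₂ B.form _ _ _)
    rw [h1, ← mul_assoc, mul_inv_cancel₀ hc, one_mul]
    exact B.sharp_left α z
  ext α
  refine (cartanField_apply (B.scale c hc) e a m α).trans ?_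
  refine Eq.trans ?_ (congrArg ((c⁻¹) ^ 2 * ·) (cartanField_apply B e a m α).symm)
  have ht : ∀ x y z, (B.scale c hc).tri (c⁻¹ • x) (c⁻¹ • y) (c⁻¹ • z) =
      c * (c⁻¹ ^ 3 * B.tri x y z) := fun x y z => congrArg (c * ·) (B.tri_smul _ x y z)
  rw [hs, hs, hs, ht]
  field_simp

lemma isInvariant_of_apply {k : ℕ} {T : KVectorField I M k} {a : G → M → M}
    (h : ∀ g m (α : Fin k → TangentSpace I (a g m) →L[ℝ] ℝ),
      T m (fun i => (α i).comp (mfderiv I I (a g) m)) = T (a g m) α) : T.IsInvariant a :=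
  fun g m => AlternatingMap.ext fun α => h g m α

lemma momentOperator_scale (B : InvariantForm E G)
    (e : Module.Basis ι ℝ (GroupLieAlgebra 𝓘(ℝ, E) G)) {c : ℝ} (hc : c ≠ 0) (f : G → ℝ) (g : G) :
    momentOperator (B.scale c hc) e f g = c⁻¹ • momentOperator B e f g := by
  have hd : ∀ i, (B.scale c hc).dual e i = c⁻¹ • B.dual e i := fun i => by
    refine (B.scale c hc).eq_of_form_left fun z => ?_
    have h1 : (B.scale c hc).form (c⁻¹ • B.dual e i) z = c * (c⁻¹ * B.form (B.dual e i) z) :=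
      congrArg (c * ·) (LinearMap.map_smul₂ B.form _ _ _)
    rw [h1, ← mul_assoc, mul_inv_cancel₀ hc, one_mul]
    have h2 : (B.scale c hc).form ((B.scale c hc).dual e i) = B.form (B.dual e i) :=
      e.ext fun j => (LinearMap.BilinForm.apply_dualBasis_left _ e i j).trans
        (LinearMap.BilinForm.apply_dualBasis_left B.nondegenerate e i j).symm
    exact LinearMap.congr_fun h2 z
  unfold momentOperator
  simp only [hd, smul_comm _ c⁻¹]
  rw [← Finset.smul_sum, smul_comm]

/-- If `(M, P, Φ, μ)` is a Hamiltonian quasi-Poisson manifold for a form, then `(M, tP, t²Φ, μ)` is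
one for the form multiplied by `t⁻¹`. -/
lemma IsHamiltonianQuasiPoisson.scale {B : InvariantForm E G}
    {e : Module.Basis ι ℝ (GroupLieAlgebra 𝓘(ℝ, E) G)} {a : G → M → M} {P : KVectorField I M 2}
    {Φ : KVectorField I M 3} {μ : M → G} (h : IsHamiltonianQuasiPoisson I B e a P Φ μ) {t : ℝ}
    (ht : t ≠ 0) : IsHamiltonianQuasiPoisson I (B.scale t⁻¹ (inv_ne_zero ht)) e a
      (fun m => t • P m) (fun m => t ^ 2 • Φ m) μ where
  action := h.action
  smooth := h.smooth.smul contMDiff_const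
  invariant g m := congrArg (t • ·) (h.invariant g m)
  trivector := by
    funext m
    rw [cartanField_scale, inv_inv, h.trivector]
  jacobi := by
    intro U hU f₁ f₂ f₃ h₁ h₂ h₃ m hm
    have hb : ∀ f g : M → ℝ, bivectorBracket (fun m => t • P m) f g =
        fun m => t * bivectorBracket P f g m := fun f g => rfl
    have hb2 : ∀ f₁ f₂ f₃ : M → ℝ, ContMDiffOn I 𝓘(ℝ, ℝ) ∞ f₂ U → ContMDiffOn I 𝓘(ℝ, ℝ) ∞ f₃ U →
        bivectorBracket (fun m => t • P m) f₁ (bivectorBracket (fun m => t • P m) f₂ f₃) m =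
          t ^ 2 * bivectorBracket P f₁ (bivectorBracket P f₂ f₃) m := fun f₁ f₂ f₃ h₂ h₃ => by
      have hd := ((h.smooth.bracket hU h₂ h₃).contMDiffAt (hU.mem_nhds hm)).mdifferentiableAt
        (by simp)
      have h1 := congrArg (fun β => t * P m ![covec I f₁ m, β]) (covec_const_mul hd t)
      refine h1.trans ((congrArg (t * ·) (KVector.map_smul_right _ _ _ _)).trans ?_)
      rw [← mul_assoc, ← sq]
      rfl
    rw [hb2 _ _ _ h₂ h₃, hb2 _ _ _ h₃ h₁, hb2 _ _ _ h₁ h₂]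
    refine (congrArg (t ^ 2 * ·) (h.jacobi U hU f₁ f₂ f₃ h₁ h₂ h₃ m hm)).trans ?_
    ring
  moment_smooth := h.moment_smooth
  moment_equivariant := h.moment_equivariant
  moment f hf m β := by
    rw [momentOperator_scale, inv_inv]
    refine (congrArg (t * ·) (h.moment f hf m β)).trans ?_
    rw [← pullFundamental_apply, ← pullFundamental_apply]
    exact (map_smul (pullFundamental E a m β) t _).symm

end Cartan

/-! ### The quasi-Poisson structure of a Lie group -/

section PullBack

variable {E : Type*} [NormedAddCommGroup E] [NormedSpace ℝ E]
  {G : Type*} [TopologicalSpace G] [ChartedSpace E G] [Group G]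

/-- The linear form `x ↦ α(x^L(g))` on the Lie algebra. -/
noncomputable def pullLeft (g : G) (α : TangentSpace 𝓘(ℝ, E) g →L[ℝ] ℝ) : E →L[ℝ] ℝ :=
  let d : E →L[ℝ] E := mfderiv 𝓘(ℝ, E) 𝓘(ℝ, E) (fun h : G => g * h) 1
  let α' : E →L[ℝ] ℝ := α
  α'.comp d

/-- The linear form `x ↦ α(x^R(g))` on the Lie algebra. -/
noncomputable def pullRight (g : G) (α : TangentSpace 𝓘(ℝ, E) g →L[ℝ] ℝ) : E →L[ℝ] ℝ :=
  let d : E →L[ℝ] E := mfderiv 𝓘(ℝ, E) 𝓘(ℝ, E) (fun h : G => h * g) 1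
  let α' : E →L[ℝ] ℝ := α
  α'.comp d

variable [LieGroup 𝓘(ℝ, E) ∞ G]

lemma pullLeft_covec {f : G → ℝ} {g : G} (hf : MDifferentiableAt 𝓘(ℝ, E) 𝓘(ℝ, ℝ) f g) :
    pullLeft g (covec 𝓘(ℝ, E) f g) = leftDeriv f g :=
  ContinuousLinearMap.ext fun x => covec_leftField hf x

lemma pullRight_covec {f : G → ℝ} {g : G} (hf : MDifferentiableAt 𝓘(ℝ, E) 𝓘(ℝ, ℝ) f g) :
    pullRight g (covec 𝓘(ℝ, E) f g) = rightDeriv f g :=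
  ContinuousLinearMap.ext fun x => covec_rightField hf x

lemma leftField_eq_rightField_adj (x : GroupLieAlgebra 𝓘(ℝ, E) G) (g : G) :
    leftField x g = rightField (adj g x) g := by
  have e : (fun h : G => g * h) = (fun k => k * g) ∘ fun h => g * h * g⁻¹ := by
    ext h; simp
  unfold leftField
  rw [e]
  exact mfderiv_comp_apply_of_eq (1 : G) (mdifferentiableAt_mul_right_one g)
    (mdifferentiableAt_conj_one g) (by simp) x

lemma mfderiv_conj_rightField (a g : G) (x : GroupLieAlgebra 𝓘(ℝ, E) G) :
    (mfderiv 𝓘(ℝ, E) 𝓘(ℝ, E) (fun h : G => a * h * a⁻¹) g (rightField x g) : E) =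
      rightField (adj a x) (a * g * a⁻¹) := by
  have e : (fun h : G => a * h * a⁻¹) ∘ (fun h => h * g) =
      (fun k => k * (a * g * a⁻¹)) ∘ fun h => a * h * a⁻¹ := by
    ext h; simp [mul_assoc]
  have h1 := mfderiv_comp_apply_of_eq (1 : G)
    ((contMDiff_conj_right (E := E) a).mdifferentiableAt (by simp : (∞ : WithTop ℕ∞) ≠ 0))
    (mdifferentiableAt_mul_right_one g) (one_mul g) x
  have h2 := mfderiv_comp_apply_of_eq (1 : G) (mdifferentiableAt_mul_right_one (a * g * a⁻¹))
    (mdifferentiableAt_conj_one (E := E) a) (by simp) x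
  rw [← e] at h2
  exact h1.symm.trans h2

lemma mfderiv_conj_leftField (a g : G) (x : GroupLieAlgebra 𝓘(ℝ, E) G) :
    (mfderiv 𝓘(ℝ, E) 𝓘(ℝ, E) (fun h : G => a * h * a⁻¹) g (leftField x g) : E) =
      leftField (adj a x) (a * g * a⁻¹) := by
  have e : (fun h : G => a * h * a⁻¹) ∘ (fun h => g * h) =
      (fun k => (a * g * a⁻¹) * k) ∘ fun h => a * h * a⁻¹ := by
    ext h; simp [mul_assoc]
  have h1 := mfderiv_comp_apply_of_eq (1 : G)
    ((contMDiff_conj_right (E := E) a).mdifferentiableAt (by simp : (∞ : WithTop ℕ∞) ≠ 0))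
    (mdifferentiableAt_mul_left_one g) (mul_one g) x
  have h2 := mfderiv_comp_apply_of_eq (1 : G) (mdifferentiableAt_mul_left_one (a * g * a⁻¹))
    (mdifferentiableAt_conj_one (E := E) a) (by simp) x
  rw [← e] at h2
  exact h1.symm.trans h2

/-- The fundamental vector fields of the conjugation action are `x^L - x^R`. -/
lemma fundamental_conj (x : GroupLieAlgebra 𝓘(ℝ, E) G) (g : G) :
    fundamental 𝓘(ℝ, E) (fun g h : G => g * h * g⁻¹) x g = leftField x g - rightField x g := by
  have hm : ContMDiff (𝓘(ℝ, E).prod 𝓘(ℝ, E)) 𝓘(ℝ, E) ∞ (fun p : G × G => p.1 * p.2) :=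
    contMDiff_mul 𝓘(ℝ, E) ∞
  have hs : ContMDiff (𝓘(ℝ, E).prod 𝓘(ℝ, E)) 𝓘(ℝ, E) ∞
      (Function.uncurry fun a b : G => a * g * b⁻¹) :=
    (contMDiff_fst.mul contMDiff_const).mul contMDiff_snd.inv
  have hs' : ContMDiff (𝓘(ℝ, E).prod 𝓘(ℝ, E)) 𝓘(ℝ, E) ∞
      (Function.uncurry fun a b : G => g * a * b⁻¹) :=
    (contMDiff_const.mul contMDiff_fst).mul contMDiff_snd.inv
  have h1 := mfderiv_diag (hs.mdifferentiableAt (by simp) (x := ((1 : G), (1 : G)))) x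
  have h2 := mfderiv_diag (hs'.mdifferentiableAt (by simp) (x := ((1 : G), (1 : G)))) x
  -- the second map is constant on the diagonal
  have e0 : (fun h : G => g * h * h⁻¹) = fun _ => g := by ext h; simp
  have e1 : (fun h : G => g * h * 1⁻¹) = fun h => g * h := by ext h; simp
  have e2 : (fun h : G => g * 1 * h⁻¹) = fun h => 1 * g * h⁻¹ := by ext h; simp
  have e3 : (fun h : G => h * g * 1⁻¹) = fun h => h * g := by ext h; simp
  have h0 : (mfderiv 𝓘(ℝ, E) 𝓘(ℝ, E) (fun h : G => g * h * h⁻¹) 1 x : E) = 0 := by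
    rw [e0]
    exact congrArg (fun L : E →L[ℝ] E => L x)
      (mfderiv_const (I := 𝓘(ℝ, E)) (I' := 𝓘(ℝ, E)) (c := g) (x := (1 : G)))
  rw [h0] at h2
  have e1' : (mfderiv 𝓘(ℝ, E) 𝓘(ℝ, E) (fun h : G => g * h * 1⁻¹) 1 x : E) = leftField x g := by
    rw [e1]; rfl
  have e2' : (mfderiv 𝓘(ℝ, E) 𝓘(ℝ, E) (fun h : G => g * 1 * h⁻¹) 1 x : E) =
      mfderiv 𝓘(ℝ, E) 𝓘(ℝ, E) (fun h : G => 1 * g * h⁻¹) 1 x :=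
    congrArg (fun u : G → G => (mfderiv 𝓘(ℝ, E) 𝓘(ℝ, E) u 1 x : E)) e2
  have e3' : (mfderiv 𝓘(ℝ, E) 𝓘(ℝ, E) (fun h : G => h * g * 1⁻¹) 1 x : E) = rightField x g := by
    rw [e3]; rfl
  let l : E := leftField x g
  let r : E := rightField x g
  let s : E := mfderiv 𝓘(ℝ, E) 𝓘(ℝ, E) (fun h : G => 1 * g * h⁻¹) 1 x
  let c : E := mfderiv 𝓘(ℝ, E) 𝓘(ℝ, E) (fun h : G => h * g * h⁻¹) 1 x
  have k1 : c = r + s := h1.trans (congrArg (· + s) e3')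
  have k2 : (0 : E) = l + s := h2.trans (congrArg₂ (fun a b : E => a + b) e1' e2')
  have k3 : -c = l - r := by
    rw [k1, eq_neg_of_add_eq_zero_right k2.symm]
    abel
  exact k3

end PullBack

section GroupBivector

variable {E : Type*} [NormedAddCommGroup E] [NormedSpace ℝ E] [FiniteDimensional ℝ E]
  {G : Type*} [TopologicalSpace G] [ChartedSpace E G] [Group G] [LieGroup 𝓘(ℝ, E) ∞ G]
  {ι : Type*} [Fintype ι] [DecidableEq ι] (B : InvariantForm E G)
  (e : Module.Basis ι ℝ (GroupLieAlgebra 𝓘(ℝ, E) G))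

lemma isSmoothAction_conj : IsSmoothAction (E := E) 𝓘(ℝ, E) (fun g h : G => g * h * g⁻¹) where
  one m := by simp
  mul g h m := by simp [mul_assoc]
  smooth := contMDiff_conj

lemma pullFundamental_conj (g : G) (α : TangentSpace 𝓘(ℝ, E) g →L[ℝ] ℝ) :
    pullFundamental E (fun g h : G => g * h * g⁻¹) g α = pullLeft g α - pullRight g α :=
  ContinuousLinearMap.ext fun x =>
    (congrArg α (fundamental_conj x g)).trans (map_sub α _ _)

lemma InvariantForm.sharp_pullRight (g : G) (α : TangentSpace 𝓘(ℝ, E) g →L[ℝ] ℝ) :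
    B.sharp (pullRight g α) = adj g (B.sharp (pullLeft g α)) := by
  have : CompleteSpace E := FiniteDimensional.complete ℝ E
  refine B.sharp_eq_iff.2 fun z => (B.adj_left g _ z).trans ((B.sharp_left _ _).trans ?_)
  exact congrArg α ((leftField_eq_rightField_adj (adj g⁻¹ z) g).trans
    (congrArg (fun y => rightField y g) (adj_adj_inv g z)))

lemma InvariantForm.sharp_comp_adj (g : G) (α β : E →L[ℝ] ℝ)
    (h : ∀ x : GroupLieAlgebra 𝓘(ℝ, E) G, β x = α (adj g x)) :
    adj g (B.sharp β) = B.sharp α := by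
  have : CompleteSpace E := FiniteDimensional.complete ℝ E
  refine (B.sharp_eq_iff.2 fun z => (B.adj_left g _ z).trans ((B.sharp_left _ _).trans ?_)).symm
  exact (h _).trans (congrArg α (adj_adj_inv g z))

lemma groupBivector_apply (g : G) (α : Fin 2 → TangentSpace 𝓘(ℝ, E) g →L[ℝ] ℝ) :
    groupBivector B e g α = 1 / 2 * (pullLeft g (α 1) (B.sharp (pullRight g (α 0))) -
      pullRight g (α 1) (B.sharp (pullLeft g (α 0)))) := by
  rw [← B.sum_mul_dual e, ← B.sum_dual_mul e, ← Finset.sum_sub_distrib]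
  refine congrArg ((1 / 2 : ℝ) * ·) ((KVector.sum_apply _ _ _).trans ?_)
  exact Finset.sum_congr rfl fun i _ => wedge_two _ _ _

lemma isSmooth_groupBivector : (groupBivector B e).IsSmooth := by
  refine KVectorField.IsSmooth.smul (KVectorField.IsSmooth.sum fun i _ => ?_) contMDiff_const
  have h := isSmooth_wedge (I := 𝓘(ℝ, E)) (M := G)
    (V := ![rightField (e i), leftField (B.dual e i)]) (fun j => by
      fin_cases j
      exacts [isSmoothField_rightField _, isSmoothField_leftField _])
  convert! h using 3 with g
  ext j
  fin_cases j <;> rfl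

lemma isInvariant_groupBivector :
    (groupBivector B e).IsInvariant (fun g h : G => g * h * g⁻¹) := by
  have : CompleteSpace E := FiniteDimensional.complete ℝ E
  refine isInvariant_of_apply fun a g α => ?_
  rw [groupBivector_apply, groupBivector_apply]
  have hR : ∀ i, ∀ x : GroupLieAlgebra 𝓘(ℝ, E) G,
      pullRight g ((α i).comp (mfderiv 𝓘(ℝ, E) 𝓘(ℝ, E) (fun h : G => a * h * a⁻¹) g)) x =
        pullRight (a * g * a⁻¹) (α i) (adj a x) :=
    fun i x => congrArg (α i) (mfderiv_conj_rightField a g x)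
  have hL : ∀ i, ∀ x : GroupLieAlgebra 𝓘(ℝ, E) G,
      pullLeft g ((α i).comp (mfderiv 𝓘(ℝ, E) 𝓘(ℝ, E) (fun h : G => a * h * a⁻¹) g)) x =
        pullLeft (a * g * a⁻¹) (α i) (adj a x) :=
    fun i x => congrArg (α i) (mfderiv_conj_leftField a g x)
  rw [hL, hR, B.sharp_comp_adj a _ _ (hR 0), B.sharp_comp_adj a _ _ (hL 0)]

lemma momentOperator_eq (f : G → ℝ) (g : G) : momentOperator B e f g =
    (1 / 2 : ℝ) • (B.sharp (pullLeft g (covec 𝓘(ℝ, E) f g)) +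
      B.sharp (pullRight g (covec 𝓘(ℝ, E) f g))) := by
  rw [← B.sharp_add, ← B.sum_smul_dual e]
  unfold momentOperator
  congr 1
  exact Finset.sum_congr rfl fun i _ => congrArg (· • B.dual e i) (map_add _ _ _)

lemma groupBivector_moment (f : G → ℝ) (g : G) (β : TangentSpace 𝓘(ℝ, E) g →L[ℝ] ℝ) :
    groupBivector B e g ![covec 𝓘(ℝ, E) f g, β] =
      β (fundamental 𝓘(ℝ, E) (fun g h : G => g * h * g⁻¹) (momentOperator B e f g) g) := by
  rw [groupBivector_apply, ← pullFundamental_apply, momentOperator_eq]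
  set l := B.sharp (pullLeft g (covec 𝓘(ℝ, E) f g)) with hl
  set r := B.sharp (pullRight g (covec 𝓘(ℝ, E) f g)) with hr
  have hlr : pullRight g β r = pullLeft g β l := by
    rw [hr, B.sharp_pullRight]
    exact (congrArg β (leftField_eq_rightField_adj _ g)).symm
  have e1 : pullFundamental E (fun g h : G => g * h * g⁻¹) g β ((1 / 2 : ℝ) • (l + r)) =
      1 / 2 * ((pullLeft g β l + pullLeft g β r) - (pullRight g β l + pullRight g β r)) := by
    rw [pullFundamental_conj]
    exact (map_smul (pullLeft g β - pullRight g β) _ _).trans (congrArg ((1 / 2 : ℝ) * ·)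
      (congrArg₂ (· - ·) (map_add (pullLeft g β) l r) (map_add (pullRight g β) l r)))
  rw [e1, hlr]
  change 1 / 2 * (pullLeft g β r - pullRight g β l) = _
  ring

lemma covec_const_mul_apply {E' H' : Type*} [NormedAddCommGroup E'] [NormedSpace ℝ E']
    [TopologicalSpace H'] {I : ModelWithCorners ℝ E' H'} {M : Type*} [TopologicalSpace M]
    [ChartedSpace H' M] {f : M → ℝ} {m : M} (hf : MDifferentiableAt I 𝓘(ℝ, ℝ) f m) (c : ℝ)
    (v : TangentSpace I m) : covec I (fun x => c * f x) m v = c * covec I f m v :=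
  congrArg (fun L => L v) (covec_const_mul hf c)

/-- Contraction with a fixed vector commutes with linear combinations, also after derivation. -/
lemma covec_apply_sum {E' H' : Type*} [NormedAddCommGroup E'] [NormedSpace ℝ E']
    [TopologicalSpace H'] {I : ModelWithCorners ℝ E' H'} {M : Type*} [TopologicalSpace M]
    [ChartedSpace H' M] {A : M → GroupLieAlgebra 𝓘(ℝ, E) G →L[ℝ] ℝ} {m : M}
    (hA : ∀ x, MDifferentiableAt I 𝓘(ℝ, ℝ) (fun q => A q x) m)
    (c : ι → ℝ) (b : ι → GroupLieAlgebra 𝓘(ℝ, E) G) (v : TangentSpace I m) :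
    covec I (fun q => A q (∑ i, c i • b i)) m v =
      ∑ i, c i * covec I (fun q => A q (b i)) m v := by
  have e1 : (fun q => A q (∑ i, c i • b i)) = fun q => ∑ i, c i * A q (b i) := by
    funext q
    simp only [map_sum, map_smul, smul_eq_mul]
  have hd : ∀ i, MDifferentiableAt I 𝓘(ℝ, ℝ) (fun q => c i * A q (b i)) m :=
    fun i => (hA (b i)).const_smul (c i)
  rw [e1, (covec_sum fun i _ => hd i).2]
  refine (sum_apply _ _ _).trans (Finset.sum_congr rfl fun i _ => ?_)
  exact congrArg (fun L => L v) (covec_const_mul (hA (b i)) (c i))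

/-- `H_f = ½ (y^L - x^R)`, where `x` and `y` correspond to the forms `z ↦ z^L f`, `z ↦ z^R f` at
the point `p`: the vector field with constant coefficients which agrees with the Hamiltonian vector
field of `f` at `p`. Here it is applied to the function `h`. -/
noncomputable def frozen (B : InvariantForm E G) (p : G) (f h : G → ℝ) (q : G) : ℝ :=
  1 / 2 * (leftDeriv h q (B.sharp (rightDeriv f p)) - rightDeriv h q (B.sharp (leftDeriv f p)))

lemma groupBracket_eq {f h : G → ℝ} {p : G} (hf : MDifferentiableAt 𝓘(ℝ, E) 𝓘(ℝ, ℝ) f p)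
    (hh : MDifferentiableAt 𝓘(ℝ, E) 𝓘(ℝ, ℝ) h p) :
    bivectorBracket (groupBivector B e) f h p = frozen B p f h p := by
  unfold bivectorBracket frozen
  rw [groupBivector_apply, ← pullLeft_covec hf, ← pullLeft_covec hh, ← pullRight_covec hf,
    ← pullRight_covec hh]
  rfl

lemma covec_frozen (B : InvariantForm E G) {f h : G → ℝ} {p : G}
    (hL : ∀ x : GroupLieAlgebra 𝓘(ℝ, E) G, MDifferentiableAt 𝓘(ℝ, E) 𝓘(ℝ, ℝ)
      (fun q => leftDeriv h q x) p)
    (hR : ∀ x : GroupLieAlgebra 𝓘(ℝ, E) G, MDifferentiableAt 𝓘(ℝ, E) 𝓘(ℝ, ℝ)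
      (fun q => rightDeriv h q x) p)
    (v : TangentSpace 𝓘(ℝ, E) p) : covec 𝓘(ℝ, E) (frozen B p f h) p v = 1 / 2 *
      (covec 𝓘(ℝ, E) (fun q => leftDeriv h q (B.sharp (rightDeriv f p))) p v -
        covec 𝓘(ℝ, E) (fun q => rightDeriv h q (B.sharp (leftDeriv f p))) p v) := by
  have hd : MDifferentiableAt 𝓘(ℝ, E) 𝓘(ℝ, ℝ) (fun q => leftDeriv h q (B.sharp (rightDeriv f p)) -
      rightDeriv h q (B.sharp (leftDeriv f p))) p := (hL _).sub (hR _)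
  refine (congrArg (fun L => L v) (covec_const_mul hd (1 / 2))).trans ?_
  exact congrArg (fun L : TangentSpace 𝓘(ℝ, E) p →L[ℝ] ℝ => 1 / 2 * L v) (covec_sub (hL _) (hR _))

/-- The derivative of `{f, h}` at `p` differentiates one factor at a time. -/
lemma covec_groupBracket {f h : G → ℝ} {U : Set G} (hU : IsOpen U)
    (hf : ContMDiffOn 𝓘(ℝ, E) 𝓘(ℝ, ℝ) ∞ f U) (hh : ContMDiffOn 𝓘(ℝ, E) 𝓘(ℝ, ℝ) ∞ h U) {p : G}
    (hp : p ∈ U) (v : TangentSpace 𝓘(ℝ, E) p) :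
    covec 𝓘(ℝ, E) (bivectorBracket (groupBivector B e) f h) p v =
      covec 𝓘(ℝ, E) (frozen B p f h) p v - covec 𝓘(ℝ, E) (frozen B p h f) p v := by
  have hUp := hU.mem_nhds hp
  have dL : ∀ {w : G → ℝ}, ContMDiffOn 𝓘(ℝ, E) 𝓘(ℝ, ℝ) ∞ w U → ∀ x,
      MDifferentiableAt 𝓘(ℝ, E) 𝓘(ℝ, ℝ) (fun q => leftDeriv w q x) p := fun hw x =>
    ((contMDiffOn_leftDeriv hU hw x).contMDiffAt hUp).mdifferentiableAt (by simp)
  have dR : ∀ {w : G → ℝ}, ContMDiffOn 𝓘(ℝ, E) 𝓘(ℝ, ℝ) ∞ w U → ∀ x,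
      MDifferentiableAt 𝓘(ℝ, E) 𝓘(ℝ, ℝ) (fun q => rightDeriv w q x) p := fun hw x =>
    ((contMDiffOn_rightDeriv hU hw x).contMDiffAt hUp).mdifferentiableAt (by simp)
  have e1 : bivectorBracket (groupBivector B e) f h =ᶠ[𝓝 p] fun q => 1 / 2 * ∑ i,
      (rightDeriv f q (e i) * leftDeriv h q (B.dual e i) -
        leftDeriv f q (B.dual e i) * rightDeriv h q (e i)) := by
    filter_upwards [hUp] with q hq
    rw [groupBracket_eq B e (((hf.contMDiffAt (hU.mem_nhds hq))).mdifferentiableAt (by simp))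
      (((hh.contMDiffAt (hU.mem_nhds hq))).mdifferentiableAt (by simp))]
    unfold frozen
    rw [Finset.sum_sub_distrib]
    exact congrArg (1 / 2 * ·) (congrArg₂ (· - ·)
      (B.sum_mul_dual e (rightDeriv f q) (leftDeriv h q)).symm
      (B.sum_dual_mul e (leftDeriv f q) (rightDeriv h q)).symm)
  -- the derivative of each product falls on the second or on the first factor
  have hd : ∀ i, MDifferentiableAt 𝓘(ℝ, E) 𝓘(ℝ, ℝ) (fun q =>
      rightDeriv f q (e i) * leftDeriv h q (B.dual e i) -
        leftDeriv f q (B.dual e i) * rightDeriv h q (e i)) p := fun i =>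
    ((dR hf _).mul (dL hh _)).sub ((dL hf _).mul (dR hh _))
  have e2 : covec 𝓘(ℝ, E) (bivectorBracket (groupBivector B e) f h) p v = 1 / 2 * ∑ i,
      ((rightDeriv f p (e i) * covec 𝓘(ℝ, E) (fun q => leftDeriv h q (B.dual e i)) p v +
          leftDeriv h p (B.dual e i) * covec 𝓘(ℝ, E) (fun q => rightDeriv f q (e i)) p v) -
        (leftDeriv f p (B.dual e i) * covec 𝓘(ℝ, E) (fun q => rightDeriv h q (e i)) p v +
          rightDeriv h p (e i) * covec 𝓘(ℝ, E) (fun q => leftDeriv f q (B.dual e i)) p v)) := by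
    rw [covec_congr e1]
    rw [covec_const_mul_apply (covec_sum fun i _ => hd i).1]
    refine congrArg (1 / 2 * ·) ?_
    rw [(covec_sum fun i _ => hd i).2]
    refine (sum_apply _ _ _).trans (Finset.sum_congr rfl fun i _ => ?_)
    have m1 : MDifferentiableAt 𝓘(ℝ, E) 𝓘(ℝ, ℝ)
        (fun q => rightDeriv f q (e i) * leftDeriv h q (B.dual e i)) p := (dR hf _).mul (dL hh _)
    have m2 : MDifferentiableAt 𝓘(ℝ, E) 𝓘(ℝ, ℝ)
        (fun q => leftDeriv f q (B.dual e i) * rightDeriv h q (e i)) p := (dL hf _).mul (dR hh _)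
    rw [covec_sub m1 m2]
    exact congrArg₂ (· - ·) (congrArg (fun L => L v) (covec_mul (dR hf _) (dL hh _)))
      (congrArg (fun L => L v) (covec_mul (dL hf _) (dR hh _)))
  have s1 := covec_apply_sum (dL hh) (fun i => rightDeriv f p (e i)) (fun i => B.dual e i) v
  have s2 := covec_apply_sum (dR hh) (fun i => leftDeriv f p (B.dual e i)) (fun i => e i) v
  have s3 := covec_apply_sum (dL hf) (fun i => rightDeriv h p (e i)) (fun i => B.dual e i) v
  have s4 := covec_apply_sum (dR hf) (fun i => leftDeriv h p (B.dual e i)) (fun i => e i) v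
  have t1 : ∀ w : G → ℝ, ∑ i, rightDeriv w p (e i) • B.dual e i = B.sharp (rightDeriv w p) :=
    fun w => B.sum_smul_dual e (rightDeriv w p)
  have t2 : ∀ w : G → ℝ, ∑ i, leftDeriv w p (B.dual e i) • e i = B.sharp (leftDeriv w p) :=
    fun w => B.sum_dual_smul e (leftDeriv w p)
  rw [t1] at s1 s3
  rw [t2] at s2 s4
  rw [covec_frozen B (dL hh) (dR hh), covec_frozen B (dL hf) (dR hf), s1, s2, s3, s4, e2]
  simp only [Finset.sum_sub_distrib, Finset.sum_add_distrib]
  ring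

lemma contMDiffOn_frozen {p : G} {f h : G → ℝ} {U : Set G} (hU : IsOpen U)
    (hh : ContMDiffOn 𝓘(ℝ, E) 𝓘(ℝ, ℝ) ∞ h U) :
    ContMDiffOn 𝓘(ℝ, E) 𝓘(ℝ, ℝ) ∞ (frozen B p f h) U :=
  contMDiffOn_const.mul ((contMDiffOn_leftDeriv hU hh _).sub (contMDiffOn_rightDeriv hU hh _))

/-- `[H_f, H_g] h` for the frozen Hamiltonian vector fields: left- and right-invariant fields
commute, so only the brackets within the two halves survive. -/
lemma frozen_commutator {f g h : G → ℝ} {U : Set G} (hU : IsOpen U)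
    (hh : ContMDiffOn 𝓘(ℝ, E) 𝓘(ℝ, ℝ) ∞ h U) {p : G} (hp : p ∈ U) :
    frozen B p f (frozen B p g h) p - frozen B p g (frozen B p f h) p = 1 / 4 *
      (B.tri (B.sharp (leftDeriv h p)) (B.sharp (rightDeriv f p)) (B.sharp (rightDeriv g p)) -
        B.tri (B.sharp (rightDeriv h p)) (B.sharp (leftDeriv f p)) (B.sharp (leftDeriv g p))) := by
  have : CompleteSpace E := FiniteDimensional.complete ℝ E
  have hUp := hU.mem_nhds hp
  have dL : ∀ x, MDifferentiableAt 𝓘(ℝ, E) 𝓘(ℝ, ℝ) (fun q => leftDeriv h q x) p := fun x =>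
    ((contMDiffOn_leftDeriv hU hh x).contMDiffAt hUp).mdifferentiableAt (by simp)
  have dR : ∀ x, MDifferentiableAt 𝓘(ℝ, E) 𝓘(ℝ, ℝ) (fun q => rightDeriv h q x) p := fun x =>
    ((contMDiffOn_rightDeriv hU hh x).contMDiffAt hUp).mdifferentiableAt (by simp)
  have dF : ∀ w, MDifferentiableAt 𝓘(ℝ, E) 𝓘(ℝ, ℝ) (frozen B p w h) p := fun w =>
    ((contMDiffOn_frozen B hU hh).contMDiffAt hUp).mdifferentiableAt (by simp)
  have key : ∀ u w : G → ℝ, frozen B p u (frozen B p w h) p = 1 / 4 *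
      (leftDeriv (fun q => leftDeriv h q (B.sharp (rightDeriv w p))) p (B.sharp (rightDeriv u p)) -
        leftDeriv (fun q => rightDeriv h q (B.sharp (leftDeriv w p))) p
          (B.sharp (rightDeriv u p)) -
        rightDeriv (fun q => leftDeriv h q (B.sharp (rightDeriv w p))) p
          (B.sharp (leftDeriv u p)) +
        rightDeriv (fun q => rightDeriv h q (B.sharp (leftDeriv w p))) p
          (B.sharp (leftDeriv u p))) := fun u w => by
    rw [frozen, ← covec_leftField (dF w), ← covec_rightField (dF w), covec_frozen B dL dR,
      covec_frozen B dL dR, covec_leftField (dL _), covec_leftField (dR _),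
      covec_rightField (dL _), covec_rightField (dR _)]
    ring
  have hl : ∀ x, B.form (B.sharp (leftDeriv h p)) x = leftDeriv h p x :=
    fun x => B.sharp_left (leftDeriv h p) x
  have hr : ∀ x, B.form (B.sharp (rightDeriv h p)) x = rightDeriv h p x :=
    fun x => B.sharp_left (rightDeriv h p) x
  rw [key, key, InvariantForm.tri, InvariantForm.tri, hl, hr,
    ← leftDeriv_commutator hU hh hp, ← neg_neg (rightDeriv h p ⁅_, _⁆),
    ← rightDeriv_commutator hU hh hp]
  rw [leftDeriv_rightDeriv_comm hU hh hp (B.sharp (rightDeriv f p)) (B.sharp (leftDeriv g p)),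
    leftDeriv_rightDeriv_comm hU hh hp (B.sharp (rightDeriv g p)) (B.sharp (leftDeriv f p))]
  ring

/-- `[P_G, P_G] = φ_G`. The cyclic sum of double brackets is a sum of commutators of frozen
Hamiltonian vector fields, hence a combination of values of the trilinear form `⟨x, [y, z]⟩` on left
and right derivatives. In the expansion of `φ_G` along `x^L - x^R` the purely left and purely right
terms cancel by `Ad`-invariance, and the mixed terms are those of the commutators. -/
lemma isSchoutenSquare_groupBivector : IsSchoutenSquare (groupBivector B e)
    (cartanField 𝓘(ℝ, E) B e fun g h : G => g * h * g⁻¹) := by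
  intro U hU f g h hf hg hh p hp
  have hd : ∀ {w : G → ℝ}, ContMDiffOn 𝓘(ℝ, E) 𝓘(ℝ, ℝ) ∞ w U →
      MDifferentiableAt 𝓘(ℝ, E) 𝓘(ℝ, ℝ) w p := fun hw =>
    (hw.contMDiffAt (hU.mem_nhds hp)).mdifferentiableAt (by simp)
  have hb : ∀ {f g h : G → ℝ}, ContMDiffOn 𝓘(ℝ, E) 𝓘(ℝ, ℝ) ∞ f U →
      ContMDiffOn 𝓘(ℝ, E) 𝓘(ℝ, ℝ) ∞ g U → ContMDiffOn 𝓘(ℝ, E) 𝓘(ℝ, ℝ) ∞ h U →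
      bivectorBracket (groupBivector B e) f (bivectorBracket (groupBivector B e) g h) p =
        frozen B p f (frozen B p g h) p - frozen B p f (frozen B p h g) p :=
    fun {f g h} hf hg hh => by
      have hs := hd ((isSmooth_groupBivector B e).bracket hU hg hh)
      have h1 := hd (contMDiffOn_frozen B (p := p) (f := g) hU hh)
      have h2 := hd (contMDiffOn_frozen B (p := p) (f := h) hU hg)
      rw [groupBracket_eq B e (hd hf) hs]
      unfold frozen
      rw [← covec_leftField hs, ← covec_rightField hs, covec_groupBracket B e hU hg hh hp,
        covec_groupBracket B e hU hg hh hp, covec_leftField h1, covec_leftField h2,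
        covec_rightField h1, covec_rightField h2]
      unfold frozen
      ring
  rw [hb hf hg hh, hb hg hh hf, hb hh hf hg, cartanField_apply]
  have c1 := frozen_commutator B (f := f) (g := g) hU hh hp
  have c2 := frozen_commutator B (f := g) (g := h) hU hf hp
  have c3 := frozen_commutator B (f := h) (g := f) hU hg hp
  have hp' : ∀ {w : G → ℝ}, ContMDiffOn 𝓘(ℝ, E) 𝓘(ℝ, ℝ) ∞ w U →
      B.sharp (pullFundamental E (fun g h : G => g * h * g⁻¹) p (covec 𝓘(ℝ, E) w p)) =
        B.sharp (leftDeriv w p) - B.sharp (rightDeriv w p) := fun {w} hw => by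
    have h1 := B.sharp_sub (pullLeft p (covec 𝓘(ℝ, E) w p)) (pullRight p (covec 𝓘(ℝ, E) w p))
    rw [pullFundamental_conj, h1, pullLeft_covec (hd hw), pullRight_covec (hd hw)]
  have ha : ∀ {w : G → ℝ}, ContMDiffOn 𝓘(ℝ, E) 𝓘(ℝ, ℝ) ∞ w U →
      B.sharp (rightDeriv w p) = adj p (B.sharp (leftDeriv w p)) := fun {w} hw => by
    have h1 := B.sharp_pullRight p (covec 𝓘(ℝ, E) w p)
    rwa [pullLeft_covec (hd hw), pullRight_covec (hd hw)] at h1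
  -- left and right frames differ by `Ad`
  have t := B.tri_adj p (B.sharp (leftDeriv f p)) (B.sharp (leftDeriv g p))
    (B.sharp (leftDeriv h p))
  rw [← ha hf, ← ha hg, ← ha hh] at t
  simp only [Matrix.cons_val_zero, Matrix.cons_val_one, Matrix.cons_val]
  rw [hp' hf, hp' hg, hp' hh, B.tri_sub_sub_sub]
  generalize B.sharp (leftDeriv f p) = lf, B.sharp (rightDeriv f p) = rf,
    B.sharp (leftDeriv g p) = lg, B.sharp (rightDeriv g p) = rg,
    B.sharp (leftDeriv h p) = lh, B.sharp (rightDeriv h p) = rh at *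
  have r1 := B.tri_rotate lh rf rg
  have r2 := B.tri_rotate rh lf lg
  have r3 := B.tri_rotate lf rg lh
  have r4 := B.tri_rotate rf lg rh
  linarith

end GroupBivector

section GroupHamiltonian

variable {E : Type*} [NormedAddCommGroup E] [NormedSpace ℝ E] [FiniteDimensional ℝ E]
  {G : Type*} [TopologicalSpace G] [ChartedSpace E G] [Group G] [LieGroup 𝓘(ℝ, E) ∞ G]
  {ι : Type*} [Fintype ι] [DecidableEq ι] (B : InvariantForm E G)
  (e : Module.Basis ι ℝ (GroupLieAlgebra 𝓘(ℝ, E) G))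

lemma isHamiltonianQuasiPoisson_group :
    IsHamiltonianQuasiPoisson 𝓘(ℝ, E) B e (fun g h : G => g * h * g⁻¹) (groupBivector B e)
      (cartanField 𝓘(ℝ, E) B e fun g h : G => g * h * g⁻¹) id where
  action := isSmoothAction_conj
  smooth := isSmooth_groupBivector B e
  invariant := isInvariant_groupBivector B e
  trivector := rfl
  jacobi := isSchoutenSquare_groupBivector B e
  moment_smooth := contMDiff_id
  moment_equivariant _ _ := rfl
  moment f _ g β := groupBivector_moment B e f g β

end GroupHamiltonian

/-! ### The linear Poisson structure on the dual of the Lie algebra -/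

section Coadjoint

variable {E : Type*} [NormedAddCommGroup E] [NormedSpace ℝ E] [FiniteDimensional ℝ E]
  {G : Type*} [TopologicalSpace G] [ChartedSpace E G] [Group G] [LieGroup 𝓘(ℝ, E) ∞ G]
  {ι : Type*} [Fintype ι] [DecidableEq ι]
  (e : Module.Basis ι ℝ (GroupLieAlgebra 𝓘(ℝ, E) G))

lemma coadj_apply (g : G) (ξ : E →L[ℝ] ℝ) (x : GroupLieAlgebra 𝓘(ℝ, E) G) :
    coadj g ξ x = ξ (adj g⁻¹ x) := rfl

lemma isSmoothAction_coadj :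
    IsSmoothAction (E := E) 𝓘(ℝ, E →L[ℝ] ℝ) (coadj (E := E) (G := G)) where
  one ξ := by
    ext x
    refine (coadj_apply 1 ξ x).trans (congrArg ξ ?_)
    rw [inv_one]
    exact adj_one x
  mul g h ξ := by
    have : CompleteSpace E := FiniteDimensional.complete ℝ E
    ext x
    refine (coadj_apply (g * h) ξ x).trans (congrArg ξ ?_)
    rw [mul_inv_rev]
    exact adj_mul h⁻¹ g⁻¹ x
  smooth := by
    have : CompleteSpace E := FiniteDimensional.complete ℝ E
    have h1 : ContMDiff (M' := E →L[ℝ] E) (𝓘(ℝ, E).prod 𝓘(ℝ, E →L[ℝ] ℝ)) 𝓘(ℝ, E →L[ℝ] E) ∞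
        (fun p : G × (E →L[ℝ] ℝ) => adjE E p.1⁻¹) :=
      contMDiff_adj.comp contMDiff_fst.inv
    exact ContMDiff.clm_comp (g := fun p : G × (E →L[ℝ] ℝ) => p.2) contMDiff_snd h1

variable (E G) in
/-- The Lie bracket as a continuous bilinear map on the model space. -/
noncomputable def lieMap : E →L[ℝ] E →L[ℝ] E :=
  haveI : CompleteSpace E := FiniteDimensional.complete ℝ E
  haveI := lieGroup_minSmoothness E G
  let b : GroupLieAlgebra 𝓘(ℝ, E) G →ₗ[ℝ] GroupLieAlgebra 𝓘(ℝ, E) G →ₗ[ℝ]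
      GroupLieAlgebra 𝓘(ℝ, E) G := LinearMap.mk₂ ℝ (fun x y => ⁅x, y⁆) add_lie smul_lie lie_add
        lie_smul
  let b' : E →ₗ[ℝ] E →ₗ[ℝ] E := b
  b'.toContinuousBilinearMap

lemma lieMap_swap (x y : E) : lieMap E G y x = -lieMap E G x y := by
  have : CompleteSpace E := FiniteDimensional.complete ℝ E
  have := lieGroup_minSmoothness E G
  let x' : GroupLieAlgebra 𝓘(ℝ, E) G := x
  let y' : GroupLieAlgebra 𝓘(ℝ, E) G := y
  exact (lie_skew y' x').symm

lemma lieMap_jacobi (x y z : E) : lieMap E G x (lieMap E G y z) +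
    lieMap E G y (lieMap E G z x) + lieMap E G z (lieMap E G x y) = 0 := by
  have : CompleteSpace E := FiniteDimensional.complete ℝ E
  have := lieGroup_minSmoothness E G
  let x' : GroupLieAlgebra 𝓘(ℝ, E) G := x
  let y' : GroupLieAlgebra 𝓘(ℝ, E) G := y
  let z' : GroupLieAlgebra 𝓘(ℝ, E) G := z
  exact lie_jacobi x' y' z'

/-- The fundamental vector fields of the coadjoint action: `x ↦ ξ ∘ ad_x`. -/
lemma fundamental_coadj (ξ : E →L[ℝ] ℝ) (x : GroupLieAlgebra 𝓘(ℝ, E) G) :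
    fundamental 𝓘(ℝ, E →L[ℝ] ℝ) (coadj (E := E) (G := G)) x ξ =
      (ξ.comp (lieMap E G x) : E →L[ℝ] ℝ) := by
  have : CompleteSpace E := FiniteDimensional.complete ℝ E
  have hc : MDifferentiableAt 𝓘(ℝ, E) 𝓘(ℝ, E →L[ℝ] ℝ) (fun g : G => coadj g ξ) 1 :=
    ((isSmoothAction_coadj (E := E) (G := G)).smooth.comp
      (contMDiff_id.prodMk contMDiff_const)).mdifferentiableAt (by simp)
  refine ContinuousLinearMap.ext fun y : E => ?_
  let ev : (E →L[ℝ] ℝ) →L[ℝ] ℝ := ContinuousLinearMap.apply ℝ ℝ y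
  have h1 := mfderiv_comp_apply (I' := 𝓘(ℝ, E →L[ℝ] ℝ)) (1 : G) (g := ev)
    ev.mdifferentiableAt hc x
  have hadj : MDifferentiableAt 𝓘(ℝ, E) 𝓘(ℝ, E) (fun g : G => adjE E g y) 1 :=
    (contMDiff_adj.contMDiffAt.clm_apply
      (contMDiffAt_const (I' := 𝓘(ℝ, E)) (M' := E) (c := y))).mdifferentiableAt (by simp)
  have hx : MDifferentiableAt 𝓘(ℝ, E) 𝓘(ℝ, ℝ) (fun h : G => ξ (adjE E h y)) 1 :=
    MDifferentiableAt.comp (I' := 𝓘(ℝ, E)) (1 : G) ξ.mdifferentiableAt hadj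
  have h3 := covec_comp_inv hx x
  have h4 : covec 𝓘(ℝ, E) (fun h : G => ξ (adjE E h y)) 1 x = ξ (lieMap E G x y) := by
    refine (mfderiv_comp_apply (I' := 𝓘(ℝ, E)) (1 : G) (g := ξ)
      (ContinuousLinearMap.mdifferentiableAt _) hadj x).trans ?_
    refine (congrArg (fun L : E →L[ℝ] ℝ => L _) (ContinuousLinearMap.mfderiv_eq ξ)).trans ?_
    exact congrArg ξ (mfderiv_adj_one x y)
  let c : E →L[ℝ] ℝ := mfderiv 𝓘(ℝ, E) 𝓘(ℝ, E →L[ℝ] ℝ) (fun g : G => coadj g ξ) 1 x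
  have h2 : (mfderiv 𝓘(ℝ, E →L[ℝ] ℝ) 𝓘(ℝ, ℝ) ev (coadj (1 : G) ξ) :
      (E →L[ℝ] ℝ) →L[ℝ] ℝ) c = ev c :=
    congrArg (fun L : (E →L[ℝ] ℝ) →L[ℝ] ℝ => L c) (ContinuousLinearMap.mfderiv_eq ev)
  have h5 : c y = -ξ (lieMap E G x y) := by
    rw [← h4, ← h3]
    exact h2.symm.trans h1.symm
  exact (congrArg (- ·) h5).trans (neg_neg _)

/-- The vectors of the basis of `𝔤*` dual to `e`. -/
noncomputable def dualVec (e : Module.Basis ι ℝ (GroupLieAlgebra 𝓘(ℝ, E) G)) : ι → E →L[ℝ] ℝ :=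
  fun j => LinearMap.toContinuousLinearMap (E := E) (e.coord j)

/-- The vector of `𝔤` at which an element `α` of the bidual is the evaluation. It does not depend
on the basis `e`, which only serves to write it down. -/
noncomputable def bidual (e : Module.Basis ι ℝ (GroupLieAlgebra 𝓘(ℝ, E) G)) :
    ((E →L[ℝ] ℝ) →L[ℝ] ℝ) →L[ℝ] E :=
  ∑ j, (ContinuousLinearMap.apply ℝ ℝ (dualVec e j)).smulRight (e j : E)

lemma bidual_eq (α : (E →L[ℝ] ℝ) →L[ℝ] ℝ) : bidual e α =
    (∑ j, α (dualVec e j) • e j : GroupLieAlgebra 𝓘(ℝ, E) G) :=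
  sum_apply (F := ((E →L[ℝ] ℝ) →L[ℝ] ℝ) →L[ℝ] E) _ _ _

lemma apply_bidual (η : E →L[ℝ] ℝ) (α : (E →L[ℝ] ℝ) →L[ℝ] ℝ) : η (bidual e α) = α η := by
  let η' : GroupLieAlgebra 𝓘(ℝ, E) G →ₗ[ℝ] ℝ := η.toLinearMap
  have h : η = ∑ j, η' (e j) • dualVec e j := by
    refine ContinuousLinearMap.ext fun x => ?_
    have h1 : η' (∑ j, e.repr x j • e j) = η' x := congrArg η' (e.sum_repr x)
    rw [map_sum] at h1
    rw [sum_apply]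
    refine Eq.trans h1.symm (Finset.sum_congr rfl fun j _ => ?_)
    rw [map_smul]
    exact mul_comm _ _
  have h2 : η (bidual e α) = ∑ j, α (dualVec e j) * η' (e j) := by
    rw [bidual_eq]
    exact (map_sum η' _ _).trans (Finset.sum_congr rfl fun j _ => map_smul η' _ _)
  rw [h2]
  conv_rhs => rw [h]
  rw [map_sum]
  refine Finset.sum_congr rfl fun j _ => ?_
  rw [map_smul]
  exact mul_comm _ _

lemma bidual_eq_of_apply {α : (E →L[ℝ] ℝ) →L[ℝ] ℝ} {x : E} (h : ∀ η : E →L[ℝ] ℝ, η x = α η) :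
    bidual e α = x :=
  (SeparatingDual.eq_iff_forall_dual_eq (R := ℝ)).2 fun η => (apply_bidual e η α).trans (h η).symm

/-- The linear Poisson bivector field is `(x, y) ↦ ξ([x, y])` on `𝔤 = (𝔤*)*`. -/
lemma linearBivector_apply (ξ : E →L[ℝ] ℝ)
    (α : Fin 2 → TangentSpace 𝓘(ℝ, E →L[ℝ] ℝ) ξ →L[ℝ] ℝ) :
    linearBivector e ξ α = ξ (lieMap E G (bidual e (α 0)) (bidual e (α 1))) := by
  let a : Fin 2 → (E →L[ℝ] ℝ) →L[ℝ] ℝ := α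
  let β : Fin 2 → ι → ℝ := fun i j => a i (dualVec e j)
  let e' : ι → E := fun j => e j
  have h0 : linearBivector e ξ = (1 / 2 : ℝ) • ∑ j, ∑ k, ξ (lieMap E G (e' j) (e' k)) •
    wedge (V := TangentSpace 𝓘(ℝ, E →L[ℝ] ℝ) ξ) ![dualVec e j, dualVec e k] := rfl
  have h1 : linearBivector e ξ α = 1 / 2 * ∑ j, ∑ k, ξ (lieMap E G (e' j) (e' k)) *
      (β 0 j * β 1 k - β 0 k * β 1 j) := by
    rw [h0]
    refine congrArg ((1 / 2 : ℝ) * ·) ?_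
    refine (KVector.sum_apply _ _ _).trans (Finset.sum_congr rfl fun j _ => ?_)
    refine (KVector.sum_apply _ _ _).trans (Finset.sum_congr rfl fun k _ => ?_)
    exact congrArg (ξ (lieMap E G (e' j) (e' k)) * ·)
      (wedge_two (V := TangentSpace 𝓘(ℝ, E →L[ℝ] ℝ) ξ) _ _ α)
  have h2 : ∀ i i', ξ (lieMap E G (bidual e (a i)) (bidual e (a i'))) =
      ∑ j, ∑ k, ξ (lieMap E G (e' j) (e' k)) * (β i j * β i' k) := fun i i' => by
    have hb : ∀ i, bidual e (a i) = ∑ j, β i j • e' j := fun i => bidual_eq e (a i)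
    rw [hb, hb]
    simp only [map_sum, map_smul, sum_apply, smul_apply, smul_eq_mul, Finset.mul_sum]
    rw [Finset.sum_comm]
    exact Finset.sum_congr rfl fun j _ => Finset.sum_congr rfl fun k _ => by ring
  have h3 : ξ (lieMap E G (bidual e (a 1)) (bidual e (a 0))) =
      -ξ (lieMap E G (bidual e (a 0)) (bidual e (a 1))) := by
    rw [lieMap_swap, map_neg]
  have h4 : 1 / 2 * (ξ (lieMap E G (bidual e (a 0)) (bidual e (a 1))) -
      ξ (lieMap E G (bidual e (a 1)) (bidual e (a 0)))) =
      ξ (lieMap E G (bidual e (a 0)) (bidual e (a 1))) := by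
    rw [h3]; ring
  refine Eq.trans ?_ h4
  rw [h1, h2, h2]
  simp only [← Finset.sum_sub_distrib]
  refine congrArg (1 / 2 * ·) ?_
  refine Finset.sum_congr rfl fun j _ => Finset.sum_congr rfl fun k _ => ?_
  ring

lemma isSmoothField_const {V : Type*} [NormedAddCommGroup V] [NormedSpace ℝ V] (v : V) :
    IsSmoothField (I := 𝓘(ℝ, V)) (M := V) fun _ => v := by
  intro U hU f hf
  refine ContDiffOn.contMDiffOn ?_
  have h := (hf.contDiffOn.fderiv_of_isOpen hU (m := ∞) (by simp)).clm_apply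
    (contDiffOn_const (c := v))
  exact h.congr fun x _ => congrArg (fun L : V →L[ℝ] ℝ => L v) mfderiv_eq_fderiv

lemma isSmooth_linearBivector : (linearBivector e).IsSmooth := by
  refine KVectorField.IsSmooth.smul (KVectorField.IsSmooth.sum fun j _ =>
    KVectorField.IsSmooth.sum fun k _ => ?_) contMDiff_const
  have h := isSmooth_wedge (I := 𝓘(ℝ, E →L[ℝ] ℝ)) (M := E →L[ℝ] ℝ)
    (V := ![fun _ => dualVec e j, fun _ => dualVec e k]) (fun i => by
      fin_cases i
      exacts [isSmoothField_const _, isSmoothField_const _])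
  have hc : ContMDiff 𝓘(ℝ, E →L[ℝ] ℝ) 𝓘(ℝ, ℝ) ∞
      (fun ξ : E →L[ℝ] ℝ => ξ (lieMap E G (e j) (e k))) :=
    (ContinuousLinearMap.apply ℝ ℝ (lieMap E G (e j) (e k))).contMDiff
  have h2 := KVectorField.IsSmooth.smul h hc
  convert! h2 using 4 with ξ
  ext i
  fin_cases i <;> rfl

lemma isInvariant_linearBivector : (linearBivector e).IsInvariant (coadj (E := E) (G := G)) := by
  have : CompleteSpace E := FiniteDimensional.complete ℝ E
  refine isInvariant_of_apply fun g ξ α => ?_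
  let L : (E →L[ℝ] ℝ) →L[ℝ] (E →L[ℝ] ℝ) :=
    ContinuousLinearMap.precomp ℝ (adjE E g⁻¹)
  have hL : (mfderiv 𝓘(ℝ, E →L[ℝ] ℝ) 𝓘(ℝ, E →L[ℝ] ℝ) (coadj (E := E) g) ξ :
      (E →L[ℝ] ℝ) →L[ℝ] (E →L[ℝ] ℝ)) = L := L.mfderiv_eq
  let a : Fin 2 → (E →L[ℝ] ℝ) →L[ℝ] ℝ := α
  have hb : ∀ i, bidual e ((a i).comp L) = adjE E g⁻¹ (bidual e (a i)) := fun i =>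
    bidual_eq_of_apply e fun η => apply_bidual e (L η) (a i)
  have h1 := congrArg (fun M : (E →L[ℝ] ℝ) →L[ℝ] (E →L[ℝ] ℝ) =>
    linearBivector e ξ fun i => (a i).comp M) hL
  refine h1.trans ((linearBivector_apply e ξ _).trans
    (Eq.trans ?_ (linearBivector_apply e (coadj g ξ) α).symm))
  exact (congrArg₂ (fun p q => ξ (lieMap E G p q)) (hb 0) (hb 1)).trans
    (congrArg ξ (adj_lie g⁻¹ _ _).symm)

lemma linearBivector_moment (x : GroupLieAlgebra 𝓘(ℝ, E) G) (ξ : E →L[ℝ] ℝ)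
    (β : TangentSpace 𝓘(ℝ, E →L[ℝ] ℝ) ξ →L[ℝ] ℝ) :
    linearBivector e ξ ![covec 𝓘(ℝ, E →L[ℝ] ℝ) (fun η : E →L[ℝ] ℝ => η (x : E)) ξ, β] =
      β (fundamental 𝓘(ℝ, E →L[ℝ] ℝ) (coadj (E := E) (G := G)) x ξ) := by
  let ev : (E →L[ℝ] ℝ) →L[ℝ] ℝ := ContinuousLinearMap.apply ℝ ℝ (x : E)
  let b : (E →L[ℝ] ℝ) →L[ℝ] ℝ := β
  have h1 : (covec 𝓘(ℝ, E →L[ℝ] ℝ) (fun η : E →L[ℝ] ℝ => η (x : E)) ξ :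
      (E →L[ℝ] ℝ) →L[ℝ] ℝ) = ev := ev.mfderiv_eq
  have h2 := congrArg (fun M : (E →L[ℝ] ℝ) →L[ℝ] ℝ => linearBivector e ξ ![M, β]) h1
  refine h2.trans ((linearBivector_apply e ξ _).trans ?_)
  have h3 : bidual e ev = x := bidual_eq_of_apply e fun η => rfl
  have h4 : ξ (lieMap E G (bidual e ev) (bidual e b)) = b (ξ.comp (lieMap E G x)) := by
    rw [h3]
    exact apply_bidual e (ξ.comp (lieMap E G x)) b
  exact h4.trans (congrArg b (fundamental_coadj ξ x).symm)

lemma linearBracket_eq (f h : (E →L[ℝ] ℝ) → ℝ) :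
    bivectorBracket (linearBivector e) f h =
      fun ξ => ξ (lieMap E G (bidual e (fderiv ℝ f ξ)) (bidual e (fderiv ℝ h ξ))) := by
  funext ξ
  have h1 : ∀ u : (E →L[ℝ] ℝ) → ℝ, (covec 𝓘(ℝ, E →L[ℝ] ℝ) u ξ : (E →L[ℝ] ℝ) →L[ℝ] ℝ) =
    fderiv ℝ u ξ := fun u => mfderiv_eq_fderiv
  refine (linearBivector_apply e ξ _).trans ?_
  exact congrArg₂ (fun α β => ξ (lieMap E G (bidual e α) (bidual e β))) (h1 f) (h1 h)

/-- The double bracket on `𝔤*`, in terms of the Hamiltonian vectors `ξ ∘ ad`. -/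
lemma linearBracket_linearBracket {f g h : (E →L[ℝ] ℝ) → ℝ} {ξ : E →L[ℝ] ℝ}
    (hg : ContDiffAt ℝ ∞ g ξ) (hh : ContDiffAt ℝ ∞ h ξ) :
    bivectorBracket (linearBivector e) f (bivectorBracket (linearBivector e) g h) ξ =
      ξ (lieMap E G (bidual e (fderiv ℝ f ξ))
        (lieMap E G (bidual e (fderiv ℝ g ξ)) (bidual e (fderiv ℝ h ξ)))) -
      fderiv ℝ (fderiv ℝ g) ξ (ξ.comp (lieMap E G (bidual e (fderiv ℝ f ξ))))
        (ξ.comp (lieMap E G (bidual e (fderiv ℝ h ξ)))) +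
      fderiv ℝ (fderiv ℝ h) ξ (ξ.comp (lieMap E G (bidual e (fderiv ℝ f ξ))))
        (ξ.comp (lieMap E G (bidual e (fderiv ℝ g ξ)))) := by
  have hD : ∀ {α : (E →L[ℝ] ℝ) →L[ℝ] ℝ}, HasFDerivAt (bidual e) (bidual e) α := fun {α} =>
    ContinuousLinearMap.hasFDerivAt (f := bidual e) (x := α)
  have hd : ∀ {u : (E →L[ℝ] ℝ) → ℝ}, ContDiffAt ℝ ∞ u ξ → HasFDerivAt
      (fun η => bidual e (fderiv ℝ u η)) ((bidual e).comp (fderiv ℝ (fderiv ℝ u) ξ)) ξ :=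
    fun {u} hu => HasFDerivAt.comp (g := bidual e) (f := fderiv ℝ u) ξ hD
      ((hu.fderiv_right (m := ∞) (by simp)).differentiableAt (by simp)).hasFDerivAt
  have hb := (lieMap E G).hasFDerivAt_of_bilinear (hd hg) (hd hh)
  have hf := ((hasFDerivAt_id ξ).clm_apply hb).fderiv
  set x := bidual e (fderiv ℝ f ξ) with hx
  set y := bidual e (fderiv ℝ g ξ) with hy
  set z := bidual e (fderiv ℝ h ξ) with hz
  have h1 : bivectorBracket (linearBivector e) f (bivectorBracket (linearBivector e) g h) ξ =
      fderiv ℝ (bivectorBracket (linearBivector e) g h) ξ (ξ.comp (lieMap E G x)) := by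
    rw [linearBracket_eq e f]
    exact apply_bidual e (ξ.comp (lieMap E G x)) _
  rw [h1, linearBracket_eq e g h]
  refine (congrArg (fun L : (E →L[ℝ] ℝ) →L[ℝ] ℝ => L (ξ.comp (lieMap E G x))) hf).trans ?_
  have h2 : ξ (lieMap E G (bidual e (fderiv ℝ (fderiv ℝ g) ξ (ξ.comp (lieMap E G x)))) z) =
      -fderiv ℝ (fderiv ℝ g) ξ (ξ.comp (lieMap E G x)) (ξ.comp (lieMap E G z)) := by
    rw [lieMap_swap, map_neg, ← apply_bidual e]
    rfl
  have h3 : ξ (lieMap E G y (bidual e (fderiv ℝ (fderiv ℝ h) ξ (ξ.comp (lieMap E G x))))) =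
      fderiv ℝ (fderiv ℝ h) ξ (ξ.comp (lieMap E G x)) (ξ.comp (lieMap E G y)) :=
    apply_bidual e (ξ.comp (lieMap E G y)) _
  rw [← h3, ← neg_eq_iff_eq_neg.2 h2, sub_neg_eq_add]
  simp only [add_apply, ContinuousLinearMap.comp_apply, ContinuousLinearMap.precompR_apply,
    ContinuousLinearMap.precompL_apply, ContinuousLinearMap.flip_apply, id, map_add,
    ContinuousLinearMap.id_apply, ContinuousLinearMap.compL_apply]
  ring

/-- `[P_0, P_0] = 0`: the terms with second derivatives cancel by their symmetry, and the remaining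
ones by the Jacobi identity. -/
lemma isSchoutenSquare_linearBivector :
    IsSchoutenSquare (linearBivector e) fun _ => 0 := by
  intro U hU f g h hf hg hh ξ hξ
  have hd : ∀ {u : (E →L[ℝ] ℝ) → ℝ}, ContMDiffOn 𝓘(ℝ, E →L[ℝ] ℝ) 𝓘(ℝ, ℝ) ∞ u U →
      ContDiffAt ℝ ∞ u ξ := fun hu => (hu.contMDiffAt (hU.mem_nhds hξ)).contDiffAt
  have hs : ∀ {u : (E →L[ℝ] ℝ) → ℝ}, ContMDiffOn 𝓘(ℝ, E →L[ℝ] ℝ) 𝓘(ℝ, ℝ) ∞ u U → ∀ v w,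
      fderiv ℝ (fderiv ℝ u) ξ v w = fderiv ℝ (fderiv ℝ u) ξ w v := fun hu =>
    (hd hu).isSymmSndFDerivAt (by
      rw [minSmoothness_of_isRCLikeNormedField]; exact ENat.LEInfty.out)
  rw [linearBracket_linearBracket e (hd hg) (hd hh), linearBracket_linearBracket e (hd hh) (hd hf),
    linearBracket_linearBracket e (hd hf) (hd hg)]
  set x := bidual e (fderiv ℝ f ξ) with hx
  set y := bidual e (fderiv ℝ g ξ) with hy
  set z := bidual e (fderiv ℝ h ξ) with hz
  have hj := congrArg ξ (lieMap_jacobi (G := G) x y z)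
  rw [map_add, map_add, map_zero] at hj
  have s1 := hs hf (ξ.comp (lieMap E G y)) (ξ.comp (lieMap E G z))
  have s2 := hs hg (ξ.comp (lieMap E G x)) (ξ.comp (lieMap E G z))
  have s3 := hs hh (ξ.comp (lieMap E G x)) (ξ.comp (lieMap E G y))
  change (0 : ℝ) = _
  linarith

lemma isHamiltonianPoisson_dual : IsHamiltonianPoisson 𝓘(ℝ, E →L[ℝ] ℝ)
    (coadj (E := E) (G := G)) (linearBivector e) id where
  action := isSmoothAction_coadj
  smooth := isSmooth_linearBivector e
  invariant := isInvariant_linearBivector e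
  jacobi := isSchoutenSquare_linearBivector e
  moment_smooth := contMDiff_id
  moment_equivariant _ _ := rfl
  moment x ξ β := linearBivector_moment e x ξ β

end Coadjoint

/-! ### The smooth structure of the deformation space -/

section ModelProd

variable {E : Type*} [NormedAddCommGroup E] [NormedSpace ℝ E]
  {ES H : Type*} [NormedAddCommGroup ES] [NormedSpace ℝ ES] [TopologicalSpace H]
  {I : ModelWithCorners ℝ ES H}
  {EM HM : Type*} [NormedAddCommGroup EM] [NormedSpace ℝ EM] [TopologicalSpace HM]
  {J : ModelWithCorners ℝ EM HM} {M : Type*} [TopologicalSpace M] [ChartedSpace HM M]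

lemma ContMDiffOn.of_modelProd {f : M → ModelProd E H} {s : Set M}
    (h : ContMDiffOn J (𝓘(ℝ, E).prod I) ∞ f s) :
    ContMDiffOn (M' := E × H) J (𝓘(ℝ, E).prod I) ∞ f s := by
  rw [chartedSpaceSelf_prod]
  exact h

lemma ContMDiffOn.from_modelProd {f : ModelProd E H → M} {s : Set (ModelProd E H)}
    (h : ContMDiffOn (𝓘(ℝ, E).prod I) J ∞ f s) :
    ContMDiffOn (M := E × H) (𝓘(ℝ, E).prod I) J ∞ f s := by
  rw [chartedSpaceSelf_prod]
  exact h

/-- A map between open subsets of `E × H` which is smooth as a map of manifolds is smooth in the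
sense used for coordinate changes. -/
lemma contDiffOn_of_contMDiffOn_prod {f : E × H → E × H} {s : Set (E × H)}
    (h : ContMDiffOn (𝓘(ℝ, E).prod I) (𝓘(ℝ, E).prod I) ∞ f s) :
    ContDiffOn ℝ ∞ (𝓘(ℝ, E).prod I ∘ f ∘ (𝓘(ℝ, E).prod I).symm)
      ((𝓘(ℝ, E).prod I).symm ⁻¹' s ∩ Set.range (𝓘(ℝ, E).prod I)) := by
  have h0 : ContMDiffOn (M := ModelProd E H) (M' := ModelProd E H)
      (𝓘(ℝ, E).prod I) (𝓘(ℝ, E).prod I) ∞ f s := by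
    rw [chartedSpaceSelf_prod] at h
    exact h
  intro y hy
  have h1 := (contMDiffWithinAt_iff.1 (h0 ((𝓘(ℝ, E).prod I).symm y) hy.1)).2
  obtain ⟨z, rfl⟩ := hy.2
  rw [extChartAt_self_eq, extChartAt_self_eq] at h1
  have h2 : (𝓘(ℝ, E).prod I).symm (𝓘(ℝ, E).prod I z) = z := (𝓘(ℝ, E).prod I).left_inv z
  rw [h2] at h1
  have h3 : chartAt (ModelProd E H) (z : ModelProd E H) = OpenPartialHomeomorph.refl _ := rfl
  simp only [extChartAt, h3, mfld_simps] at h1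
  simp only [mfld_simps]
  exact h1

end ModelProd

namespace DefSpace

variable {E : Type*} [NormedAddCommGroup E] [NormedSpace ℝ E]
  {G : Type*} [TopologicalSpace G] [ChartedSpace E G] [Group G] [LieGroup 𝓘(ℝ, E) ∞ G]
  {ES H : Type*} [NormedAddCommGroup ES] [NormedSpace ℝ ES] [TopologicalSpace H]
  {I : ModelWithCorners ℝ ES H} {S : Type*} [TopologicalSpace S] [ChartedSpace H S]
  [IsManifold I ∞ S] {τ : C(S, ℝ)} [hτ : Fact (ContMDiff I 𝓘(ℝ, ℝ) ∞ τ)]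

section Transitions

variable {c c' : OpenPartialHomeomorph G E} {d d' : OpenPartialHomeomorph S H}

lemma contMDiffOn_param (hd : d ∈ atlas H S) :
    ContMDiffOn (𝓘(ℝ, E).prod I) 𝓘(ℝ, ℝ) ∞ (fun p : E × H => τ (d.symm p.2))
      {p | p.2 ∈ d.target} :=
  hτ.out.comp_contMDiffOn ((contMDiffOn_symm_of_mem_maximalAtlas
    (IsManifold.subset_maximalAtlas hd)).comp contMDiffOn_snd fun _ hp => hp)

lemma contMDiffOn_change (hd : d ∈ atlas H S) (hd' : d' ∈ atlas H S) :
    ContMDiffOn (𝓘(ℝ, E).prod I) I ∞ (fun p : E × H => d' (d.symm p.2))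
      {p | p.2 ∈ d.target ∧ d.symm p.2 ∈ d'.source} :=
  (contMDiffOn_of_mem_maximalAtlas (IsManifold.subset_maximalAtlas hd')).comp
    ((contMDiffOn_symm_of_mem_maximalAtlas (IsManifold.subset_maximalAtlas hd)).comp
      contMDiffOn_snd fun _ hp => hp.1) fun _ hp => hp.2

lemma contMDiffOn_symm_fst (hc : c ∈ atlas E G) :
    ContMDiffOn (𝓘(ℝ, E).prod I) 𝓘(ℝ, E) ∞ (fun p : E × H => c.symm p.1)
      {p | p.1 ∈ c.target} :=
  (contMDiffOn_symm_of_mem_maximalAtlas (IsManifold.subset_maximalAtlas hc)).comp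
      contMDiffOn_fst fun _ hp => hp

lemma contMDiffOn_change_fst (hc : c ∈ atlas E G) (hc' : c' ∈ atlas E G) :
    ContMDiffOn (𝓘(ℝ, E).prod I) 𝓘(ℝ, E) ∞ (fun p : E × H => c' (c.symm p.1))
      {p | p.1 ∈ c.target ∧ c.symm p.1 ∈ c'.source} :=
  (contMDiffOn_of_mem_maximalAtlas (IsManifold.subset_maximalAtlas hc')).comp
    ((contMDiffOn_symm_fst hc).mono fun _ hp => hp.1) fun _ hp => hp.2

lemma contMDiffOn_affine (hd : d ∈ atlas H S) :
    ContMDiffOn (𝓘(ℝ, E).prod I) 𝓘(ℝ, E) ∞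
      (fun p : E × H => chartAt E (1 : G) 1 + τ (d.symm p.2) • p.1) {p | p.2 ∈ d.target} :=
  contMDiffOn_const.add ((contMDiffOn_param hd).smul contMDiffOn_fst)

lemma contMDiffOn_grp_grp (hc : c ∈ atlas E G) (hc' : c' ∈ atlas E G) (hd : d ∈ atlas H S)
    (hd' : d' ∈ atlas H S) : ContMDiffOn (M := E × H) (M' := E × H) (𝓘(ℝ, E).prod I)
      (𝓘(ℝ, E).prod I) ∞ ((grpChart (τ := τ) c d).symm.trans (grpChart c' d'))
      ((grpChart (τ := τ) c d).symm.trans (grpChart c' d')).source := by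
  rw [grp_grp_source]
  refine (((contMDiffOn_change_fst hc hc').mono fun p hp => ⟨hp.1, hp.2.2.2.1⟩).prodMk
    ((contMDiffOn_change hd hd').mono fun p hp => ⟨hp.2.1, hp.2.2.2.2⟩)).congr ?_
  rintro ⟨v, h⟩ ⟨_, _, hτ, _, _⟩
  exact congrArg (grpChart (τ := τ) c' d') (mk_of_ne _ _ hτ)

lemma contMDiffOn_grp_lie (hc : c ∈ atlas E G) (hd : d ∈ atlas H S)
    (hd' : d' ∈ atlas H S) : ContMDiffOn (M := E × H) (M' := E × H) (𝓘(ℝ, E).prod I)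
      (𝓘(ℝ, E).prod I) ∞ ((grpChart (τ := τ) c d).symm.trans (lieChart d'))
      ((grpChart (τ := τ) c d).symm.trans (lieChart d')).source := by
  rw [grp_lie_source]
  have h1 : ContMDiffOn (𝓘(ℝ, E).prod I) 𝓘(ℝ, E) ∞ (fun p : E × H => (τ (d.symm p.2))⁻¹ •
      (chartAt E (1 : G) (c.symm p.1) - chartAt E (1 : G) 1))
      {p | p.1 ∈ c.target ∧ p.2 ∈ d.target ∧ τ (d.symm p.2) ≠ 0 ∧
        c.symm p.1 ∈ (chartAt E (1 : G)).source ∧ d.symm p.2 ∈ d'.source} :=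
    (((contMDiffOn_param hd).mono fun p hp => hp.2.1).inv₀ fun p hp => hp.2.2.1).smul
      (((contMDiffOn_change_fst hc (chart_mem_atlas E (1 : G))).mono
        fun p hp => ⟨hp.1, hp.2.2.2.1⟩).sub contMDiffOn_const)
  refine (h1.prodMk
    ((contMDiffOn_change hd hd').mono fun p hp => ⟨hp.2.1, hp.2.2.2.2⟩)).congr ?_
  rintro ⟨v, h⟩ ⟨_, _, hτ, _, _⟩
  exact congrArg (lieChart (τ := τ) d') (mk_of_ne _ _ hτ)

lemma contMDiffOn_lie_grp (hc : c ∈ atlas E G) (hd : d ∈ atlas H S)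
    (hd' : d' ∈ atlas H S) : ContMDiffOn (M := E × H) (M' := E × H) (𝓘(ℝ, E).prod I)
      (𝓘(ℝ, E).prod I) ∞ ((lieChart (G := G) (τ := τ) d).symm.trans (grpChart c d'))
      ((lieChart (G := G) (τ := τ) d).symm.trans (grpChart c d')).source := by
  rw [lie_grp_source]
  have h1 : ContMDiffOn (𝓘(ℝ, E).prod I) 𝓘(ℝ, E) ∞ (fun p : E × H => c ((chartAt E (1 : G)).symm
      (chartAt E (1 : G) 1 + τ (d.symm p.2) • p.1)))
      {p | (p.2 ∈ d.target ∧ chartAt E (1 : G) 1 + τ (d.symm p.2) • p.1 ∈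
          (chartAt E (1 : G)).target) ∧ τ (d.symm p.2) ≠ 0 ∧
        (chartAt E (1 : G)).symm (chartAt E (1 : G) 1 + τ (d.symm p.2) • p.1) ∈ c.source ∧
        d.symm p.2 ∈ d'.source} :=
    (contMDiffOn_of_mem_maximalAtlas (IsManifold.subset_maximalAtlas hc)).comp
      ((contMDiffOn_symm_of_mem_maximalAtlas
        (IsManifold.subset_maximalAtlas (chart_mem_atlas E (1 : G)))).comp
        ((contMDiffOn_affine hd).mono fun p hp => hp.1.1) fun p hp => hp.1.2)
      fun p hp => hp.2.2.1
  refine (h1.prodMk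
    ((contMDiffOn_change hd hd').mono fun p hp => ⟨hp.1.1, hp.2.2.2⟩)).congr ?_
  rintro ⟨v, h⟩ ⟨_, hτ, _, _⟩
  exact congrArg (grpChart (τ := τ) c d') (mk_of_ne _ _ hτ)

lemma contMDiffOn_lie_lie (hd : d ∈ atlas H S)
    (hd' : d' ∈ atlas H S) : ContMDiffOn (M := E × H) (M' := E × H) (𝓘(ℝ, E).prod I)
      (𝓘(ℝ, E).prod I) ∞ ((lieChart (E := E) (G := G) (τ := τ) d).symm.trans (lieChart d'))
      ((lieChart (E := E) (G := G) (τ := τ) d).symm.trans (lieChart d')).source := by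
  rw [lie_lie_source]
  refine ((contMDiffOn_fst).prodMk
    ((contMDiffOn_change hd hd').mono fun p hp => ⟨hp.1.1, hp.2⟩)).congr ?_
  rintro ⟨v, h⟩ ⟨⟨hh, hv⟩, hd⟩
  by_cases hτ : τ (d.symm h) = 0
  · exact congrArg (lieChart (E := E) (G := G) (τ := τ) d') (mk_of_eq _ _ hτ)
  · refine (congrArg (lieChart (E := E) (G := G) (τ := τ) d') (mk_of_ne _ _ hτ)).trans ?_
    refine Prod.ext ?_ rfl
    change (τ (d.symm h))⁻¹ • (chartAt E (1 : G) ((chartAt E (1 : G)).symm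
      (chartAt E (1 : G) 1 + τ (d.symm h) • v)) - chartAt E (1 : G) 1) = v
    rw [(chartAt E (1 : G)).right_inv hv, add_sub_cancel_left, smul_smul, inv_mul_cancel₀ hτ,
      one_smul]

end Transitions

instance isManifold : IsManifold (𝓘(ℝ, E).prod I) ∞ (DefSpace E H G τ) := by
  refine isManifold_of_contDiffOn _ _ _ fun e e' he he' => ?_
  obtain ⟨_, ⟨e₀, rfl⟩, _, ⟨h₀, rfl⟩, rfl⟩ := he
  obtain ⟨_, ⟨e₁, rfl⟩, _, ⟨h₁, rfl⟩, rfl⟩ := he'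
  rcases h₀ with ⟨c, hc, d, hd, rfl⟩ | ⟨d, hd, rfl⟩ <;>
    rcases h₁ with ⟨c', hc', d', hd', rfl⟩ | ⟨d', hd', rfl⟩
  · exact contDiffOn_of_contMDiffOn_prod (contMDiffOn_grp_grp hc hc' hd hd')
  · exact contDiffOn_of_contMDiffOn_prod (contMDiffOn_grp_lie hc hd hd')
  · exact contDiffOn_of_contMDiffOn_prod (contMDiffOn_lie_grp hc' hd hd')
  · exact contDiffOn_of_contMDiffOn_prod (contMDiffOn_lie_lie hd hd')

end DefSpace

/-! ### Coordinates on the deformation space -/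

namespace DefSpace

section Coordinates

variable {E H G : Type*} [NormedAddCommGroup E] [NormedSpace ℝ E]
  [TopologicalSpace G] [ChartedSpace E G] [Group G] {S : Type*} [TopologicalSpace S]
  {τ : C(S, ℝ)}

/-- The `G`-component of the blow-down map `D(G, {1}) → G × S`, which contracts `𝔤 × {τ = 0}` to
`{1} × {τ = 0}`. -/
def blowDown : DefSpace E H G τ → G
  | grp g _ _ => g
  | lie _ _ _ => 1

/-- The rescaled coordinate near `𝔤 × {τ = 0}`: the difference quotient `(c(g) - c(1)) / τ(t)` for
the preferred chart `c` of `G` at `1`, extended by the identity of `𝔤`. -/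
noncomputable def scaled : DefSpace E H G τ → E
  | grp g t _ => (τ t)⁻¹ • (chartAt E (1 : G) g - chartAt E (1 : G) 1)
  | lie x _ _ => x

variable (E G) in
/-- The local parametrisation `κ` of `G` near `1`, the inverse of the preferred chart shifted so
that `κ(0) = 1`. -/
noncomputable def kappa (x : E) : G := (chartAt E (1 : G)).symm (chartAt E (1 : G) 1 + x)

lemma kappa_zero : kappa E G 0 = 1 := by
  rw [kappa, add_zero, (chartAt E (1 : G)).left_inv (mem_chart_source E (1 : G))]

@[simp] lemma proj_mk (g : G) (x : E) (t : S) : (mk g x t : DefSpace E H G τ).proj = t := by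
  unfold mk
  split_ifs <;> rfl

lemma blowDown_mk_of_ne (g : G) (x : E) {t : S} (ht : τ t ≠ 0) :
    (mk g x t : DefSpace E H G τ).blowDown = g := by
  rw [mk_of_ne _ _ ht]
  rfl

lemma blowDown_mk {g : G} (x : E) {t : S} (h : τ t = 0 → g = 1) :
    (mk g x t : DefSpace E H G τ).blowDown = g := by
  by_cases ht : τ t = 0
  · rw [mk_of_eq _ _ ht, h ht]
    rfl
  · exact blowDown_mk_of_ne _ _ ht

lemma scaled_mk (g : G) (x : E) (t : S) :
    (mk g x t : DefSpace E H G τ).scaled =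
      if τ t = 0 then x else (τ t)⁻¹ • (chartAt E (1 : G) g - chartAt E (1 : G) 1) := by
  unfold mk
  split_ifs <;> rfl

lemma mk_blowDown (q : DefSpace E H G τ) (hq : τ q.proj ≠ 0) (x : E) :
    mk q.blowDown x q.proj = q := by
  rcases q with ⟨g, t, ht⟩ | ⟨y, t, ht⟩
  · exact mk_of_ne _ _ ht
  · exact (hq ht).elim

lemma mk_scaled (q : DefSpace E H G τ) (hq : q.blowDown ∈ (chartAt E (1 : G)).source) :
    mk (kappa E G (τ q.proj • q.scaled)) q.scaled q.proj = q := by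
  rcases q with ⟨g, t, ht⟩ | ⟨y, t, ht⟩
  · refine (mk_of_ne _ _ ht).trans ?_
    have : kappa E G (τ t • ((τ t)⁻¹ • (chartAt E (1 : G) g - chartAt E (1 : G) 1))) = g := by
      rw [kappa, smul_smul, mul_inv_cancel₀ ht, one_smul, add_sub_cancel]
      exact (chartAt E (1 : G)).left_inv hq
    exact congrArg (fun g => grp g t ht) this
  · exact mk_of_eq _ _ ht

end Coordinates

variable {E : Type*} [NormedAddCommGroup E] [NormedSpace ℝ E]
  {G : Type*} [TopologicalSpace G] [ChartedSpace E G] [Group G] [LieGroup 𝓘(ℝ, E) ∞ G]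
  {ES H : Type*} [NormedAddCommGroup ES] [NormedSpace ℝ ES] [TopologicalSpace H]
  {I : ModelWithCorners ℝ ES H} {S : Type*} [TopologicalSpace S] [ChartedSpace H S]
  [IsManifold I ∞ S] {τ : C(S, ℝ)} [hτ : Fact (ContMDiff I 𝓘(ℝ, ℝ) ∞ τ)]

section Charts

variable {c : OpenPartialHomeomorph G E} {d : OpenPartialHomeomorph S H}

variable (τ) in
/-- The chart `grpChart`, as a homeomorphism between open sets. -/
noncomputable def grpHomeo (hc : c ∈ atlas E G) (hd : d ∈ atlas H S) :
    OpenPartialHomeomorph (DefSpace E H G τ) (ModelProd E H) :=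
  (core E H G τ).openPartialHomeomorph (grpChart c d) (Or.inl ⟨c, hc, d, hd, rfl⟩)

variable (E G τ) in
/-- The chart `lieChart`, as a homeomorphism between open sets. -/
noncomputable def lieHomeo (hd : d ∈ atlas H S) :
    OpenPartialHomeomorph (DefSpace E H G τ) (ModelProd E H) :=
  (core E H G τ).openPartialHomeomorph (lieChart d) (Or.inr ⟨d, hd, rfl⟩)

lemma grpHomeo_mem_atlas (hc : c ∈ atlas E G) (hd : d ∈ atlas H S) :
    grpHomeo τ hc hd ∈ atlas (ModelProd E H) (DefSpace E H G τ) :=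
  Set.mem_iUnion₂.2 ⟨_, Or.inl ⟨c, hc, d, hd, rfl⟩, rfl⟩

lemma lieHomeo_mem_atlas (hd : d ∈ atlas H S) :
    lieHomeo E G τ hd ∈ atlas (ModelProd E H) (DefSpace E H G τ) :=
  Set.mem_iUnion₂.2 ⟨_, Or.inr ⟨d, hd, rfl⟩, rfl⟩

lemma mem_lieHomeo_source (hd : d ∈ atlas H S) (q : DefSpace E H G τ) :
    q ∈ (lieHomeo E G τ hd).source ↔
      q.proj ∈ d.source ∧ q.blowDown ∈ (chartAt E (1 : G)).source := by
  rcases q with ⟨g, t, ht⟩ | ⟨y, t, ht⟩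
  · exact ⟨fun h => ⟨h.1, h.2 _ _ _ rfl⟩, fun h => ⟨h.1, fun _ _ _ hq => by cases hq; exact h.2⟩⟩
  · exact ⟨fun h => ⟨h.1, mem_chart_source E (1 : G)⟩, fun h => ⟨h.1, fun _ _ _ hq => by cases hq⟩⟩

lemma mem_grpHomeo_source (hc : c ∈ atlas E G) (hd : d ∈ atlas H S) (q : DefSpace E H G τ) :
    q ∈ (grpHomeo τ hc hd).source ↔
      τ q.proj ≠ 0 ∧ q.proj ∈ d.source ∧ q.blowDown ∈ c.source := by
  rcases q with ⟨g, t, ht⟩ | ⟨y, t, ht⟩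
  · exact ⟨fun ⟨_, _, _, hq, h1, h2⟩ => by cases hq; exact ⟨ht, h2, h1⟩,
      fun h => ⟨_, _, ht, rfl, h.2.2, h.2.1⟩⟩
  · exact ⟨fun ⟨_, _, _, hq, _⟩ => (by cases hq), fun h => (h.1 ht).elim⟩

lemma grpHomeo_apply (hc : c ∈ atlas E G) (hd : d ∈ atlas H S) {q : DefSpace E H G τ}
    (hq : τ q.proj ≠ 0) : grpHomeo τ hc hd q = (c q.blowDown, d q.proj) := by
  rcases q with ⟨g, t, ht⟩ | ⟨y, t, ht⟩
  · rfl
  · exact (hq ht).elim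

lemma lieHomeo_apply (hd : d ∈ atlas H S) (q : DefSpace E H G τ) :
    lieHomeo E G τ hd q = (q.scaled, d q.proj) := by
  rcases q with ⟨g, t, ht⟩ | ⟨y, t, ht⟩ <;> rfl

variable (I)

lemma contMDiffOn_grpHomeo (hc : c ∈ atlas E G) (hd : d ∈ atlas H S) :
    ContMDiffOn (M' := E × H) (𝓘(ℝ, E).prod I) (𝓘(ℝ, E).prod I) ∞ (grpHomeo τ hc hd)
      (grpHomeo τ hc hd).source :=
  haveI := isManifold (E := E) (G := G) (I := I) (τ := τ)
  (contMDiffOn_of_mem_maximalAtlas (IsManifold.subset_maximalAtlas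
    (grpHomeo_mem_atlas hc hd))).of_modelProd

lemma contMDiffOn_grpHomeo_symm (hc : c ∈ atlas E G) (hd : d ∈ atlas H S) :
    ContMDiffOn (M := E × H) (𝓘(ℝ, E).prod I) (𝓘(ℝ, E).prod I) ∞ (grpHomeo τ hc hd).symm
      (grpHomeo τ hc hd).target :=
  haveI := isManifold (E := E) (G := G) (I := I) (τ := τ)
  (contMDiffOn_symm_of_mem_maximalAtlas (IsManifold.subset_maximalAtlas
    (grpHomeo_mem_atlas hc hd))).from_modelProd

lemma contMDiffOn_lieHomeo (hd : d ∈ atlas H S) :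
    ContMDiffOn (M' := E × H) (𝓘(ℝ, E).prod I) (𝓘(ℝ, E).prod I) ∞ (lieHomeo E G τ hd)
      (lieHomeo E G τ hd).source :=
  haveI := isManifold (E := E) (G := G) (I := I) (τ := τ)
  (contMDiffOn_of_mem_maximalAtlas (IsManifold.subset_maximalAtlas
    (lieHomeo_mem_atlas hd))).of_modelProd

lemma contMDiffOn_lieHomeo_symm (hd : d ∈ atlas H S) :
    ContMDiffOn (M := E × H) (𝓘(ℝ, E).prod I) (𝓘(ℝ, E).prod I) ∞ (lieHomeo E G τ hd).symm
      (lieHomeo E G τ hd).target :=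
  haveI := isManifold (E := E) (G := G) (I := I) (τ := τ)
  (contMDiffOn_symm_of_mem_maximalAtlas (IsManifold.subset_maximalAtlas
    (lieHomeo_mem_atlas hd))).from_modelProd

variable {I}

lemma mem_lieHomeo_source_or_mem_grpHomeo_source (q : DefSpace E H G τ) :
    q ∈ (lieHomeo E G τ (chart_mem_atlas H q.proj)).source ∨
      q ∈ (grpHomeo τ (chart_mem_atlas E q.blowDown) (chart_mem_atlas H q.proj)).source := by
  rcases q with ⟨g, t, ht⟩ | ⟨y, t, ht⟩
  · exact Or.inr ((mem_grpHomeo_source _ _ _).2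
      ⟨ht, mem_chart_source H t, mem_chart_source E g⟩)
  · exact Or.inl ((mem_lieHomeo_source _ _).2
      ⟨mem_chart_source H t, mem_chart_source E (1 : G)⟩)

end Charts

lemma contMDiff_proj : ContMDiff (𝓘(ℝ, E).prod I) I ∞ (proj : DefSpace E H G τ → S) := by
  intro q
  have hd := chart_mem_atlas H q.proj
  have hd' := contMDiffOn_symm_of_mem_maximalAtlas (I := I) (n := ∞)
    (IsManifold.subset_maximalAtlas hd)
  rcases mem_lieHomeo_source_or_mem_grpHomeo_source q with hq | hq
  · refine ((hd'.comp (contMDiff_snd.comp_contMDiffOn (contMDiffOn_lieHomeo I hd))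
      fun p hp => ?_).congr fun p hp => ?_).contMDiffAt (
      (lieHomeo E G τ hd).open_source.mem_nhds hq)
    · rw [mem_lieHomeo_source] at hp
      simpa only [Set.mem_preimage, Function.comp, lieHomeo_apply]
        using (chartAt H q.proj).map_source hp.1
    · rw [mem_lieHomeo_source] at hp
      simpa only [Function.comp, lieHomeo_apply] using ((chartAt H q.proj).left_inv hp.1).symm
  · have hc := chart_mem_atlas E q.blowDown
    refine ((hd'.comp (contMDiff_snd.comp_contMDiffOn (contMDiffOn_grpHomeo I hc hd))
      fun p hp => ?_).congr fun p hp => ?_).contMDiffAt (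
      (grpHomeo τ hc hd).open_source.mem_nhds hq)
    · rw [mem_grpHomeo_source] at hp
      simpa only [Set.mem_preimage, Function.comp, grpHomeo_apply hc hd hp.1]
        using (chartAt H q.proj).map_source hp.2.1
    · rw [mem_grpHomeo_source] at hp
      simpa only [Function.comp, grpHomeo_apply hc hd hp.1]
        using ((chartAt H q.proj).left_inv hp.2.1).symm

lemma contMDiffAt_scaled {q : DefSpace E H G τ} (hq : q.blowDown ∈ (chartAt E (1 : G)).source) :
    ContMDiffAt (𝓘(ℝ, E).prod I) 𝓘(ℝ, E) ∞ (scaled : DefSpace E H G τ → E) q := by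
  have hd := chart_mem_atlas H q.proj
  refine ((contMDiff_fst.comp_contMDiffOn (contMDiffOn_lieHomeo I hd)).congr
    fun p hp => ?_).contMDiffAt (
    (lieHomeo E G τ hd).open_source.mem_nhds
      ((mem_lieHomeo_source _ _).2 ⟨mem_chart_source H _, hq⟩))
  simp only [Function.comp, lieHomeo_apply]

lemma contMDiffAt_kappa {x : E} (hx : chartAt E (1 : G) 1 + x ∈ (chartAt E (1 : G)).target) :
    ContMDiffAt 𝓘(ℝ, E) 𝓘(ℝ, E) ∞ (kappa E G) x := by
  have h1 : ContMDiffAt 𝓘(ℝ, E) 𝓘(ℝ, E) ∞ (chartAt E (1 : G)).symm (chartAt E (1 : G) 1 + x) :=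
    (contMDiffOn_symm_of_mem_maximalAtlas (IsManifold.subset_maximalAtlas
      (chart_mem_atlas E (1 : G)))).contMDiffAt ((chartAt E (1 : G)).open_target.mem_nhds hx)
  exact ContMDiffAt.comp x h1 (contMDiffAt_const.add contMDiffAt_id)

lemma contMDiff_blowDown :
    ContMDiff (𝓘(ℝ, E).prod I) 𝓘(ℝ, E) ∞ (blowDown : DefSpace E H G τ → G) := by
  intro q
  have hd := chart_mem_atlas H q.proj
  rcases mem_lieHomeo_source_or_mem_grpHomeo_source q with hq | hq
  · have hS := (lieHomeo E G τ hd).open_source.mem_nhds hq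
    rw [mem_lieHomeo_source] at hq
    have e1 : (blowDown : DefSpace E H G τ → G) =ᶠ[𝓝 q]
        fun p => kappa E G (τ p.proj • p.scaled) := by
      filter_upwards [hS] with p hp
      rw [mem_lieHomeo_source] at hp
      conv_lhs => rw [← mk_scaled p hp.2]
      refine blowDown_mk _ fun h => ?_
      rw [h, zero_smul, kappa_zero]
    refine ContMDiffAt.congr_of_eventuallyEq ?_ e1
    refine ContMDiffAt.comp q (g := kappa E G) (contMDiffAt_kappa ?_)
      (((hτ.out.comp contMDiff_proj) q).smul (contMDiffAt_scaled (I := I) hq.2))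
    have hq' := ((lieHomeo E G τ hd).map_source ((mem_lieHomeo_source _ _).2 hq))
    rw [lieHomeo_apply] at hq'
    have := hq'.2
    rw [(chartAt H q.proj).left_inv hq.1] at this
    exact this
  · have hc := chart_mem_atlas E q.blowDown
    refine (((contMDiffOn_symm_of_mem_maximalAtlas (I := 𝓘(ℝ, E)) (n := ∞)
      (IsManifold.subset_maximalAtlas hc)).comp (contMDiff_fst.comp_contMDiffOn
      (contMDiffOn_grpHomeo I hc hd)) fun p hp => ?_).congr
      fun p hp => ?_).contMDiffAt ((grpHomeo τ hc hd).open_source.mem_nhds hq)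
    · rw [mem_grpHomeo_source] at hp
      simpa only [Set.mem_preimage, Function.comp, grpHomeo_apply hc hd hp.1]
        using (chartAt E q.blowDown).map_source hp.2.2
    · rw [mem_grpHomeo_source] at hp
      simpa only [Function.comp, grpHomeo_apply hc hd hp.1]
        using ((chartAt E q.blowDown).left_inv hp.2.2).symm

variable (I) in
/-- The projection of the deformation space to the base is a submersion: in the charts it is the
projection `E × H → H`. -/
theorem isSubmersion_proj :
    Manifold.IsSubmersion (𝓘(ℝ, E).prod I) I ∞ (proj : DefSpace E H G τ → S) := by
  have := isManifold (E := E) (G := G) (I := I) (τ := τ)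
  refine Manifold.IsSubmersionOfComplement.isSubmersion (F := E) fun q => ?_
  have cont : ContinuousAt (proj : DefSpace E H G τ → S) q :=
    (contMDiff_proj (I := I) q).continuousAt
  have hd := chart_mem_atlas H q.proj
  rcases mem_lieHomeo_source_or_mem_grpHomeo_source q with hq | hq
  · refine Manifold.IsSubmersionAtOfComplement.mk_of_continuousAt cont
      (ContinuousLinearEquiv.prodComm ℝ E ES) (lieHomeo E G τ hd)
      (chartAt H q.proj) hq (mem_chart_source H q.proj)
      (IsManifold.subset_maximalAtlas (lieHomeo_mem_atlas _))
      (IsManifold.subset_maximalAtlas hd) fun z hz => ?_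
    have h1 := (((lieHomeo E G τ hd).extend (𝓘(ℝ, E).prod I)).map_target hz)
    have h2 := (((lieHomeo E G τ hd).extend (𝓘(ℝ, E).prod I)).right_inv hz)
    set p := ((lieHomeo E G τ hd).extend (𝓘(ℝ, E).prod I)).symm z
    have h3 : (p.scaled, I (chartAt H q.proj p.proj)) = z := by
      rw [← h2]
      exact congrArg (𝓘(ℝ, E).prod I) (lieHomeo_apply hd p).symm
    exact congrArg Prod.snd h3
  · have hc := chart_mem_atlas E q.blowDown
    refine Manifold.IsSubmersionAtOfComplement.mk_of_continuousAt cont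
      (ContinuousLinearEquiv.prodComm ℝ E ES) (grpHomeo τ hc hd)
      (chartAt H q.proj) hq (mem_chart_source H q.proj)
      (IsManifold.subset_maximalAtlas (grpHomeo_mem_atlas _ _))
      (IsManifold.subset_maximalAtlas hd) fun z hz => ?_
    have h1 := (((grpHomeo τ hc hd).extend (𝓘(ℝ, E).prod I)).map_target hz)
    have h2 := (((grpHomeo τ hc hd).extend (𝓘(ℝ, E).prod I)).right_inv hz)
    set p := ((grpHomeo τ hc hd).extend (𝓘(ℝ, E).prod I)).symm z
    rw [OpenPartialHomeomorph.extend_source, mem_grpHomeo_source] at h1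
    have h3 : (chartAt E q.blowDown p.blowDown, I (chartAt H q.proj p.proj)) = z := by
      rw [← h2]
      exact congrArg (𝓘(ℝ, E).prod I) (grpHomeo_apply hc hd h1.1).symm
    exact congrArg Prod.snd h3

/-- Over `τ ≠ 0` the deformation space is the product of `G` with the base. The value `0` of the
coordinate in `𝔤` is irrelevant there. -/
lemma contMDiffAt_mk_of_ne (g : G) {t : S} (ht : τ t ≠ 0) :
    ContMDiffAt (𝓘(ℝ, E).prod I) (𝓘(ℝ, E).prod I) ∞
      (fun p : G × S => (mk p.1 0 p.2 : DefSpace E H G τ)) (g, t) := by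
  have hc := chart_mem_atlas E g
  have hd := chart_mem_atlas H t
  have h0 : ∀ᶠ p : G × S in 𝓝 (g, t), τ p.2 ≠ 0 ∧ p.2 ∈ (chartAt H t).source ∧
      p.1 ∈ (chartAt E g).source :=
    (ContinuousAt.eventually_ne (g := fun p : G × S => τ p.2) (x := (g, t))
      (τ.continuous.comp continuous_snd).continuousAt ht).and
      ((continuousAt_snd (p := (g, t)) |>.eventually (chart_source_mem_nhds H t)).and
        (continuousAt_fst (p := (g, t)) |>.eventually (chart_source_mem_nhds E g)))
  have h1 : ∀ p : G × S, (τ p.2 ≠ 0 ∧ p.2 ∈ (chartAt H t).source ∧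
      p.1 ∈ (chartAt E g).source) → (mk p.1 0 p.2 : DefSpace E H G τ) ∈
        (grpHomeo τ hc hd).source ∧
      grpHomeo τ hc hd (mk p.1 0 p.2) = (chartAt E g p.1, chartAt H t p.2) := by
    intro p hp
    have h2 := mem_grpHomeo_source (τ := τ) hc hd (mk p.1 0 p.2)
    have h3 := grpHomeo_apply (τ := τ) hc hd (q := mk p.1 0 p.2)
    rw [proj_mk, blowDown_mk_of_ne _ _ hp.1] at h2 h3
    exact ⟨h2.2 hp, h3 hp.1⟩
  have e1 : (fun p : G × S => (mk p.1 0 p.2 : DefSpace E H G τ)) =ᶠ[𝓝 (g, t)]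
      fun p => (grpHomeo τ hc hd).symm (chartAt E g p.1, chartAt H t p.2) := by
    filter_upwards [h0] with p hp
    obtain ⟨h2, h3⟩ := h1 p hp
    rw [← h3]
    exact ((grpHomeo τ hc hd).left_inv h2).symm
  refine ContMDiffAt.congr_of_eventuallyEq ?_ e1
  have h2 := h1 (g, t) ⟨ht, mem_chart_source H t, mem_chart_source E g⟩
  have h4 := (grpHomeo τ hc hd).map_source h2.1
  rw [h2.2] at h4
  have hopen := (grpHomeo τ hc hd).open_target
  refine ContMDiffAt.comp (g, t) (g := (grpHomeo τ hc hd).symm) (M' := E × H)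
    (I' := 𝓘(ℝ, E).prod I) ((contMDiffOn_grpHomeo_symm I hc hd).contMDiffAt
      (hopen.mem_nhds h4)) ?_
  exact ((contMDiffAt_of_mem_maximalAtlas (IsManifold.subset_maximalAtlas hc)
    (mem_chart_source E g)).comp (g, t) contMDiffAt_fst).prodMk
    ((contMDiffAt_of_mem_maximalAtlas (IsManifold.subset_maximalAtlas hd)
    (mem_chart_source H t)).comp (g, t) contMDiffAt_snd)

/-- The parametrisation `(x, t) ↦ (κ(τ(t) x), t)`, `(x, t) ↦ (x, t)` for `τ(t) = 0`, is smooth. -/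
lemma contMDiffAt_mk_kappa (x : E) {t : S}
    (hx : chartAt E (1 : G) 1 + τ t • x ∈ (chartAt E (1 : G)).target) :
    ContMDiffAt (𝓘(ℝ, E).prod I) (𝓘(ℝ, E).prod I) ∞
      (fun p : E × S => (mk (kappa E G (τ p.2 • p.1)) p.1 p.2 : DefSpace E H G τ)) (x, t) := by
  have hd := chart_mem_atlas H t
  have h0 : ∀ᶠ p : E × S in 𝓝 (x, t), p.2 ∈ (chartAt H t).source :=
    continuousAt_snd (p := (x, t)) |>.eventually (chart_source_mem_nhds H t)
  have e1 : (fun p : E × S => (mk (kappa E G (τ p.2 • p.1)) p.1 p.2 : DefSpace E H G τ))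
      =ᶠ[𝓝 (x, t)] fun p => (lieHomeo E G τ hd).symm (p.1, chartAt H t p.2) := by
    filter_upwards [h0] with p hp
    change _ = mk _ p.1 ((chartAt H t).symm (chartAt H t p.2))
    rw [(chartAt H t).left_inv hp]
    rfl
  refine ContMDiffAt.congr_of_eventuallyEq ?_ e1
  have h4 : (x, chartAt H t t) ∈ (lieHomeo E G τ hd).target := by
    refine ⟨mem_chart_target H t, ?_⟩
    change _ + τ ((chartAt H t).symm (chartAt H t t)) • x ∈ _
    rwa [(chartAt H t).left_inv (mem_chart_source H t)]
  have hopen := (lieHomeo E G τ hd).open_target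
  refine ContMDiffAt.comp (x, t) (g := (lieHomeo E G τ hd).symm) (M' := E × H)
    (I' := 𝓘(ℝ, E).prod I) ((contMDiffOn_lieHomeo_symm I hd).contMDiffAt
      (hopen.mem_nhds h4)) ?_
  exact contMDiffAt_fst.prodMk
    ((contMDiffAt_of_mem_maximalAtlas (IsManifold.subset_maximalAtlas hd)
    (mem_chart_source H t)).comp (x, t) contMDiffAt_snd)

end DefSpace

/-! ### Smooth maps to and from the deformation space -/

namespace DefSpace

variable {E : Type*} [NormedAddCommGroup E] [NormedSpace ℝ E]
  {G : Type*} [TopologicalSpace G] [ChartedSpace E G] [Group G] [LieGroup 𝓘(ℝ, E) ∞ G]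
  {ES H : Type*} [NormedAddCommGroup ES] [NormedSpace ℝ ES] [TopologicalSpace H]
  {I : ModelWithCorners ℝ ES H} {S : Type*} [TopologicalSpace S] [ChartedSpace H S]
  [IsManifold I ∞ S] {τ : C(S, ℝ)} [hτ : Fact (ContMDiff I 𝓘(ℝ, ℝ) ∞ τ)]
  {EX HX : Type*} [NormedAddCommGroup EX] [NormedSpace ℝ EX] [TopologicalSpace HX]
  {J : ModelWithCorners ℝ EX HX} {X : Type*} [TopologicalSpace X] [ChartedSpace HX X]
  {EY HY : Type*} [NormedAddCommGroup EY] [NormedSpace ℝ EY] [TopologicalSpace HY]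
  {K : ModelWithCorners ℝ EY HY} {Y : Type*} [TopologicalSpace Y] [ChartedSpace HY Y]

lemma mk_eq (q : DefSpace E H G τ) (x : E) (hx : τ q.proj = 0 → x = q.scaled) :
    mk q.blowDown x q.proj = q := by
  rcases q with ⟨g, t, ht⟩ | ⟨y, t, ht⟩
  · exact mk_of_ne _ _ ht
  · exact (mk_of_eq _ _ ht).trans (congrArg (fun x => lie x t ht) (hx ht))

lemma blowDown_of_eq (q : DefSpace E H G τ) (hq : τ q.proj = 0) : q.blowDown = 1 := by
  rcases q with ⟨g, t, ht⟩ | ⟨y, t, ht⟩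
  · exact (ht hq).elim
  · rfl

lemma kappa_scaled {q : DefSpace E H G τ} (hq : q.blowDown ∈ (chartAt E (1 : G)).source) :
    chartAt E (1 : G) 1 + τ q.proj • q.scaled = chartAt E (1 : G) q.blowDown := by
  rcases q with ⟨g, t, ht⟩ | ⟨y, t, ht⟩
  · change _ + τ t • ((τ t)⁻¹ • (chartAt E (1 : G) g - chartAt E (1 : G) 1)) = _
    rw [smul_smul, mul_inv_cancel₀ ht, one_smul, add_sub_cancel]
    rfl
  · have h0 : ∀ a z : E, a + τ t • z = a := fun a z => by rw [ht, zero_smul, add_zero]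
    exact h0 _ y

/-- A map into the deformation space is smooth if its components in `G` and in the base are, and,
over `τ = 0`, also the rescaled coordinate. -/
lemma contMDiffAt_of_components {f : X → DefSpace E H G τ} {x : X}
    (h1 : ContMDiffAt J 𝓘(ℝ, E) ∞ (fun y => (f y).blowDown) x)
    (h2 : ContMDiffAt J I ∞ (fun y => (f y).proj) x)
    (h3 : τ (f x).proj = 0 → ContMDiffAt J 𝓘(ℝ, E) ∞ (fun y => (f y).scaled) x) :
    ContMDiffAt J (𝓘(ℝ, E).prod I) ∞ f x := by
  by_cases ht : τ (f x).proj = 0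
  · have h0 : (f x).blowDown ∈ (chartAt E (1 : G)).source := by
      rw [blowDown_of_eq _ ht]
      exact mem_chart_source E (1 : G)
    have e1 : f =ᶠ[𝓝 x] fun y =>
        mk (kappa E G (τ (f y).proj • (f y).scaled)) (f y).scaled (f y).proj := by
      filter_upwards [h1.continuousAt.eventually
        ((chartAt E (1 : G)).open_source.mem_nhds h0)] with y hy
      exact (mk_scaled (f y) hy).symm
    refine ContMDiffAt.congr_of_eventuallyEq ?_ e1
    exact ContMDiffAt.comp x (f := fun y => ((f y).scaled, (f y).proj))
      (contMDiffAt_mk_kappa (I := I) (f x).scaled (t := (f x).proj)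
        (by rw [kappa_scaled h0]; exact (chartAt E (1 : G)).map_source h0)) ((h3 ht).prodMk h2)
  · have e1 : f =ᶠ[𝓝 x] fun y => mk (f y).blowDown 0 (f y).proj := by
      filter_upwards [(τ.continuous.continuousAt.comp h2.continuousAt).eventually_ne ht] with y hy
      exact (mk_blowDown (f y) hy 0).symm
    refine ContMDiffAt.congr_of_eventuallyEq ?_ e1
    exact ContMDiffAt.comp x (f := fun y => ((f y).blowDown, (f y).proj))
      (contMDiffAt_mk_of_ne (I := I) (f x).blowDown ht) (h1.prodMk h2)

/-- A map out of the deformation space, depending on parameters, is smooth near `τ = 0` if it is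
smooth in the rescaled coordinate. -/
lemma contMDiffAt_of_comp_kappa {f : Y × DefSpace E H G τ → X} {y : Y} {q : DefSpace E H G τ}
    (hq : τ q.proj = 0)
    (h : ContMDiffAt (K.prod (𝓘(ℝ, E).prod I)) J ∞ (fun p : Y × (E × S) =>
      f (p.1, mk (kappa E G (τ p.2.2 • p.2.1)) p.2.1 p.2.2)) (y, (q.scaled, q.proj))) :
    ContMDiffAt (K.prod (𝓘(ℝ, E).prod I)) J ∞ f (y, q) := by
  have h0 : q.blowDown ∈ (chartAt E (1 : G)).source := by
    rw [blowDown_of_eq _ hq]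
    exact mem_chart_source E (1 : G)
  have h1 := (contMDiff_blowDown (E := E) (G := G) (I := I) (τ := τ)) q
  have e1 : f =ᶠ[𝓝 (y, q)] fun p =>
      f (p.1, mk (kappa E G (τ p.2.proj • p.2.scaled)) p.2.scaled p.2.proj) := by
    have := (h1.continuousAt.eventually ((chartAt E (1 : G)).open_source.mem_nhds h0))
    filter_upwards [(continuousAt_snd (p := (y, q))).eventually this] with p hp
    rw [mk_scaled p.2 hp]
  refine ContMDiffAt.congr_of_eventuallyEq ?_ e1
  exact ContMDiffAt.comp (y, q) (f := fun p : Y × DefSpace E H G τ =>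
    (p.1, (p.2.scaled, p.2.proj))) h (contMDiffAt_fst.prodMk
    (((contMDiffAt_scaled (I := I) h0).comp (y, q) contMDiffAt_snd).prodMk
      ((contMDiff_proj (I := I) q).comp (y, q) contMDiffAt_snd)))

/-- Points which the blow-down map to `G × S` does not separate lie over `τ = 0`, and there the
rescaled coordinate is continuous and separates them. -/
lemma t2Space [T2Space G] [T2Space S] (hI : ContMDiff I 𝓘(ℝ, ℝ) ∞ τ) :
    T2Space (DefSpace E H G τ) := by
  have : Fact (ContMDiff I 𝓘(ℝ, ℝ) ∞ τ) := ⟨hI⟩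
  refine t2Space_iff_disjoint_nhds.2 fun p q hpq => ?_
  have hc : Continuous fun q : DefSpace E H G τ => (q.blowDown, q.proj) :=
    (contMDiff_blowDown (I := I)).continuous.prodMk (contMDiff_proj (I := I)).continuous
  by_cases h : (p.blowDown, p.proj) = (q.blowDown, q.proj)
  · obtain ⟨h1, h2⟩ := Prod.mk.inj h
    have ht : τ p.proj = 0 := by
      by_contra ht
      refine hpq ?_
      rw [← mk_blowDown p ht 0, ← mk_blowDown q (h2 ▸ ht) 0, h1, h2]
    have hsc : p.scaled ≠ q.scaled := fun h3 => hpq <| by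
      rw [← mk_eq p p.scaled fun _ => rfl, ← mk_eq q q.scaled fun _ => rfl, h1, h2, h3]
    have hs : ∀ r : DefSpace E H G τ, τ r.proj = 0 → ContinuousAt scaled r := fun r hr =>
      (contMDiffAt_scaled (I := I) (by
        rw [blowDown_of_eq r hr]; exact mem_chart_source E (1 : G))).continuousAt
    exact Filter.Tendsto.disjoint (hs p ht) (disjoint_nhds_nhds.2 hsc) (hs q (h2 ▸ ht))
  · exact Filter.Tendsto.disjoint hc.continuousAt (disjoint_nhds_nhds.2 h) hc.continuousAt

lemma secondCountable [FiniteDimensional ℝ E] [SecondCountableTopology G]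
    [SecondCountableTopology S] [SecondCountableTopology H] :
    SecondCountableTopology (DefSpace E H G τ) := by
  have : SecondCountableTopology E := inferInstance
  obtain ⟨s, hs, hs'⟩ := TopologicalSpace.countable_cover_nhds (chart_source_mem_nhds H (M := S))
  obtain ⟨r, hr, hr'⟩ := TopologicalSpace.countable_cover_nhds (chart_source_mem_nhds E (M := G))
  have : Countable s := hs
  have : Countable r := hr
  have : SecondCountableTopology (ModelProd E H) :=
    inferInstanceAs (SecondCountableTopology (E × H))
  let U : s ⊕ (r × s) → Set (DefSpace E H G τ) :=
    Sum.elim (fun t => (lieHomeo E G τ (chart_mem_atlas H (t : S))).source)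
      fun p => (grpHomeo τ (chart_mem_atlas E (p.1 : G)) (chart_mem_atlas H (p.2 : S))).source
  have : ∀ i, SecondCountableTopology (U i) := by
    rintro (i | i)
    · exact (lieHomeo E G τ (chart_mem_atlas H (i : S))).secondCountableTopology_source
    · exact (grpHomeo τ (chart_mem_atlas E (i.1 : G))
        (chart_mem_atlas H (i.2 : S))).secondCountableTopology_source
  refine TopologicalSpace.secondCountableTopology_of_countable_cover (U := U) ?_ ?_
  · rintro (i | i)
    · exact (lieHomeo E G τ (chart_mem_atlas H (i : S))).open_source
    · exact (grpHomeo τ (chart_mem_atlas E (i.1 : G)) (chart_mem_atlas H (i.2 : S))).open_source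
  · refine Set.eq_univ_of_forall fun q => Set.mem_iUnion.2 ?_
    have h1 : q.proj ∈ ⋃ x ∈ s, (chartAt H x).source := hs' ▸ Set.mem_univ _
    have h2 : q.blowDown ∈ ⋃ x ∈ r, (chartAt E x).source := hr' ▸ Set.mem_univ _
    obtain ⟨t, ht, htq⟩ := Set.mem_iUnion₂.1 h1
    obtain ⟨g, hg, hgq⟩ := Set.mem_iUnion₂.1 h2
    by_cases h0 : τ q.proj = 0
    · refine ⟨Sum.inl ⟨t, ht⟩, (mem_lieHomeo_source _ _).2 ⟨htq, ?_⟩⟩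
      rw [blowDown_of_eq q h0]
      exact mem_chart_source E (1 : G)
    · exact ⟨Sum.inr (⟨g, hg⟩, ⟨t, ht⟩), (mem_grpHomeo_source _ _ _).2 ⟨h0, htq, hgq⟩⟩

end DefSpace

/-! ### Smooth extension across `τ = 0` -/

universe u

section ChartAtOne

variable {E : Type*} [NormedAddCommGroup E] [NormedSpace ℝ E] [CompleteSpace E]
  {G : Type*} [TopologicalSpace G] [ChartedSpace E G] [Group G] [LieGroup 𝓘(ℝ, E) ∞ G]

variable (E G) in
/-- The preferred chart at `1` induces the identity on `T₁G`, by definition of the tangent space. -/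
lemma hasMFDerivAt_chart_one :
    HasMFDerivAt 𝓘(ℝ, E) 𝓘(ℝ, E) (chartAt E (1 : G)) (1 : G) (ContinuousLinearMap.id ℝ E) := by
  have hd : MDifferentiableAt 𝓘(ℝ, E) 𝓘(ℝ, E) (extChartAt 𝓘(ℝ, E) (1 : G)) (1 : G) :=
    mdifferentiableAt_extChartAt (mem_chart_source E (1 : G))
  have h := hd.hasMFDerivAt
  have e : mfderiv 𝓘(ℝ, E) 𝓘(ℝ, E) (extChartAt 𝓘(ℝ, E) (1 : G)) (1 : G) =
    ContinuousLinearMap.id ℝ E := mfderiv_extChartAt_one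
  rw [e] at h
  exact h

variable (G) in
lemma hasMFDerivAt_kappa_zero :
    HasMFDerivAt 𝓘(ℝ, E) 𝓘(ℝ, E) (DefSpace.kappa E G) 0 (ContinuousLinearMap.id ℝ E) := by
  have hk : MDifferentiableAt 𝓘(ℝ, E) 𝓘(ℝ, E) (DefSpace.kappa E G) 0 :=
    (DefSpace.contMDiffAt_kappa (x := (0 : E)) (by
      rw [add_zero]; exact mem_chart_target E (1 : G))).mdifferentiableAt (by simp)
  have h1 := hk.hasMFDerivAt
  have hc : HasMFDerivAt 𝓘(ℝ, E) 𝓘(ℝ, E) (chartAt E (1 : G)) (DefSpace.kappa E G 0)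
      (ContinuousLinearMap.id ℝ E) := by
    rw [DefSpace.kappa_zero]
    exact hasMFDerivAt_chart_one E G
  have h2 := hc.comp 0 h1
  have e1 : (chartAt E (1 : G)) ∘ DefSpace.kappa E G =ᶠ[𝓝 0]
      fun x => chartAt E (1 : G) 1 + x := by
    have : ∀ᶠ x : E in 𝓝 0, chartAt E (1 : G) 1 + x ∈ (chartAt E (1 : G)).target := by
      refine (continuous_const.add continuous_id).continuousAt.eventually
        ((chartAt E (1 : G)).open_target.mem_nhds ?_)
      simp
    filter_upwards [this] with x hx
    exact (chartAt E (1 : G)).right_inv hx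
  have h3 : HasMFDerivAt 𝓘(ℝ, E) 𝓘(ℝ, E) ((chartAt E (1 : G)) ∘ DefSpace.kappa E G) 0
      (ContinuousLinearMap.id ℝ E) :=
    (HasFDerivAt.hasMFDerivAt ((hasFDerivAt_id (𝕜 := ℝ) (0 : E)).const_add
      (chartAt E (1 : G) 1))).congr_of_eventuallyEq e1
  have h4 := hasMFDerivAt_unique h2 h3
  have h5 : mfderiv 𝓘(ℝ, E) 𝓘(ℝ, E) (DefSpace.kappa E G) 0 = ContinuousLinearMap.id ℝ E := h4
  rw [h5] at h1
  exact h1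

/-- The velocity at `0` of a curve through `1`, read in the preferred chart at `1`. -/
lemma hasDerivAt_chart_one {V : Type*} [NormedAddCommGroup V] [NormedSpace ℝ V] {γ : V → G}
    {L : V →L[ℝ] E} (h0 : γ 0 = 1) (h : HasMFDerivAt 𝓘(ℝ, V) 𝓘(ℝ, E) γ 0 L) (x : V) :
    HasDerivAt (fun r : ℝ => chartAt E (1 : G) (γ (r • x))) (L x) 0 := by
  have hc : HasMFDerivAt 𝓘(ℝ, E) 𝓘(ℝ, E) (chartAt E (1 : G)) (γ 0)
      (ContinuousLinearMap.id ℝ E) := by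
    rw [h0]
    exact hasMFDerivAt_chart_one E G
  have h1 : HasFDerivAt ((chartAt E (1 : G)) ∘ γ) L 0 := (hc.comp 0 h).hasFDerivAt
  have h2 : HasDerivAt (fun r : ℝ => r • x) x 0 := by
    simpa using (hasDerivAt_id (0 : ℝ)).smul_const x
  have h3 : HasFDerivAt ((chartAt E (1 : G)) ∘ γ) L ((0 : ℝ) • x) := by rwa [zero_smul]
  exact h3.comp_hasDerivAt 0 h2

lemma contMDiffAt_kappa_zero : ContMDiffAt 𝓘(ℝ, E) 𝓘(ℝ, E) ∞ (DefSpace.kappa E G) 0 :=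
  DefSpace.contMDiffAt_kappa (by rw [add_zero]; exact mem_chart_target E (1 : G))

lemma contMDiffAt_kappa_smul {EM HM : Type*} [NormedAddCommGroup EM] [NormedSpace ℝ EM]
    [TopologicalSpace HM] {I : ModelWithCorners ℝ EM HM} {M : Type*} [TopologicalSpace M]
    [ChartedSpace HM M] {a : M → ℝ} {v : M → E} {m : M} (ha : ContMDiffAt I 𝓘(ℝ, ℝ) ∞ a m)
    (hv : ContMDiffAt I 𝓘(ℝ, E) ∞ v m) (h0 : a m • v m = 0) :
    ContMDiffAt I 𝓘(ℝ, E) ∞ (fun x => DefSpace.kappa E G (a x • v x)) m :=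
  ContMDiffAt.comp_of_eq (g := DefSpace.kappa E G) contMDiffAt_kappa_zero (ha.smul hv) h0

lemma hasDerivAt_chart_kappa_mul_kappa (x y : E) :
    HasDerivAt (fun r : ℝ => chartAt E (1 : G)
      (DefSpace.kappa E G (r • x) * DefSpace.kappa E G (r • y))) (x + y) 0 := by
  have hk : ∀ z : E, HasMFDerivAt 𝓘(ℝ, ℝ) 𝓘(ℝ, E) (fun r : ℝ => DefSpace.kappa E G (r • z)) 0
      (ContinuousLinearMap.toSpanSingleton ℝ z) := fun z => by
    have h1 : HasMFDerivAt 𝓘(ℝ, E) 𝓘(ℝ, E) (DefSpace.kappa E G) ((0 : ℝ) • z)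
        (ContinuousLinearMap.id ℝ E) := by
      rw [zero_smul]
      exact hasMFDerivAt_kappa_zero G
    exact h1.comp (0 : ℝ) (ContinuousLinearMap.toSpanSingleton ℝ z).hasMFDerivAt
  have hs : ContMDiffAt (𝓘(ℝ, ℝ).prod 𝓘(ℝ, ℝ)) 𝓘(ℝ, E) ∞ (Function.uncurry fun a b : ℝ =>
      DefSpace.kappa E G (a • x) * DefSpace.kappa E G (b • y)) (0, 0) :=
    (contMDiffAt_kappa_smul contMDiffAt_fst contMDiffAt_const (zero_smul ℝ x)).mul
      (contMDiffAt_kappa_smul contMDiffAt_snd contMDiffAt_const (zero_smul ℝ y))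
  have h1 := mfderiv_diag (hs.mdifferentiableAt (by simp)) (1 : ℝ)
  have e1 : (fun r : ℝ => DefSpace.kappa E G (r • x) * DefSpace.kappa E G ((0 : ℝ) • y)) =
      fun r => DefSpace.kappa E G (r • x) := by
    ext r
    rw [zero_smul, DefSpace.kappa_zero, mul_one]
  have e2 : (fun r : ℝ => DefSpace.kappa E G ((0 : ℝ) • x) * DefSpace.kappa E G (r • y)) =
      fun r => DefSpace.kappa E G (r • y) := by
    ext r
    rw [zero_smul, DefSpace.kappa_zero, one_mul]
  have hd : MDifferentiableAt 𝓘(ℝ, ℝ) 𝓘(ℝ, E) (fun r : ℝ =>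
      DefSpace.kappa E G (r • x) * DefSpace.kappa E G (r • y)) 0 :=
    ((contMDiffAt_kappa_smul contMDiffAt_id contMDiffAt_const (zero_smul ℝ x)).mul
      (contMDiffAt_kappa_smul contMDiffAt_id contMDiffAt_const
        (zero_smul ℝ y))).mdifferentiableAt (by simp)
  have h2 := hasDerivAt_chart_one (by simp [DefSpace.kappa_zero]) hd.hasMFDerivAt (1 : ℝ)
  have h3 : ∀ z : E, (mfderiv 𝓘(ℝ, ℝ) 𝓘(ℝ, E) (fun r : ℝ => DefSpace.kappa E G (r • z)) 0
      (1 : ℝ) : E) = z := fun z => by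
    refine (congrArg (fun L : ℝ →L[ℝ] E => L 1) (hk z).mfderiv).trans ?_
    exact one_smul ℝ z
  have h4 : (mfderiv 𝓘(ℝ, ℝ) 𝓘(ℝ, E) (fun r : ℝ =>
      DefSpace.kappa E G (r • x) * DefSpace.kappa E G (r • y)) 0 (1 : ℝ) : E) = x + y := by
    refine h1.trans (congrArg₂ (fun a b : E => a + b) ?_ ?_)
    · exact (congrArg (fun u : ℝ → G => (mfderiv 𝓘(ℝ, ℝ) 𝓘(ℝ, E) u 0 (1 : ℝ) : E)) e1).trans
        (h3 x)
    · exact (congrArg (fun u : ℝ → G => (mfderiv 𝓘(ℝ, ℝ) 𝓘(ℝ, E) u 0 (1 : ℝ) : E)) e2).trans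
        (h3 y)
  simp only [smul_eq_mul, mul_one] at h2
  exact h4 ▸ h2

lemma hasDerivAt_chart_conj_kappa (g : G) (x : E) :
    HasDerivAt (fun r : ℝ => chartAt E (1 : G) (g * DefSpace.kappa E G (r • x) * g⁻¹))
      (adjE E g x) 0 := by
  have h1 : HasMFDerivAt 𝓘(ℝ, E) 𝓘(ℝ, E) (fun h : G => g * h * g⁻¹) (DefSpace.kappa E G 0)
      (adjE E g) := by
    rw [DefSpace.kappa_zero]
    exact (mdifferentiableAt_conj_one g).hasMFDerivAt
  exact hasDerivAt_chart_one (γ := fun v => g * DefSpace.kappa E G v * g⁻¹)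
    (by simp [DefSpace.kappa_zero]) (h1.comp (0 : E) (hasMFDerivAt_kappa_zero G)) x

end ChartAtOne

section Hadamard

variable {E : Type u} [NormedAddCommGroup E] [NormedSpace ℝ E] [CompleteSpace E]
  {G : Type*} [TopologicalSpace G] [ChartedSpace E G] [Group G] [LieGroup 𝓘(ℝ, E) ∞ G]
  {EP : Type u} {HP : Type*} [NormedAddCommGroup EP] [NormedSpace ℝ EP] [FiniteDimensional ℝ EP]
  [TopologicalSpace HP] {J : ModelWithCorners ℝ EP HP} [J.Boundaryless]
  {P : Type*} [TopologicalSpace P] [ChartedSpace HP P] [IsManifold J ∞ P]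

/-- A family of curves `r ↦ Ψ(p, r)` in `G` through `1` has rescalings `(c(Ψ(p, r)) - c(1)) / r`
that extend smoothly across `r = 0` by the velocities. -/
lemma contMDiffAt_difference_quotient {Ψ : P × ℝ → G} {W : P → E} {p₀ : P}
    (hΨ : ContMDiffAt (J.prod 𝓘(ℝ, ℝ)) 𝓘(ℝ, E) ∞ Ψ (p₀, 0)) (h1 : ∀ p, Ψ (p, 0) = 1)
    (hW : ∀ p, HasDerivAt (fun r => chartAt E (1 : G) (Ψ (p, r))) (W p) 0) :
    ContMDiffAt (J.prod 𝓘(ℝ, ℝ)) 𝓘(ℝ, E) ∞ (fun q : P × ℝ => if q.2 = 0 then W q.1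
      else q.2⁻¹ • (chartAt E (1 : G) (Ψ q) - chartAt E (1 : G) 1)) (p₀, 0) := by
  set φ := extChartAt J p₀
  let f : EP × ℝ → E := fun q => chartAt E (1 : G) (Ψ (φ.symm q.1, q.2)) - chartAt E (1 : G) 1
  have hφ : φ.symm (φ p₀) = p₀ := extChartAt_to_inv (I := J) p₀
  have hf : ContDiffAt ℝ ∞ f (φ p₀, 0) := by
    have h2 : ContMDiffAt 𝓘(ℝ, EP) J ∞ φ.symm (φ p₀) :=
      (contMDiffOn_extChartAt_symm p₀).contMDiffAt (extChartAt_target_mem_nhds p₀)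
    have h3 : ContMDiffAt (𝓘(ℝ, EP).prod 𝓘(ℝ, ℝ)) (J.prod 𝓘(ℝ, ℝ)) ∞
        (fun q : EP × ℝ => (φ.symm q.1, q.2)) (φ p₀, 0) :=
      (ContMDiffAt.comp (φ p₀, (0 : ℝ)) h2 contMDiffAt_fst).prodMk contMDiffAt_snd
    have h4 : ContMDiffAt 𝓘(ℝ, E) 𝓘(ℝ, E) ∞ (chartAt E (1 : G)) (Ψ (φ.symm (φ p₀), 0)) := by
      rw [h1]
      exact contMDiffAt_of_mem_maximalAtlas
        (IsManifold.subset_maximalAtlas (chart_mem_atlas E (1 : G))) (mem_chart_source E (1 : G))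
    have h5 : ContMDiffAt (J.prod 𝓘(ℝ, ℝ)) 𝓘(ℝ, E) ∞ Ψ (φ.symm (φ p₀), 0) := by rwa [hφ]
    have h6 := (h4.comp (φ p₀, 0) (f := fun q : EP × ℝ => Ψ (φ.symm q.1, q.2))
      (h5.comp (φ p₀, 0) (f := fun q : EP × ℝ => (φ.symm q.1, q.2)) h3))
    rw [← modelWithCornersSelf_prod, chartedSpaceSelf_prod] at h6
    exact h6.contDiffAt.sub contDiffAt_const
  have h0 : ∀ᶠ u in 𝓝 (φ p₀), f (u, 0) = 0 := Filter.Eventually.of_forall fun u => by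
    simp only [f, h1, sub_self]
  have key := hf.hadamard h0
  have hdf : ∀ᶠ u in 𝓝 (φ p₀), fderiv ℝ f (u, 0) (0, 1) = W (φ.symm u) := by
    have h2 : ∀ᶠ q in 𝓝 ((φ p₀, 0) : EP × ℝ), ContDiffAt ℝ 1 f q :=
      (hf.of_le (by simp)).eventually (by simp)
    have h3 : Filter.Tendsto (fun u : EP => ((u, 0) : EP × ℝ)) (𝓝 (φ p₀)) (𝓝 (φ p₀, 0)) :=
      (continuous_id.prodMk continuous_const).continuousAt
    filter_upwards [h3.eventually h2] with u hu
    have h4 : HasDerivAt (fun r : ℝ => ((u, r) : EP × ℝ)) (0, 1) 0 :=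
      (hasDerivAt_const (0 : ℝ) u).prodMk (hasDerivAt_id (0 : ℝ))
    have h5 := (hu.differentiableAt (by simp)).hasFDerivAt.comp_hasDerivAt (0 : ℝ) h4
    exact h5.unique ((hW (φ.symm u)).sub_const _)
  have h7 : ContMDiffAt (J.prod 𝓘(ℝ, ℝ)) 𝓘(ℝ, EP × ℝ) ∞
      (fun q : P × ℝ => ((φ q.1, q.2) : EP × ℝ)) (p₀, 0) := by
    rw [modelWithCornersSelf_prod, ← chartedSpaceSelf_prod]
    exact (ContMDiffAt.comp (p₀, (0 : ℝ)) (contMDiffAt_extChartAt (I := J) (x := p₀))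
      contMDiffAt_fst).prodMk contMDiffAt_snd
  have h8 := key.contMDiffAt.comp (p₀, 0) (f := fun q : P × ℝ => ((φ q.1, q.2) : EP × ℝ)) h7
  refine h8.congr_of_eventuallyEq ?_
  have h9 : ∀ᶠ q in 𝓝 ((p₀, 0) : P × ℝ), q.1 ∈ φ.source :=
    (continuousAt_fst (p := (p₀, (0 : ℝ)))).eventually (extChartAt_source_mem_nhds (I := J) p₀)
  have h10 : ∀ᶠ q in 𝓝 ((p₀, 0) : P × ℝ), fderiv ℝ f (φ q.1, 0) (0, 1) = W (φ.symm (φ q.1)) :=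
    ((continuousAt_extChartAt (I := J) p₀).comp (continuousAt_fst (p := (p₀, (0 : ℝ))))
      ).eventually hdf
  filter_upwards [h9, h10] with q hq hq'
  have h11 : φ.symm (φ q.1) = q.1 := φ.left_inv hq
  rw [h11] at hq'
  simp only [Function.comp, hq', f, h11]

end Hadamard

/-! ### The action and the translations of the deformation space -/

namespace DefSpace

variable {E : Type*} [NormedAddCommGroup E] [NormedSpace ℝ E] [FiniteDimensional ℝ E]
  {G : Type*} [TopologicalSpace G] [ChartedSpace E G] [Group G] [LieGroup 𝓘(ℝ, E) ∞ G]
  {ES H : Type*} [NormedAddCommGroup ES] [NormedSpace ℝ ES] [TopologicalSpace H]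
  {I : ModelWithCorners ℝ ES H} {S : Type*} [TopologicalSpace S] [ChartedSpace H S]
  [IsManifold I ∞ S] {τ : C(S, ℝ)} [hτ : Fact (ContMDiff I 𝓘(ℝ, ℝ) ∞ τ)]

lemma blowDown_act (h : G) (q : DefSpace E H G τ) :
    (q.act h).blowDown = h * q.blowDown * h⁻¹ := by
  rcases q with ⟨g, t, ht⟩ | ⟨y, t, ht⟩
  · rfl
  · exact (by simp : (1 : G) = h * 1 * h⁻¹)

@[simp] lemma proj_act (h : G) (q : DefSpace E H G τ) : (q.act h).proj = q.proj := by
  rcases q with ⟨g, t, ht⟩ | ⟨y, t, ht⟩ <;> rfl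

lemma act_mk (h g : G) (x : E) (t : S) :
    (mk g x t : DefSpace E H G τ).act h = mk (h * g * h⁻¹) (adjE E h x) t := by
  by_cases ht : τ t = 0
  · rw [mk_of_eq _ _ ht, mk_of_eq _ _ ht]
    rfl
  · rw [mk_of_ne _ _ ht, mk_of_ne _ _ ht]
    rfl

/-- Right translation of `G` by `κ(τ x)`, which extends to translation of `𝔤` by `x`. It is defined
for all `x`, but behaves well only for small `x`. -/
noncomputable def translate (q : DefSpace E H G τ) (x : E) : DefSpace E H G τ :=
  match q with
  | grp g t ht => grp (g * kappa E G (τ t • x)) t ht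
  | lie y t ht => lie (show E from (show E from y) + x) t ht

lemma translate_zero (q : DefSpace E H G τ) : q.translate 0 = q := by
  rcases q with ⟨g, t, ht⟩ | ⟨y, t, ht⟩
  · refine congrArg (fun g => grp g t ht) ?_
    rw [smul_zero, kappa_zero, mul_one]
  · exact congrArg (fun y : E => lie y t ht) (add_zero (show E from y))

lemma blowDown_translate (q : DefSpace E H G τ) (x : E) :
    (q.translate x).blowDown = q.blowDown * kappa E G (τ q.proj • x) := by
  rcases q with ⟨g, t, ht⟩ | ⟨y, t, ht⟩
  · rfl
  · change (1 : G) = 1 * kappa E G (τ t • x)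
    rw [ht, zero_smul, kappa_zero, mul_one]

@[simp] lemma proj_translate (q : DefSpace E H G τ) (x : E) : (q.translate x).proj = q.proj := by
  rcases q with ⟨g, t, ht⟩ | ⟨y, t, ht⟩ <;> rfl

lemma translate_mk (g : G) (y x : E) (t : S) : (mk g y t : DefSpace E H G τ).translate x =
    mk (g * kappa E G (τ t • x)) (y + x) t := by
  by_cases ht : τ t = 0
  · rw [mk_of_eq _ _ ht, mk_of_eq _ _ ht]
    rfl
  · rw [mk_of_ne _ _ ht, mk_of_ne _ _ ht]
    rfl

/-- Over `τ = 0` the rescaled coordinate of the action is the difference quotient in `r` of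
`g κ(r x) g⁻¹`, extended by its derivative `Ad_g x`. -/
theorem contMDiff_act : ContMDiff (𝓘(ℝ, E).prod (𝓘(ℝ, E).prod I)) (𝓘(ℝ, E).prod I) ∞
    fun p : G × DefSpace E H G τ => p.2.act p.1 := by
  have : CompleteSpace E := FiniteDimensional.complete ℝ E
  rintro ⟨h, q⟩
  refine contMDiffAt_of_components ?_ ?_ fun h0 => ?_
  · simp only [blowDown_act]
    exact (contMDiff_conj (E := E) (G := G)).contMDiffAt.comp (h, q)
      (f := fun p : G × DefSpace E H G τ => (p.1, p.2.blowDown)) (contMDiffAt_fst.prodMk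
        ((contMDiff_blowDown (I := I) q).comp (h, q) contMDiffAt_snd))
  · simp only [proj_act]
    exact (contMDiff_proj (I := I) q).comp (h, q) (contMDiffAt_snd (I := 𝓘(ℝ, E)))
  · rw [proj_act] at h0
    refine contMDiffAt_of_comp_kappa h0 ?_
    have hΨ : ContMDiffAt ((𝓘(ℝ, E).prod 𝓘(ℝ, E)).prod 𝓘(ℝ, ℝ)) 𝓘(ℝ, E) ∞
        (fun p : (G × E) × ℝ => p.1.1 * kappa E G (p.2 • p.1.2) * p.1.1⁻¹)
        ((h, q.scaled), 0) :=
      (contMDiff_conj (E := E) (G := G)).contMDiffAt.comp ((h, q.scaled), (0 : ℝ))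
        (f := fun p : (G × E) × ℝ => (p.1.1, kappa E G (p.2 • p.1.2)))
        (contMDiffAt_fst.fst.prodMk (contMDiffAt_kappa_smul contMDiffAt_snd
          contMDiffAt_fst.snd (zero_smul ℝ _)))
    have key := contMDiffAt_difference_quotient (W := fun p : G × E => adjE E p.1 p.2) hΨ
      (fun p => by rw [zero_smul, kappa_zero]; simp)
      fun p => hasDerivAt_chart_conj_kappa p.1 p.2
    refine (key.comp_of_eq (x := (h, (q.scaled, q.proj))) (f := fun p : G × (E × S) =>
      ((p.1, p.2.1), τ p.2.2)) ?_ (by rw [h0])).congr_of_eventuallyEq ?_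
    · exact (contMDiffAt_fst.prodMk contMDiffAt_snd.fst).prodMk
        (hτ.out.contMDiffAt.comp (h, (q.scaled, q.proj)) contMDiffAt_snd.snd)
    · refine Filter.Eventually.of_forall fun p => ?_
      simp only [act_mk, scaled_mk, Function.comp]

/-- Over `τ = 0` the rescaled coordinate of the translation is the difference quotient in `r` of
`κ(r y) κ(r x)`, extended by its derivative `y + x`. -/
theorem contMDiffAt_translate (q : DefSpace E H G τ) :
    ContMDiffAt ((𝓘(ℝ, E).prod I).prod 𝓘(ℝ, E)) (𝓘(ℝ, E).prod I) ∞
      (Function.uncurry (translate : DefSpace E H G τ → E → DefSpace E H G τ)) (q, 0) := by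
  have : CompleteSpace E := FiniteDimensional.complete ℝ E
  suffices h : ContMDiffAt (𝓘(ℝ, E).prod (𝓘(ℝ, E).prod I)) (𝓘(ℝ, E).prod I) ∞
      (fun p : E × DefSpace E H G τ => p.2.translate p.1) (0, q) from
    h.comp (q, (0 : E)) (f := fun p : DefSpace E H G τ × E => (p.2, p.1))
      (contMDiffAt_snd.prodMk contMDiffAt_fst)
  refine contMDiffAt_of_components ?_ ?_ fun h0 => ?_
  · simp only [blowDown_translate]
    exact ((contMDiff_blowDown (I := I) q).comp ((0 : E), q) contMDiffAt_snd).mul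
      (contMDiffAt_kappa_smul ((hτ.out.comp contMDiff_proj).contMDiffAt.comp ((0 : E), q)
        contMDiffAt_snd) contMDiffAt_fst (smul_zero _))
  · simp only [proj_translate]
    exact (contMDiff_proj (I := I) q).comp ((0 : E), q) (contMDiffAt_snd (I := 𝓘(ℝ, E)))
  · rw [proj_translate] at h0
    refine contMDiffAt_of_comp_kappa h0 ?_
    have hΨ : ContMDiffAt ((𝓘(ℝ, E).prod 𝓘(ℝ, E)).prod 𝓘(ℝ, ℝ)) 𝓘(ℝ, E) ∞
        (fun p : (E × E) × ℝ => kappa E G (p.2 • p.1.2) * kappa E G (p.2 • p.1.1))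
        ((0, q.scaled), 0) :=
      (contMDiffAt_kappa_smul contMDiffAt_snd contMDiffAt_fst.snd (zero_smul ℝ _)).mul
        (contMDiffAt_kappa_smul contMDiffAt_snd contMDiffAt_fst.fst (zero_smul ℝ _))
    have key := contMDiffAt_difference_quotient (W := fun p : E × E => p.2 + p.1) hΨ
      (fun p => by rw [zero_smul, zero_smul, kappa_zero, mul_one])
      fun p => hasDerivAt_chart_kappa_mul_kappa p.2 p.1
    refine (key.comp_of_eq (x := ((0 : E), (q.scaled, q.proj))) (f := fun p : E × (E × S) =>
      ((p.1, p.2.1), τ p.2.2)) ?_ (by rw [h0])).congr_of_eventuallyEq ?_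
    · exact (contMDiffAt_fst.prodMk contMDiffAt_snd.fst).prodMk
        (hτ.out.contMDiffAt.comp ((0 : E), (q.scaled, q.proj)) contMDiffAt_snd.snd)
    · refine Filter.Eventually.of_forall fun p => ?_
      simp only [translate_mk, scaled_mk, Function.comp]

end DefSpace

/-! ### Equivariant maps and embeddings of fibres -/

section Equivariant

variable {E : Type*} [NormedAddCommGroup E] [NormedSpace ℝ E]
  {G : Type*} [TopologicalSpace G] [ChartedSpace E G] [Group G]
  {EM HM : Type*} [NormedAddCommGroup EM] [NormedSpace ℝ EM] [TopologicalSpace HM]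
  {I : ModelWithCorners ℝ EM HM} {M : Type*} [TopologicalSpace M] [ChartedSpace HM M]
  {EN HN : Type*} [NormedAddCommGroup EN] [NormedSpace ℝ EN] [TopologicalSpace HN]
  {J : ModelWithCorners ℝ EN HN} {N : Type*} [TopologicalSpace N] [ChartedSpace HN N]

lemma IsSmoothAction.mdifferentiableAt_orbit {a : G → M → M} (ha : IsSmoothAction (E := E) I a)
    (m : M) : MDifferentiableAt 𝓘(ℝ, E) I (fun g => a g m) 1 :=
  (ha.smooth.comp (contMDiff_id.prodMk contMDiff_const)).mdifferentiableAt (by simp)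

/-- Equivariant maps relate the fundamental vector fields. -/
lemma mfderiv_fundamental {a : G → M → M} {b : G → N → N} {j : M → N}
    (ha : IsSmoothAction (E := E) I a) {m : M} (hj : MDifferentiableAt I J j m)
    (h : ∀ g, b g (j m) = j (a g m)) (x : GroupLieAlgebra 𝓘(ℝ, E) G) :
    (fundamental J b x (j m) : EN) = mfderiv I J j m (fundamental I a x m) := by
  have e : (fun g => b g (j m)) = j ∘ fun g => a g m := funext h
  have h1 := mfderiv_comp_apply_of_eq (1 : G) hj (ha.mdifferentiableAt_orbit m) (ha.one m) x
  rw [← e] at h1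
  refine (congrArg (fun v : EN => -v) h1).trans ?_
  let L : EM →L[ℝ] EN := mfderiv I J j m
  exact (map_neg L _).symm

lemma pullFundamental_of_equivariant {a : G → M → M} {b : G → N → N} {j : M → N}
    (ha : IsSmoothAction (E := E) I a) {m : M} (hj : MDifferentiableAt I J j m)
    (h : ∀ g, b g (j m) = j (a g m)) (α : TangentSpace J (j m) →L[ℝ] ℝ) :
    pullFundamental E b (j m) α = pullFundamental E a m (α.comp (mfderiv I J j m)) :=
  ContinuousLinearMap.ext fun x => congrArg α (mfderiv_fundamental ha hj h x)

lemma isSmoothField_fundamental [IsManifold I 1 M] [LieGroup 𝓘(ℝ, E) ∞ G] {a : G → M → M}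
    (ha : IsSmoothAction (E := E) I a) (x : GroupLieAlgebra 𝓘(ℝ, E) G) :
    IsSmoothField (I := I) (M := M) fun m => fundamental I a x m := by
  have : IsManifold 𝓘(ℝ, E) 1 G := IsManifold.of_le (n := ∞) (by simp)
  exact (isSmoothField_of_family (F := fun m (g : G) => a g m)
    (fun m => (ha.smooth.comp (contMDiff_snd.prodMk contMDiff_fst)).contMDiffAt) ha.one x).neg

lemma isSmooth_cartanField [IsManifold I 1 M] [LieGroup 𝓘(ℝ, E) ∞ G] {ι : Type*} [Fintype ι]
    [DecidableEq ι] (B : InvariantForm E G)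
    (e : Module.Basis ι ℝ (GroupLieAlgebra 𝓘(ℝ, E) G)) {a : G → M → M}
    (ha : IsSmoothAction (E := E) I a) : (cartanField I B e a).IsSmooth := by
  refine KVectorField.IsSmooth.smul (KVectorField.IsSmooth.sum fun i _ =>
    KVectorField.IsSmooth.sum fun j _ => KVectorField.IsSmooth.sum fun k _ =>
      KVectorField.IsSmooth.smul ?_ contMDiff_const) contMDiff_const
  have h := isSmooth_wedge (I := I) (M := M)
    (V := ![fundamental I a (e i), fundamental I a (e j), fundamental I a (e k)]) (fun l => by
      fin_cases l
      exacts [isSmoothField_fundamental ha _, isSmoothField_fundamental ha _,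
        isSmoothField_fundamental ha _])
  convert! h using 3 with m
  ext l
  fin_cases l <;> rfl

/-- An injective smooth map with a smooth left inverse is an embedding. -/
lemma isFibreDiffeo_of_leftInverse {S : Type*} {p : N → S} {t : S}
    {j : M → N} {r : N → M} (hj : ContMDiff I J ∞ j) (hr : ∀ m, ContMDiffAt J I ∞ r (j m))
    (h : ∀ m, r (j m) = m) (hp : Set.range j = p ⁻¹' {t}) : IsFibreDiffeo I J p t j where
  smooth := hj
  -- the differential of the left inverse inverts the differential of `j` from the left
  immersive m := by
    have h1 : ∀ v : TangentSpace I m, (mfderiv J I r (j m) (mfderiv I J j m v) : EM) = v := by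
      intro v
      have h2 := mfderiv_comp_apply m ((hr m).mdifferentiableAt (by simp))
        ((hj m).mdifferentiableAt (by simp)) v
      have e : r ∘ j = id := funext h
      rw [e] at h2
      exact h2.symm.trans (congrArg (fun L : EM →L[ℝ] EM => L v) (mfderiv_id (I := I) (x := m)))
    intro v w hvw
    exact (h1 v).symm.trans ((congrArg (fun u : EN => (mfderiv J I r (j m) u : EM)) hvw).trans
      (h1 w))
  embedding := by
    refine ⟨Topology.isInducing_iff_nhds.2 fun m => le_antisymm
      (hj.continuous.tendsto m).le_comap ?_, fun m n hmn => by rw [← h m, hmn, h n]⟩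
    intro s hs
    have h1 : r ⁻¹' s ∈ 𝓝 (j m) := (hr m).continuousAt.preimage_mem_nhds (by rwa [h m])
    exact ⟨_, h1, fun n hn => by simpa only [Set.mem_preimage, h n] using hn⟩
  range := hp

lemma wedge_eq_zero_of_vertical {V : Type*} [AddCommGroup V] [Module ℝ V] [TopologicalSpace V]
    {k : ℕ} {v : Fin k → V} {α : Fin k → V →L[ℝ] ℝ} {i : Fin k} (h : ∀ j, α i (v j) = 0) :
    wedge v α = 0 :=
  Matrix.det_eq_zero_of_row_eq_zero i h

/-- Vector fields along the orbits of a family of fibre-preserving maps are vertical. -/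
lemma mfderiv_family_vertical {ES HS : Type*} [NormedAddCommGroup ES] [NormedSpace ℝ ES]
    [TopologicalSpace HS] {IS : ModelWithCorners ℝ ES HS} {S : Type*} [TopologicalSpace S]
    [ChartedSpace HS S] {p : N → S} {F : M → N} {m : M} {n : N} (hn : F m = n)
    (hp : MDifferentiableAt J IS p n) (hF : MDifferentiableAt I J F m) (h : ∀ x, p (F x) = p n)
    (v : TangentSpace I m) :
    (mfderiv J IS p n (show EN from mfderiv I J F m v) : ES) = 0 := by
  have h1 := mfderiv_comp_apply_of_eq m hp hF hn v
  have e : p ∘ F = fun _ => p n := funext h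
  rw [e] at h1
  refine h1.symm.trans ?_
  exact congrArg (fun L : EM →L[ℝ] ES => L v) (mfderiv_const (I := I) (I' := IS) (x := m))

end Equivariant

/-! ### The Poisson structure of the deformation space -/

namespace DefSpace

variable {E : Type*} [NormedAddCommGroup E] [NormedSpace ℝ E] [FiniteDimensional ℝ E]
  {G : Type*} [TopologicalSpace G] [ChartedSpace E G] [Group G] [LieGroup 𝓘(ℝ, E) ∞ G]
  {ES H : Type*} [NormedAddCommGroup ES] [NormedSpace ℝ ES] [TopologicalSpace H]
  {I : ModelWithCorners ℝ ES H} {S : Type*} [TopologicalSpace S] [ChartedSpace H S]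
  [IsManifold I ∞ S] {τ : C(S, ℝ)} [hτ : Fact (ContMDiff I 𝓘(ℝ, ℝ) ∞ τ)]
  {ι : Type*} [Fintype ι] [DecidableEq ι]

lemma isSmoothAction_act : IsSmoothAction (E := E) (𝓘(ℝ, E).prod I)
    (act : G → DefSpace E H G τ → DefSpace E H G τ) where
  one := by
    have : CompleteSpace E := FiniteDimensional.complete ℝ E
    rintro (⟨g, t, ht⟩ | ⟨y, t, ht⟩)
    · exact congrArg (fun g => grp g t ht) (by simp)
    · exact congrArg (fun y => lie y t ht) (adj_one y)
  mul g h := by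
    have : CompleteSpace E := FiniteDimensional.complete ℝ E
    rintro (⟨k, t, ht⟩ | ⟨y, t, ht⟩)
    · exact congrArg (fun g => grp g t ht) (by simp [mul_assoc])
    · exact congrArg (fun y => lie y t ht) (adj_mul g h y)
  smooth := contMDiff_act

variable (I) in
/-- The vector field along which `translate` moves: `τ x^L` on `G`, the constant vector field `x`
on `𝔤`. -/
noncomputable def translateField (x : GroupLieAlgebra 𝓘(ℝ, E) G) (q : DefSpace E H G τ) :
    TangentSpace (𝓘(ℝ, E).prod I) q :=
  (mfderiv 𝓘(ℝ, E) (𝓘(ℝ, E).prod I) (translate q) 0 x : E × ES)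

variable (I) in
/-- The linear form `x ↦ α(translateField x)` on `𝔤`. -/
noncomputable def pullTranslate (q : DefSpace E H G τ)
    (α : TangentSpace (𝓘(ℝ, E).prod I) q →L[ℝ] ℝ) : E →L[ℝ] ℝ :=
  let d : E →L[ℝ] E × ES := mfderiv 𝓘(ℝ, E) (𝓘(ℝ, E).prod I) (translate q) 0
  let α' : E × ES →L[ℝ] ℝ := α
  α'.comp d

lemma contMDiffAt_translate_right (q : DefSpace E H G τ) :
    ContMDiffAt 𝓘(ℝ, E) (𝓘(ℝ, E).prod I) ∞ (translate q) 0 :=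
  (contMDiffAt_translate (I := I) q).comp (0 : E) (f := fun x => (q, x))
    (contMDiffAt_const.prodMk contMDiffAt_id)

lemma isSmoothField_translateField (x : GroupLieAlgebra 𝓘(ℝ, E) G) :
    IsSmoothField (I := 𝓘(ℝ, E).prod I) (M := DefSpace E H G τ) (translateField I x) := by
  have := isManifold (E := E) (G := G) (I := I) (τ := τ)
  have : IsManifold (𝓘(ℝ, E).prod I) 1 (DefSpace E H G τ) := IsManifold.of_le (n := ∞) (by simp)
  exact isSmoothField_of_family contMDiffAt_translate translate_zero x

variable (I) in
/-- The bivector field on the deformation space which restricts to `τ P_G` and to the linear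
Poisson structure. It is `-½ ∑ (eᵢ)_𝒢 ∧ Vⁱ`, where `Vⁱ` extends `τ (eⁱ)^L`: on `G`, as
`(eᵢ)_G = eᵢ^L - eᵢ^R` and `∑ eᵢ^L ∧ (eⁱ)^L = 0`, this is `τ · ½ ∑ eᵢ^R ∧ (eⁱ)^L`. -/
noncomputable def deformationBivector (B : InvariantForm E G)
    (e : Module.Basis ι ℝ (GroupLieAlgebra 𝓘(ℝ, E) G)) :
    KVectorField (𝓘(ℝ, E).prod I) (DefSpace E H G τ) 2 :=
  fun q => (-(1 / 2) : ℝ) • ∑ i, wedge ![fundamental (𝓘(ℝ, E).prod I) act (e i) q,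
    translateField I (B.dual e i) q]

variable (I) in
/-- The trivector field on the deformation space which restricts to `τ² φ_G` and to `0`. -/
noncomputable def deformationTrivector (B : InvariantForm E G)
    (e : Module.Basis ι ℝ (GroupLieAlgebra 𝓘(ℝ, E) G)) :
    KVectorField (𝓘(ℝ, E).prod I) (DefSpace E H G τ) 3 :=
  fun q => (τ q.proj ^ 2) • cartanField (𝓘(ℝ, E).prod I) B e act q

variable (B : InvariantForm E G) (e : Module.Basis ι ℝ (GroupLieAlgebra 𝓘(ℝ, E) G))

lemma isSmooth_deformationBivector :
    (deformationBivector (τ := τ) I B e).IsSmooth := by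
  have := isManifold (E := E) (G := G) (I := I) (τ := τ)
  have : IsManifold (𝓘(ℝ, E).prod I) 1 (DefSpace E H G τ) := IsManifold.of_le (n := ∞) (by simp)
  refine KVectorField.IsSmooth.smul (KVectorField.IsSmooth.sum fun i _ => ?_) contMDiff_const
  have h := isSmooth_wedge (I := 𝓘(ℝ, E).prod I) (M := DefSpace E H G τ)
    (V := ![fundamental (𝓘(ℝ, E).prod I) act (e i), translateField I (B.dual e i)]) (fun l => by
      fin_cases l
      exacts [isSmoothField_fundamental isSmoothAction_act _, isSmoothField_translateField _])
  convert! h using 3 with m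
  ext l
  fin_cases l <;> rfl

lemma isSmooth_deformationTrivector :
    (deformationTrivector (τ := τ) I B e).IsSmooth := by
  have := isManifold (E := E) (G := G) (I := I) (τ := τ)
  have : IsManifold (𝓘(ℝ, E).prod I) 1 (DefSpace E H G τ) := IsManifold.of_le (n := ∞) (by simp)
  refine KVectorField.IsSmooth.smul (isSmooth_cartanField B e isSmoothAction_act) ?_
  exact ((hτ.out.comp contMDiff_proj).pow 2)

lemma fundamental_vertical (x : GroupLieAlgebra 𝓘(ℝ, E) G) (q : DefSpace E H G τ) :
    (mfderiv (𝓘(ℝ, E).prod I) I proj q (fundamental (𝓘(ℝ, E).prod I) act x q) : ES) = 0 := by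
  have ha := isSmoothAction_act (E := E) (G := G) (I := I) (τ := τ)
  have h1 := mfderiv_family_vertical (IS := I) (p := proj) (F := fun g => act g q) (ha.one q)
    ((contMDiff_proj q).mdifferentiableAt (by simp)) (ha.mdifferentiableAt_orbit q)
    (fun g => proj_act g q) x
  let L : E × ES →L[ℝ] ES := mfderiv (𝓘(ℝ, E).prod I) I proj q
  refine (map_neg L _).trans ?_
  exact (congrArg (fun v : ES => -v) h1).trans neg_zero

lemma translateField_vertical (x : GroupLieAlgebra 𝓘(ℝ, E) G) (q : DefSpace E H G τ) :
    (mfderiv (𝓘(ℝ, E).prod I) I proj q (translateField I x q) : ES) = 0 :=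
  mfderiv_family_vertical (IS := I) (translate_zero q)
    ((contMDiff_proj q).mdifferentiableAt (by simp))
    ((contMDiffAt_translate_right q).mdifferentiableAt (by simp)) (proj_translate q) x

lemma isVertical_deformationBivector :
    (deformationBivector (τ := τ) I B e).IsVertical I proj := by
  rintro q α ⟨k, hk⟩
  refine (congrArg ((-(1 / 2) : ℝ) * ·) ((KVector.sum_apply _ _ _).trans
    (Finset.sum_eq_zero fun i _ => wedge_eq_zero_of_vertical (i := k) fun l => ?_))).trans
    (mul_zero _)
  fin_cases l
  exacts [hk _ (fundamental_vertical _ q), hk _ (translateField_vertical _ q)]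

lemma isVertical_deformationTrivector :
    (deformationTrivector (τ := τ) I B e).IsVertical I proj := by
  rintro q α ⟨k, hk⟩
  have h0 : ∀ i j l, wedge ![fundamental (𝓘(ℝ, E).prod I) act (e i) q,
      fundamental (𝓘(ℝ, E).prod I) act (e j) q,
      fundamental (𝓘(ℝ, E).prod I) act (e l) q] α = 0 := by
    intro i j l
    refine wedge_eq_zero_of_vertical (i := k) fun n => ?_
    fin_cases n <;> exact hk _ (fundamental_vertical _ q)
  have h1 : cartanField (𝓘(ℝ, E).prod I) B e act q α = 0 := by
    refine (congrArg ((1 / 12 : ℝ) * ·) ?_).trans (mul_zero _)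
    refine (KVector.sum_apply _ _ _).trans (Finset.sum_eq_zero fun i _ => ?_)
    refine (KVector.sum_apply _ _ _).trans (Finset.sum_eq_zero fun j _ => ?_)
    refine (KVector.sum_apply _ _ _).trans (Finset.sum_eq_zero fun l _ => ?_)
    exact (congrArg (_ * ·) (h0 i j l)).trans (mul_zero _)
  exact (congrArg (τ q.proj ^ 2 * ·) h1).trans (mul_zero _)

lemma deformationBivector_apply (q : DefSpace E H G τ)
    (α : Fin 2 → TangentSpace (𝓘(ℝ, E).prod I) q →L[ℝ] ℝ) :
    deformationBivector I B e q α =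
      -(1 / 2) * (pullTranslate I q (α 1) (B.sharp (pullFundamental E act q (α 0))) -
        pullTranslate I q (α 0) (B.sharp (pullFundamental E act q (α 1)))) := by
  rw [← B.sum_mul_dual e, ← B.sum_mul_dual e, ← Finset.sum_sub_distrib]
  refine congrArg ((-(1 / 2) : ℝ) * ·) ((KVector.sum_apply _ _ _).trans ?_)
  refine Finset.sum_congr rfl fun i _ => (wedge_two _ _ _).trans ?_
  exact congrArg (_ - ·) (mul_comm _ _)

section Fibres

/-- The fibre over `t` with `τ(t) ≠ 0` is a copy of `G`. -/
lemma isFibreDiffeo_group {t : S} (ht : τ t ≠ 0) :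
    IsFibreDiffeo 𝓘(ℝ, E) (𝓘(ℝ, E).prod I) proj t
      (fun g : G => (mk g 0 t : DefSpace E H G τ)) := by
  refine isFibreDiffeo_of_leftInverse (r := blowDown) (fun g => ?_)
    (fun g => contMDiff_blowDown (I := I) _) (fun g => blowDown_mk_of_ne g 0 ht) ?_
  · exact (contMDiffAt_mk_of_ne (I := I) g ht).comp g (f := fun g : G => (g, t))
      (contMDiffAt_id.prodMk contMDiffAt_const)
  · refine Set.Subset.antisymm (Set.range_subset_iff.2 fun g => proj_mk g 0 t) ?_
    rintro q rfl
    exact ⟨q.blowDown, mk_blowDown q ht 0⟩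

variable {t : S}

lemma act_group (t : S) (h g : G) : (mk g 0 t : DefSpace E H G τ).act h = mk (h * g * h⁻¹) 0 t := by
  rw [act_mk, map_zero]

lemma translate_group (ht : τ t ≠ 0) (g : G) (x : E) :
    (mk g 0 t : DefSpace E H G τ).translate x = mk (g * kappa E G (τ t • x)) 0 t := by
  rw [translate_mk, mk_of_ne _ _ ht, mk_of_ne _ _ ht]

lemma pullTranslate_group (ht : τ t ≠ 0) (g : G)
    (α : TangentSpace (𝓘(ℝ, E).prod I) (mk g 0 t : DefSpace E H G τ) →L[ℝ] ℝ) :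
    pullTranslate I (mk g 0 t) α = τ t • pullLeft g
      (α.comp (mfderiv 𝓘(ℝ, E) (𝓘(ℝ, E).prod I)
        (fun g : G => (mk g 0 t : DefSpace E H G τ)) g)) := by
  have : CompleteSpace E := FiniteDimensional.complete ℝ E
  have hκ : HasMFDerivAt 𝓘(ℝ, E) 𝓘(ℝ, E) (kappa E G) (τ t • (0 : E))
      (ContinuousLinearMap.id ℝ E) := by
    rw [smul_zero]
    exact hasMFDerivAt_kappa_zero G
  have h1 := hκ.comp (0 : E) (τ t • ContinuousLinearMap.id ℝ E).hasMFDerivAt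
  have h2 : HasMFDerivAt 𝓘(ℝ, E) 𝓘(ℝ, E) (fun h : G => g * h) (kappa E G (τ t • (0 : E)))
      (mfderiv 𝓘(ℝ, E) 𝓘(ℝ, E) (fun h : G => g * h) 1) := by
    rw [smul_zero, kappa_zero]
    exact (mdifferentiableAt_mul_left_one g).hasMFDerivAt
  have h3 := h2.comp (0 : E) h1
  have hj : HasMFDerivAt 𝓘(ℝ, E) (𝓘(ℝ, E).prod I) (fun g : G => (mk g 0 t : DefSpace E H G τ))
      (g * kappa E G (τ t • (0 : E)))
      (mfderiv 𝓘(ℝ, E) (𝓘(ℝ, E).prod I) (fun g : G => (mk g 0 t : DefSpace E H G τ)) g) := by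
    rw [smul_zero, kappa_zero, mul_one]
    exact (((isFibreDiffeo_group ht).smooth g).mdifferentiableAt (by simp)).hasMFDerivAt
  have h4 := (hj.comp (0 : E) h3).mfderiv
  have e1 : (mk g 0 t : DefSpace E H G τ).translate =
      fun x => mk (g * kappa E G (τ t • x)) 0 t := funext (translate_group ht g)
  refine ContinuousLinearMap.ext fun x => ?_
  let d : G → E →L[ℝ] E × ES := fun g =>
    mfderiv 𝓘(ℝ, E) (𝓘(ℝ, E).prod I) (fun g : G => (mk g 0 t : DefSpace E H G τ)) g
  let l : E →L[ℝ] E := mfderiv 𝓘(ℝ, E) 𝓘(ℝ, E) (fun h : G => g * h) 1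
  let α' : E × ES →L[ℝ] ℝ := α
  have h5 : (mfderiv 𝓘(ℝ, E) (𝓘(ℝ, E).prod I) (mk g 0 t : DefSpace E H G τ).translate 0 :
      E →L[ℝ] E × ES) = (d g).comp (l.comp (τ t • ContinuousLinearMap.id ℝ E)) := by
    rw [e1]
    exact h4
  have h6 : α' (d g (l (τ t • x))) = τ t * α' (d g (l x)) := by
    rw [map_smul, map_smul, map_smul, smul_eq_mul]
  exact (congrArg (fun L : E →L[ℝ] E × ES => α' (L x)) h5).trans h6

/-- Over `τ ≠ 0` the fundamental fields are `x^L - x^R` and `translateField` is `τ x^L`; by symmetry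
of the form the terms with two left-invariant fields cancel. -/
lemma deformationBivector_group (ht : τ t ≠ 0) (g : G) :
    deformationBivector I B e (mk g 0 t : DefSpace E H G τ) =
      (τ t • groupBivector B e g).push (mfderiv 𝓘(ℝ, E) (𝓘(ℝ, E).prod I)
        (fun g : G => (mk g 0 t : DefSpace E H G τ)) g) := by
  refine AlternatingMap.ext fun α => ?_
  have hj := ((isFibreDiffeo_group (E := E) (I := I) (G := G) ht).smooth g).mdifferentiableAt
    (by simp : (∞ : WithTop ℕ∞) ≠ 0)
  set a : Fin 2 → TangentSpace 𝓘(ℝ, E) g →L[ℝ] ℝ := fun i => (α i).comp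
    (mfderiv 𝓘(ℝ, E) (𝓘(ℝ, E).prod I) (fun g : G => (mk g 0 t : DefSpace E H G τ)) g) with ha
  have h1 : ∀ i, pullFundamental E act (mk g 0 t : DefSpace E H G τ) (α i) =
      pullLeft g (a i) - pullRight g (a i) := fun i =>
    (pullFundamental_of_equivariant isSmoothAction_conj hj (fun h => act_group t h g) (α i)).trans
      (pullFundamental_conj g _)
  have h2 : ∀ i, pullTranslate I (mk g 0 t : DefSpace E H G τ) (α i) = τ t • pullLeft g (a i) :=
    fun i => pullTranslate_group ht g (α i)
  refine (deformationBivector_apply B e _ α).trans ?_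
  rw [h1, h1, h2, h2, B.sharp_sub, B.sharp_sub]
  refine Eq.trans ?_ (congrArg (τ t * ·) (groupBivector_apply B e g a)).symm
  have h3 := B.sharp_comm (pullLeft g (a 0)) (pullLeft g (a 1))
  have h4 := B.sharp_comm (pullRight g (a 1)) (pullLeft g (a 0))
  have h5 : ∀ (η : E →L[ℝ] ℝ) (x y : GroupLieAlgebra 𝓘(ℝ, E) G),
      (τ t • η) (x - y : GroupLieAlgebra 𝓘(ℝ, E) G) = τ t * (η x - η y) := fun η x y =>
    congrArg (τ t * ·) (map_sub η _ _)
  rw [h5, h5, h3, h4]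
  ring

lemma deformationTrivector_group (ht : τ t ≠ 0) (g : G) :
    deformationTrivector I B e (mk g 0 t : DefSpace E H G τ) =
      (τ t ^ 2 • cartanField 𝓘(ℝ, E) B e (fun g h : G => g * h * g⁻¹) g).push
        (mfderiv 𝓘(ℝ, E) (𝓘(ℝ, E).prod I) (fun g : G => (mk g 0 t : DefSpace E H G τ)) g) := by
  refine AlternatingMap.ext fun α => ?_
  have hj := ((isFibreDiffeo_group (E := E) (I := I) (G := G) ht).smooth g).mdifferentiableAt
    (by simp : (∞ : WithTop ℕ∞) ≠ 0)
  set a : Fin 3 → TangentSpace 𝓘(ℝ, E) g →L[ℝ] ℝ := fun i => (α i).comp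
    (mfderiv 𝓘(ℝ, E) (𝓘(ℝ, E).prod I) (fun g : G => (mk g 0 t : DefSpace E H G τ)) g) with ha
  have h1 : ∀ i, pullFundamental E act (mk g 0 t : DefSpace E H G τ) (α i) =
      pullFundamental E (fun g h : G => g * h * g⁻¹) g (a i) :=
    fun i => pullFundamental_of_equivariant isSmoothAction_conj hj (fun h => act_group t h g) (α i)
  have h2 : deformationTrivector I B e (mk g 0 t : DefSpace E H G τ) α =
      τ (mk g 0 t : DefSpace E H G τ).proj ^ 2 *
        cartanField (𝓘(ℝ, E).prod I) B e act (mk g 0 t : DefSpace E H G τ) α := rfl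
  rw [h2, proj_mk, cartanField_apply, h1, h1, h1, ← cartanField_apply B e]
  rfl

end Fibres

end DefSpace

/-! ### The fibres over `τ = 0` -/

namespace DefSpace

section LieFibre

variable {E : Type*} [NormedAddCommGroup E] [NormedSpace ℝ E] [FiniteDimensional ℝ E]
  {G : Type*} [TopologicalSpace G] [ChartedSpace E G] [Group G] [LieGroup 𝓘(ℝ, E) ∞ G]
  {ES H : Type*} [NormedAddCommGroup ES] [NormedSpace ℝ ES] [TopologicalSpace H]
  {I : ModelWithCorners ℝ ES H} {S : Type*} [TopologicalSpace S] [ChartedSpace H S]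
  [IsManifold I ∞ S] {τ : C(S, ℝ)} [hτ : Fact (ContMDiff I 𝓘(ℝ, ℝ) ∞ τ)]
  {ι : Type*} [Fintype ι] [DecidableEq ι] (B : InvariantForm E G)

/-- The isomorphism `𝔤 ≅ 𝔤*`, `x ↦ ⟨x, ·⟩`. -/
noncomputable def _root_.InvariantForm.flat : E →L[ℝ] E →L[ℝ] ℝ :=
  let b : E →ₗ[ℝ] E →ₗ[ℝ] ℝ := B.form
  LinearMap.toContinuousLinearMap (LinearMap.toContinuousLinearMap.toLinearMap ∘ₗ b)

lemma _root_.InvariantForm.sharp_flat (x : GroupLieAlgebra 𝓘(ℝ, E) G) :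
    B.sharp (B.flat x) = x :=
  B.sharp_eq_iff.2 fun _ => rfl

lemma _root_.InvariantForm.flat_sharp (ξ : E →L[ℝ] ℝ) : B.flat (B.sharp ξ) = ξ :=
  ContinuousLinearMap.ext fun x => B.sharp_left ξ x

/-- The isomorphism `𝔤* ≅ 𝔤`, as a continuous linear map. -/
noncomputable def _root_.InvariantForm.sharpMap : (E →L[ℝ] ℝ) →L[ℝ] E :=
  LinearMap.toContinuousLinearMap
    { toFun := fun ξ => B.sharp ξ
      map_add' := B.sharp_add
      map_smul' := fun c ξ => B.sharp_eq_iff.2 fun z => by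
        refine (LinearMap.map_smul₂ B.form _ _ _).trans ?_
        exact congrArg (c * ·) (B.sharp_left ξ z) }

lemma _root_.InvariantForm.sharp_coadj (g : G) (ξ : E →L[ℝ] ℝ) :
    B.sharp (coadj g ξ) = adj g (B.sharp ξ) := by
  have : CompleteSpace E := FiniteDimensional.complete ℝ E
  refine B.sharp_eq_iff.2 fun z => (B.adj_left g _ z).trans (B.sharp_left _ _)

variable {t : S}

/-- The fibre over `t` with `τ(t) = 0` is a copy of `𝔤* ≅ 𝔤`. -/
lemma isFibreDiffeo_dual (ht : τ t = 0) :
    IsFibreDiffeo 𝓘(ℝ, E →L[ℝ] ℝ) (𝓘(ℝ, E).prod I) proj t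
      (fun ξ : E →L[ℝ] ℝ => (mk 1 (B.sharpMap ξ) t : DefSpace E H G τ)) := by
  have hs : ∀ ξ, (mk 1 (B.sharpMap ξ) t : DefSpace E H G τ).scaled = B.sharpMap ξ := fun ξ => by
    rw [scaled_mk, if_pos ht]
  have hb : ∀ ξ, (mk 1 (B.sharpMap ξ) t : DefSpace E H G τ).blowDown = 1 := fun ξ =>
    blowDown_mk _ fun _ => rfl
  refine isFibreDiffeo_of_leftInverse (r := fun q => B.flat q.scaled) (fun ξ => ?_)
    (fun ξ => ?_) (fun ξ => ?_) ?_
  · refine contMDiffAt_of_components ?_ ?_ fun _ => ?_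
    · simp only [hb]
      exact contMDiffAt_const
    · simp only [proj_mk]
      exact contMDiffAt_const
    · simp only [hs]
      exact B.sharpMap.contMDiffAt
  · refine B.flat.contMDiffAt.comp _ (contMDiffAt_scaled ?_)
    rw [hb]
    exact mem_chart_source E (1 : G)
  · exact (congrArg B.flat (hs ξ)).trans (B.flat_sharp ξ)
  · refine Set.Subset.antisymm (Set.range_subset_iff.2 fun ξ => proj_mk _ _ t) ?_
    rintro q rfl
    refine ⟨B.flat q.scaled, ?_⟩
    have h1 : B.sharpMap (B.flat q.scaled) = q.scaled := B.sharp_flat _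
    refine (congrArg (fun x : E => mk 1 x q.proj) h1).trans ?_
    have h2 := mk_eq q q.scaled fun _ => rfl
    rwa [blowDown_of_eq q ht] at h2

lemma act_dual (ht : τ t = 0) (h : G) (ξ : E →L[ℝ] ℝ) :
    (mk 1 (B.sharpMap ξ) t : DefSpace E H G τ).act h = mk 1 (B.sharpMap (coadj h ξ)) t := by
  refine (act_mk h 1 (B.sharpMap ξ) t).trans ?_
  rw [mk_of_eq _ _ ht, mk_of_eq _ _ ht]
  exact congrArg (fun x => lie x t ht) (B.sharp_coadj h ξ).symm

lemma translate_dual (ht : τ t = 0) (ξ : E →L[ℝ] ℝ) (x : E) :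
    (mk 1 (B.sharpMap ξ) t : DefSpace E H G τ).translate x =
      mk 1 (B.sharpMap (ξ + B.flat x)) t := by
  refine (translate_mk 1 (B.sharpMap ξ) x t).trans ?_
  rw [mk_of_eq _ _ ht, mk_of_eq _ _ ht]
  refine congrArg (fun x => lie x t ht) ((map_add B.sharpMap ξ (B.flat x)).trans ?_).symm
  exact congrArg (B.sharpMap ξ + ·) (B.sharp_flat x)

lemma pullTranslate_dual (ht : τ t = 0) (ξ : E →L[ℝ] ℝ)
    (α : TangentSpace (𝓘(ℝ, E).prod I) (mk 1 (B.sharpMap ξ) t : DefSpace E H G τ) →L[ℝ] ℝ)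
    (x : GroupLieAlgebra 𝓘(ℝ, E) G) :
    pullTranslate I (mk 1 (B.sharpMap ξ) t) α x = α (mfderiv 𝓘(ℝ, E →L[ℝ] ℝ) (𝓘(ℝ, E).prod I)
      (fun ξ : E →L[ℝ] ℝ => (mk 1 (B.sharpMap ξ) t : DefSpace E H G τ)) ξ (B.flat x)) := by
  have h1 : HasMFDerivAt 𝓘(ℝ, E) 𝓘(ℝ, E →L[ℝ] ℝ) (fun x : E => ξ + B.flat x) 0 B.flat :=
    ((B.flat.hasFDerivAt (x := (0 : E))).const_add ξ).hasMFDerivAt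
  have hj : HasMFDerivAt 𝓘(ℝ, E →L[ℝ] ℝ) (𝓘(ℝ, E).prod I)
      (fun ξ : E →L[ℝ] ℝ => (mk 1 (B.sharpMap ξ) t : DefSpace E H G τ)) (ξ + B.flat 0)
      (mfderiv 𝓘(ℝ, E →L[ℝ] ℝ) (𝓘(ℝ, E).prod I)
        (fun ξ : E →L[ℝ] ℝ => (mk 1 (B.sharpMap ξ) t : DefSpace E H G τ)) ξ) := by
    rw [map_zero, add_zero]
    exact (((isFibreDiffeo_dual B ht).smooth ξ).mdifferentiableAt (by simp)).hasMFDerivAt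
  have h4 := (hj.comp (0 : E) h1).mfderiv
  have e1 : (mk 1 (B.sharpMap ξ) t : DefSpace E H G τ).translate =
      fun x => mk 1 (B.sharpMap (ξ + B.flat x)) t := funext (translate_dual B ht ξ)
  let d : (E →L[ℝ] ℝ) →L[ℝ] E × ES := mfderiv 𝓘(ℝ, E →L[ℝ] ℝ) (𝓘(ℝ, E).prod I)
    (fun ξ : E →L[ℝ] ℝ => (mk 1 (B.sharpMap ξ) t : DefSpace E H G τ)) ξ
  have h5 : (mfderiv 𝓘(ℝ, E) (𝓘(ℝ, E).prod I)
      (mk 1 (B.sharpMap ξ) t : DefSpace E H G τ).translate 0 : E →L[ℝ] E × ES) = d.comp B.flat := by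
    rw [e1]
    exact h4
  exact congrArg (fun L : E →L[ℝ] E × ES => (α : E × ES →L[ℝ] ℝ) (L x)) h5

/-- Over `τ = 0` the field `Vⁱ` is constant with value `⟨eⁱ, ·⟩` and `(eᵢ)_𝒢` is `ξ ∘ ad`, so both
halves of each wedge product contract to `ξ([·, ·])`. -/
lemma deformationBivector_dual (e : Module.Basis ι ℝ (GroupLieAlgebra 𝓘(ℝ, E) G))
    (ht : τ t = 0) (ξ : E →L[ℝ] ℝ) :
    deformationBivector I B e (mk 1 (B.sharpMap ξ) t : DefSpace E H G τ) =
      (linearBivector e ξ).push (mfderiv 𝓘(ℝ, E →L[ℝ] ℝ) (𝓘(ℝ, E).prod I)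
        (fun ξ : E →L[ℝ] ℝ => (mk 1 (B.sharpMap ξ) t : DefSpace E H G τ)) ξ) := by
  refine AlternatingMap.ext fun α => ?_
  have hj := ((isFibreDiffeo_dual (E := E) (I := I) B ht).smooth ξ).mdifferentiableAt
    (by simp : (∞ : WithTop ℕ∞) ≠ 0)
  set a : Fin 2 → (E →L[ℝ] ℝ) →L[ℝ] ℝ := fun i => (α i).comp
    (mfderiv 𝓘(ℝ, E →L[ℝ] ℝ) (𝓘(ℝ, E).prod I)
      (fun ξ : E →L[ℝ] ℝ => (mk 1 (B.sharpMap ξ) t : DefSpace E H G τ)) ξ) with ha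
  let b : Fin 2 → E := fun i => bidual e (a i)
  let η : Fin 2 → E →L[ℝ] ℝ := fun i =>
    pullFundamental E act (mk 1 (B.sharpMap ξ) t : DefSpace E H G τ) (α i)
  have h1 : ∀ i (x : E), η i x = ξ (lieMap E G x (b i)) := fun i x => by
    have h := congrArg (fun L : E →L[ℝ] ℝ => L x) (pullFundamental_of_equivariant
      (isSmoothAction_coadj (E := E) (G := G)) hj (fun h => act_dual B ht h ξ) (α i))
    refine h.trans ((congrArg (a i) (fundamental_coadj ξ x)).trans ?_)
    exact (apply_bidual e _ (a i)).symm
  have h2 : ∀ i k, pullTranslate I (mk 1 (B.sharpMap ξ) t : DefSpace E H G τ) (α i)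
      (B.sharpMap (η k)) = η k (b i) := fun i k => by
    refine (pullTranslate_dual B ht ξ (α i) _).trans ?_
    refine (congrArg (a i) (B.flat_sharp (η k))).trans ?_
    exact (apply_bidual e _ (a i)).symm
  refine (deformationBivector_apply B e _ α).trans ?_
  refine Eq.trans ?_ (linearBivector_apply e ξ a).symm
  refine (congrArg₂ (fun x y : ℝ => -(1 / 2) * (x - y)) (h2 1 0) (h2 0 1)).trans ?_
  rw [h1, h1, lieMap_swap (b 0) (b 1), map_neg]
  change _ = ξ (lieMap E G (b 0) (b 1))
  ring

end LieFibre

end DefSpace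

/-! ### The Poisson deformation -/

namespace DefSpace

variable {E : Type*} [NormedAddCommGroup E] [NormedSpace ℝ E] [FiniteDimensional ℝ E]
  {G : Type*} [TopologicalSpace G] [ChartedSpace E G] [Group G] [LieGroup 𝓘(ℝ, E) ∞ G]
  {ES H : Type*} [NormedAddCommGroup ES] [NormedSpace ℝ ES] [TopologicalSpace H]
  {I : ModelWithCorners ℝ ES H} {S : Type*} [TopologicalSpace S] [ChartedSpace H S]
  [IsManifold I ∞ S] {τ : C(S, ℝ)} [hτ : Fact (ContMDiff I 𝓘(ℝ, ℝ) ∞ τ)]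
  {ι : Type*} [Fintype ι] [DecidableEq ι]

lemma toGroupDeformation_id (q : GroupDeformation E G) : q.toGroupDeformation = q := by
  rcases q with ⟨g, t, ht⟩ | ⟨y, t, ht⟩ <;> rfl

lemma toGroupDeformation_act (h : G) (q : DefSpace E H G τ) :
    (q.act h).toGroupDeformation = q.toGroupDeformation.act h := by
  rcases q with ⟨g, t, ht⟩ | ⟨y, t, ht⟩ <;> rfl

lemma proj_toGroupDeformation (q : DefSpace E H G τ) :
    q.toGroupDeformation.proj = τ q.proj := by
  rcases q with ⟨g, t, ht⟩ | ⟨y, t, ht⟩ <;> rfl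

lemma contMDiff_toGroupDeformation : ContMDiff (𝓘(ℝ, E).prod I) (𝓘(ℝ, E).prod 𝓘(ℝ, ℝ)) ∞
    (toGroupDeformation : DefSpace E H G τ → GroupDeformation E G) := by
  have : Fact (ContMDiff 𝓘(ℝ, ℝ) 𝓘(ℝ, ℝ) ∞ (ContinuousMap.id ℝ)) := ⟨contMDiff_id⟩
  intro q
  refine contMDiffAt_of_components ?_ ?_ fun h0 => ?_
  · have e : (fun q : DefSpace E H G τ => q.toGroupDeformation.blowDown) = blowDown := by
      funext q
      rcases q with ⟨g, t, ht⟩ | ⟨y, t, ht⟩ <;> rfl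
    rw [e]
    exact contMDiff_blowDown q
  · simp only [proj_toGroupDeformation]
    exact (hτ.out.comp contMDiff_proj) q
  · have e : (fun q : DefSpace E H G τ => q.toGroupDeformation.scaled) = scaled := by
      funext q
      rcases q with ⟨g, t, ht⟩ | ⟨y, t, ht⟩ <;> rfl
    rw [e]
    refine contMDiffAt_scaled ?_
    rw [blowDown_of_eq q (by rwa [proj_toGroupDeformation] at h0)]
    exact mem_chart_source E (1 : G)

variable (I) in
/-- The deformation space over `(S, τ)` is a Poisson deformation of `(G, P_G)` to `𝔤*`. -/
theorem isPoissonDeformation [CompactSpace G] [T2Space G] [T2Space S] [SecondCountableTopology S]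
    [SecondCountableTopology H] (B : InvariantForm E G)
    (e : Module.Basis ι ℝ (GroupLieAlgebra 𝓘(ℝ, E) G)) :
    IsPoissonDeformation 𝓘(ℝ, E) 𝓘(ℝ, E →L[ℝ] ℝ) I (𝓘(ℝ, E).prod I) τ B e
      (fun g h : G => g * h * g⁻¹) (groupBivector B e)
      (cartanField 𝓘(ℝ, E) B e fun g h : G => g * h * g⁻¹) id
      (coadj (G := G)) (linearBivector e) id
      (proj : DefSpace E H G τ → S) act toGroupDeformation
      (deformationBivector I B e) (deformationTrivector I B e)
      (fun t g => mk g 0 t) (fun t ξ => mk 1 (B.sharp ξ) t) := by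
  have : SecondCountableTopology G := ChartedSpace.secondCountable_of_sigmaCompact E G
  exact
  { source_isHamiltonian := isHamiltonianQuasiPoisson_group B e
    target_isHamiltonian := isHamiltonianPoisson_dual e
    isManifold := isManifold
    t2 := t2Space hτ.out
    secondCountable := secondCountable
    submersion := isSubmersion_proj I
    submersion_invariant := proj_act
    action := isSmoothAction_act
    moment_smooth := contMDiff_toGroupDeformation
    moment_equivariant := toGroupDeformation_act
    moment_proj := proj_toGroupDeformation
    bivector_smooth := isSmooth_deformationBivector B e
    bivector_vertical := isVertical_deformationBivector B e
    trivector_smooth := isSmooth_deformationTrivector B e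
    trivector_vertical := isVertical_deformationTrivector B e
    rescaled_isHamiltonian := fun t ht => (isHamiltonianQuasiPoisson_group B e).scale ht
    fibre_diffeo := fun t ht => isFibreDiffeo_group ht
    fibre_equivariant := fun t _ h g => (act_group t h g).symm
    fibre_bivector := fun t ht g => deformationBivector_group B e ht g
    fibre_trivector := fun t ht g => deformationTrivector_group B e ht g
    fibre_moment := fun t ht g => congrArg toGroupDeformation (mk_of_ne g 0 ht)
    zero_diffeo := fun t ht => isFibreDiffeo_dual B ht
    zero_equivariant := fun t ht h ξ => (act_dual B ht h ξ).symm
    zero_bivector := fun t ht ξ => deformationBivector_dual B e ht ξ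
    zero_trivector := fun t ht ξ => by
      have h : τ (mk 1 (B.sharpMap ξ) t : DefSpace E H G τ).proj = 0 :=
        (congrArg τ (proj_mk _ _ t)).trans ht
      refine (congrArg (fun c : ℝ => (c ^ 2) • _) h).trans ?_
      rw [zero_pow two_ne_zero, zero_smul]
    zero_moment := fun t ht ξ => congrArg toGroupDeformation (mk_of_eq 1 (B.sharpMap ξ) ht) }

end DefSpace

theorem mainTheorem1
    {E : Type*} [NormedAddCommGroup E] [NormedSpace ℝ E] [FiniteDimensional ℝ E]
    {G : Type*} [TopologicalSpace G] [ChartedSpace E G] [Group G] [LieGroup 𝓘(ℝ, E) ∞ G]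
    [CompactSpace G] [T2Space G]
    (B : InvariantForm E G)
    {ι : Type*} [Fintype ι] [DecidableEq ι]
    (e : Module.Basis ι ℝ (GroupLieAlgebra 𝓘(ℝ, E) G)) :
    -- the whole deformation space `𝒢`, over `ℝ`
    (∃ (P : KVectorField (𝓘(ℝ, E).prod 𝓘(ℝ, ℝ)) (GroupDeformation E G) 2)
        (Φ : KVectorField (𝓘(ℝ, E).prod 𝓘(ℝ, ℝ)) (GroupDeformation E G) 3),
      IsPoissonDeformation 𝓘(ℝ, E) 𝓘(ℝ, E →L[ℝ] ℝ) 𝓘(ℝ, ℝ) (𝓘(ℝ, E).prod 𝓘(ℝ, ℝ))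
        (ContinuousMap.id ℝ) B e
        (fun g h : G => g * h * g⁻¹) (groupBivector B e)
        (cartanField 𝓘(ℝ, E) B e fun g h : G => g * h * g⁻¹) id
        (coadj (G := G)) (linearBivector e) id
        DefSpace.proj DefSpace.act id P Φ
        (fun t g => DefSpace.mk g 0 t) (fun t ξ => DefSpace.mk 1 (B.sharp ξ) t)) ∧
    -- its part over `[0,1]`
    (∃ (P : KVectorField (𝓘(ℝ, E).prod (𝓡∂ 1)) (UnitGroupDeformation E G) 2)
        (Φ : KVectorField (𝓘(ℝ, E).prod (𝓡∂ 1)) (UnitGroupDeformation E G) 3),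
      IsPoissonDeformation 𝓘(ℝ, E) 𝓘(ℝ, E →L[ℝ] ℝ) (𝓡∂ 1) (𝓘(ℝ, E).prod (𝓡∂ 1))
        unitInclusion B e
        (fun g h : G => g * h * g⁻¹) (groupBivector B e)
        (cartanField 𝓘(ℝ, E) B e fun g h : G => g * h * g⁻¹) id
        (coadj (G := G)) (linearBivector e) id
        DefSpace.proj DefSpace.act DefSpace.toGroupDeformation P Φ
        (fun t g => DefSpace.mk g 0 t) (fun t ξ => DefSpace.mk 1 (B.sharp ξ) t)) := by
  constructor
  · have : Fact (ContMDiff 𝓘(ℝ, ℝ) 𝓘(ℝ, ℝ) ∞ (ContinuousMap.id ℝ)) := ⟨contMDiff_id⟩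
    have h := DefSpace.isPoissonDeformation 𝓘(ℝ, ℝ) (τ := ContinuousMap.id ℝ) B e
    have e1 : (DefSpace.toGroupDeformation : GroupDeformation E G → GroupDeformation E G) = id :=
      funext DefSpace.toGroupDeformation_id
    rw [e1] at h
    exact ⟨_, _, h⟩
  · have : Fact ((0 : ℝ) < 1) := ⟨one_pos⟩
    have : Fact (ContMDiff (𝓡∂ 1) 𝓘(ℝ, ℝ) ∞ unitInclusion) := ⟨contMDiff_subtypeVal_Icc⟩
    have : SecondCountableTopology (EuclideanHalfSpace 1) :=
      inferInstanceAs (SecondCountableTopology {x : EuclideanSpace ℝ (Fin 1) // 0 ≤ x 0})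
    exact ⟨_, _, DefSpace.isPoissonDeformation (𝓡∂ 1) (τ := unitInclusion) B e⟩
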